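/- Let $\Omega=(0,\pi)\times(-1,0)$ and let $\mathcal H^1(\Omega)$ be the usual (complex) Sobolev space. Let $$H=\Big\{\eta\in L^2[0,\pi]\ \Big|\ \int_0^\pi\eta(x)\,dx=0\Big\},\qquad \varphi_k(x)=\sqrt{2/\pi}\,\cos(kx),\qquad \eta_k=\langle\eta,\varphi_k\rangle_{L^2[0,\pi]}\quad(k\ge 1),$$ where $H$ carries the inner product of $L^2[0,\pi]$, and for $\alpha\ge 0$ let $H_\alpha=\{\eta\in H\mid\sum_{k\ge1}k^{2\alpha}|\eta_k|^2<\infty\}$ with the inner product $\langle\eta,\psi\rangle_\alpha=\sum_{k\ge 1}k^{2\alpha}\eta_k\overline{\psi_k}$. Let $h\in L^2[-1,0]$ with $\int_{-1}^0h(y)\,dy=0$, and let $X=H_{1/2}\times H$. For $u\in L^2_{loc}([0,\infty);\mathbb C)$, a *(weak) solution* of the water wave system $$\Delta\phi=0\ \text{in }\Omega,\quad \phi(t,x,0)+\zeta(t,x)=0,\quad \partial_y\phi(t,x,0)=\ddot\zeta(t,x),\quad \partial_x\phi(t,0,y)=-h(y)u(t),\quad \partial_y\phi(t,x,-1)=0=\partial_x\phi(t,\pi,y)$$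 is a pair $(\phi,\zeta)$ with $\phi\in L^2_{loc}([0,\infty);\mathcal H^1(\Omega))$ and $\zeta\in C([0,\infty);H_{1/2})\cap C^1([0,\infty);H)$ such that $\phi(t,\cdot,0)+\zeta(t,\cdot)=0$ in $L^2_{loc}([0,\infty);L^2[0,\pi])$ (in the sense of traces) and, for every $\Psi\in\mathcal H^1(\Omega)$ and every $t>0$, $$\int_0^\pi\dot\zeta(t,x)\overline{\Psi(x,0)}\,dx-\int_0^\pi\dot\zeta(0,x)\overline{\Psi(x,0)}\,dx=\int_0^t\!\int_\Omega\nabla\phi(\sigma,x,y)\cdot\overline{\nabla\Psi(x,y)}\,dx\,dy\,d\sigma-\int_0^tu(\sigma)\int_{-1}^0h(y)\overline{\Psi(0,y)}\,dy\,d\sigma .$$ A *well-posed linear control system* with Hilbert state space $X$ and Hilbert input space $U$ is a pair $(\mathbb T,\Phi)$, where $\mathbb T=(\mathbb T_t)_{t\ge0}$ is a strongly continuous semigroup of operators on $X$ and $\Phi=(\Phi_t)_{t\ge0}$ are bounded linear operators $L^2([0,\infty);U)\to X$ such that $\Phi_{\tau+t}w=\mathbb T_t\Phi_\tau u+\Phi_tv$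 for all $t,\tau\ge 0$ and $u,v\in L^2([0,\infty);U)$, where $w(s)=u(s)$ for $s<\tau$ and $w(s)=v(s-\tau)$ for $s\ge\tau$. For $u\in L^2_{loc}([0,\infty);U)$ the vector $\Phi_\tau u$ is defined as $\Phi_\tau$ applied to the truncation of $u$ to $[0,\tau]$. **Theorem.** 1. For every $u\in L^2_{loc}([0,\infty);\mathbb C)$, $\zeta_0\in H_{1/2}$ and $w_0\in H$ there exists a unique solution $(\phi,\zeta)$ with $\zeta(0)=\zeta_0$ and $\dot\zeta(0)=w_0$. 2. There exists a well-posed linear control system $(\mathbb T,\Phi)$ with state space $X$ and input space $\mathbb C$, depending only on $h$, such that for every $u,\zeta_0,w_0$ as in 1 the corresponding solution satisfies $$\begin{bmatrix}\zeta(\tau)\\ \dot\zeta(\tau)\end{bmatrix}=\mathbb T_\tau\begin{bmatrix}\zeta_0\\ w_0\end{bmatrix}+\Phi_\tau u\qquad\text{for all }\tau\ge0 .$$ 3. The generator $A$ of $\mathbb T$ has domain $\mathcal D(A)=H_1\times H_{1/2}$, and it is skew-adjoint with respect to the inner product $$\left\langle\begin{bmatrix}\eta\\ w\end{bmatrix},\begin{bmatrix}\psi\\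 v\end{bmatrix}\right\rangle=\sum_{k\ge1}k\tanh(k)\,\eta_k\overline{\psi_k}+\langle w,v\rangle_{L^2[0,\pi]}$$ on $X$, which is equivalent to the original inner product of $X$. 4. There exists a bounded operator $B\in\mathcal L(\mathbb C,X)$ such that $$\Phi_\tau u=\int_0^\tau\mathbb T_{\tau-\sigma}Bu(\sigma)\,d\sigma\qquad\text{for all }\tau\ge0,\ u\in L^2_{loc}([0,\infty);\mathbb C).$$ -/

import Mathlib

open MeasureTheory Set Filter Topology
open scoped ENNReal NNReal ContDiff InnerProductSpace

noncomputable section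

namespace WaterWave

/-! ### The spaces `L²[0,π]`, `L²[-1,0]`, `L²(Ω)` -/

/-- `L²[0,π]` (complex valued). -/
abbrev L2Top : Type := Lp ℂ 2 (volume.restrict (Icc (0 : ℝ) Real.pi))

/-- `L²[-1,0]` (complex valued). -/
abbrev L2Side : Type := Lp ℂ 2 (volume.restrict (Icc (-1 : ℝ) 0))

/-- The rectangle `Ω = (0,π) × (-1,0)`. -/
def Omega : Set (ℝ × ℝ) := Ioo 0 Real.pi ×ˢ Ioo (-1) 0

/-- `L²(Ω)` (complex valued). -/
abbrev L2Omega : Type := Lp ℂ 2 ((volume : Measure (ℝ × ℝ)).restrict Omega)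

/-- `f ∈ L²_loc([0,∞); E)`; only the values `f t` for `t ≥ 0` matter. -/
def MemL2Loc {E : Type*} [NormedAddCommGroup E] (f : ℝ → E) : Prop :=
  ∀ T : ℝ, 0 < T → MemLp f 2 (volume.restrict (Icc 0 T))

/-! ### The Hilbert space `H` of zero-mean functions and its cosine basis -/

/-- `H = {η ∈ L²[0,π] | ∫₀^π η = 0}` with the inner product of `L²[0,π]`. -/
def H : Submodule ℂ L2Top where
  carrier := {η | ∫ x in Icc 0 Real.pi, η x = 0}
  zero_mem' := by
    show ∫ x in Icc 0 Real.pi, (0 : L2Top) x = 0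
    rw [integral_congr_ae (Lp.coeFn_zero ℂ 2 (volume.restrict (Icc (0 : ℝ) Real.pi)))]
    simp
  add_mem' := by
    intro a b ha hb
    have ia : Integrable a (volume.restrict (Icc (0 : ℝ) Real.pi)) :=
      (Lp.memLp a).integrable one_le_two
    have ib : Integrable b (volume.restrict (Icc (0 : ℝ) Real.pi)) :=
      (Lp.memLp b).integrable one_le_two
    show ∫ x in Icc 0 Real.pi, (a + b : L2Top) x = 0
    rw [integral_congr_ae (Lp.coeFn_add a b)]
    simp only [Pi.add_apply]
    rw [integral_add ia ib, show ∫ x in Icc 0 Real.pi, a x = 0 from ha,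
      show ∫ x in Icc 0 Real.pi, b x = 0 from hb, add_zero]
  smul_mem' := by
    intro c a ha
    show ∫ x in Icc 0 Real.pi, (c • a : L2Top) x = 0
    rw [integral_congr_ae (Lp.coeFn_smul c a)]
    simp only [Pi.smul_apply]
    rw [integral_smul, show ∫ x in Icc 0 Real.pi, a x = 0 from ha, smul_zero]

lemma mem_H_iff (η : L2Top) : η ∈ H ↔ ∫ x in Icc 0 Real.pi, η x = 0 := Iff.rfl

/-- `φ_k(x) = √(2/π) cos(kx)`. -/
def cosFun (k : ℕ+) (x : ℝ) : ℂ := ((Real.sqrt (2 / Real.pi) * Real.cos ((k : ℕ) * x) : ℝ) : ℂ)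

lemma continuous_cosFun (k : ℕ+) : Continuous (cosFun k) := by
  unfold cosFun; fun_prop

lemma memLp_of_continuous {f : ℝ → ℂ} (hf : Continuous f) :
    MemLp f 2 (volume.restrict (Icc (0 : ℝ) Real.pi)) := by
  obtain ⟨C, hC⟩ := (isCompact_Icc (a := (0 : ℝ)) (b := Real.pi)).exists_bound_of_continuousOn
    hf.continuousOn
  refine MemLp.of_bound hf.aestronglyMeasurable C ?_
  exact (ae_restrict_iff' measurableSet_Icc).2 (Eventually.of_forall hC)

lemma integral_cos_int (n : ℤ) :
    ∫ x in Icc 0 Real.pi, Real.cos (n * x) = if n = 0 then Real.pi else 0 := by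
  rw [integral_Icc_eq_integral_Ioc, ← intervalIntegral.integral_of_le Real.pi_pos.le]
  split_ifs with h
  · subst h; simp
  · have hn : (n : ℝ) ≠ 0 := by exact_mod_cast h
    rw [intervalIntegral.integral_comp_mul_left (fun x => Real.cos x) hn]
    simp

/-- `φ_k` as an element of `H`. -/
def cosH (k : ℕ+) : H :=
  ⟨(memLp_of_continuous (continuous_cosFun k)).toLp (cosFun k), by
    rw [mem_H_iff, integral_congr_ae (MemLp.coeFn_toLp _)]
    unfold cosFun
    rw [integral_complex_ofReal, integral_const_mul]
    have := integral_cos_int ((k : ℕ) : ℤ)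
    rw [if_neg (by exact_mod_cast k.ne_zero)] at this
    push_cast at this
    rw [this]; simp⟩

/-- The Fourier coefficient `η_k = ⟨η, φ_k⟩ = ∫₀^π η φ_k`
(Mathlib's inner product is conjugate-linear in its first argument). -/
def coeff (η : H) (k : ℕ+) : ℂ := ⟪cosH k, η⟫_ℂ

lemma coeff_eq_integral (η : H) (k : ℕ+) :
    coeff η k = ∫ x in Icc 0 Real.pi, cosFun k x * (η : L2Top) x := by
  unfold coeff
  rw [Submodule.coe_inner, L2.inner_def]
  refine integral_congr_ae ?_
  filter_upwards [MemLp.coeFn_toLp (memLp_of_continuous (continuous_cosFun k))] with x hx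
  simp only [cosH, RCLike.inner_apply]
  rw [hx, cosFun, Complex.conj_ofReal, mul_comm]

lemma cosH_orthonormal : Orthonormal ℂ cosH := by
  rw [orthonormal_iff_ite]
  intro j k
  have h1 : ⟪cosH j, cosH k⟫_ℂ = ∫ x in Icc 0 Real.pi,
      (((1 / Real.pi) * (Real.cos (((j : ℕ) - (k : ℕ) : ℤ) * x)
        + Real.cos (((j : ℕ) + (k : ℕ) : ℤ) * x)) : ℝ) : ℂ) := by
    rw [← coeff, coeff_eq_integral]
    refine integral_congr_ae ?_
    filter_upwards [MemLp.coeFn_toLp (memLp_of_continuous (continuous_cosFun k))] with x hx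
    simp only [cosH]
    rw [hx]
    simp only [cosFun]
    rw [← Complex.ofReal_mul]
    congr 1
    push_cast
    rw [sub_mul, add_mul, Real.cos_sub, Real.cos_add]
    have := Real.mul_self_sqrt (show (0 : ℝ) ≤ 2 / Real.pi by positivity)
    linear_combination (Real.cos ((j : ℕ) * x) * Real.cos ((k : ℕ) * x)) * this
  rw [h1, integral_complex_ofReal, integral_const_mul, integral_add, integral_cos_int, integral_cos_int]
  · have hk := k.pos
    have hj := j.pos
    rw [if_neg (show ((j : ℕ) + (k : ℕ) : ℤ) ≠ 0 by omega)]
    by_cases hjk : j = k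
    · subst hjk; simp
    · have : ((j : ℕ) - (k : ℕ) : ℤ) ≠ 0 := by
        intro h0; exact hjk (PNat.eq (by omega))
      rw [if_neg this, if_neg hjk]; simp
  · exact (by fun_prop : Continuous fun x : ℝ => Real.cos (((j : ℕ) - (k : ℕ) : ℤ) * x)).continuousOn.integrableOn_compact isCompact_Icc
  · exact (by fun_prop : Continuous fun x : ℝ => Real.cos (((j : ℕ) + (k : ℕ) : ℤ) * x)).continuousOn.integrableOn_compact isCompact_Icc

/-- The cosines `φ_k`, `k ≥ 1`, are total in `H`. -/
lemma eq_zero_of_coeff_eq_zero (η : H) (h : ∀ k, coeff η k = 0) : η = 0 := by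
  set f : ℝ → ℂ := ⇑(η : L2Top) with hf
  have hint : IntegrableOn f (Icc 0 Real.pi) := (Lp.memLp (η : L2Top)).integrable one_le_two
  -- all cosine moments vanish
  have hcos : ∀ k : ℤ, ∫ x in Icc 0 Real.pi, ((Real.cos (k * x) : ℝ) : ℂ) * f x = 0 := by
    intro k
    rcases eq_or_ne k 0 with rfl | hk
    · simpa using (mem_H_iff _).1 η.2
    · have hpos : 0 < k.natAbs := Int.natAbs_pos.2 hk
      have h1 := (coeff_eq_integral η ⟨k.natAbs, hpos⟩).symm.trans (h ⟨k.natAbs, hpos⟩)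
      have h2 : ∀ x : ℝ, cosFun ⟨k.natAbs, hpos⟩ x * f x
          = ((Real.sqrt (2 / Real.pi) : ℝ) : ℂ) * (((Real.cos (k * x) : ℝ) : ℂ) * f x) := by
        intro x
        have : Real.cos ((k.natAbs : ℝ) * x) = Real.cos (k * x) := by
          rw [Nat.cast_natAbs, Int.cast_abs]
          rcases abs_choice (k : ℝ) with hk' | hk'
          · rw [hk']
          · rw [hk', neg_mul, Real.cos_neg]
        simp only [cosFun, PNat.mk_coe]
        rw [this]; push_cast; ring
      simp only [← hf, h2] at h1
      rw [integral_const_mul] at h1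
      rcases mul_eq_zero.1 h1 with h3 | h3
      · exfalso
        have : (0 : ℝ) < Real.sqrt (2 / Real.pi) := Real.sqrt_pos.2 (by positivity)
        exact this.ne' (by exact_mod_cast h3)
      · exact h3
  have hbd : ∀ g : ℝ → ℝ, Continuous g →
      IntegrableOn (fun x => ((g x : ℝ) : ℂ) * f x) (Icc 0 Real.pi) := by
    intro g hg
    exact hint.continuousOn_mul (by fun_prop) isCompact_Icc
  have hpow : ∀ n : ℕ, ∀ k : ℤ,
      ∫ x in Icc 0 Real.pi, ((Real.cos x ^ n * Real.cos (k * x) : ℝ) : ℂ) * f x = 0 := by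
    intro n
    induction n with
    | zero => intro k; simpa using hcos k
    | succ n ih =>
      intro k
      have e : ∀ x : ℝ, ((Real.cos x ^ (n + 1) * Real.cos (k * x) : ℝ) : ℂ) * f x
          = (1 / 2 : ℂ) * (((Real.cos x ^ n * Real.cos ((k + 1 : ℤ) * x) : ℝ) : ℂ) * f x
            + ((Real.cos x ^ n * Real.cos ((k - 1 : ℤ) * x) : ℝ) : ℂ) * f x) := by
        intro x
        have : Real.cos x * Real.cos (k * x)
            = 1 / 2 * (Real.cos ((k + 1 : ℤ) * x) + Real.cos ((k - 1 : ℤ) * x)) := by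
          push_cast
          rw [add_mul, sub_mul, one_mul, Real.cos_add, Real.cos_sub]; ring
        rw [pow_succ, mul_assoc, this]; push_cast; ring
      simp only [e]
      rw [integral_const_mul, integral_add (hbd _ (by fun_prop)) (hbd _ (by fun_prop)), ih, ih]
      simp
  have hpoly : ∀ p : Polynomial ℝ,
      ∫ x in Icc 0 Real.pi, ((p.eval (Real.cos x) : ℝ) : ℂ) * f x = 0 := by
    intro p
    induction p using Polynomial.induction_on' with
    | add p q hp hq =>
      simp only [Polynomial.eval_add, Complex.ofReal_add, add_mul]
      rw [integral_add (hbd _ (by fun_prop)) (hbd _ (by fun_prop)), hp, hq, add_zero]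
    | monomial n a =>
      have := hpow n 0
      simp only [Int.cast_zero, zero_mul, Real.cos_zero, mul_one] at this
      simp only [Polynomial.eval_monomial, Complex.ofReal_mul, mul_assoc]
      rw [integral_const_mul, this, mul_zero]
  have hcont : ∀ g : ℝ → ℝ, Continuous g →
      ∫ x in Icc 0 Real.pi, ((g x : ℝ) : ℂ) * f x = 0 := by
    intro g hg
    have hN : 0 ≤ ∫ x in Icc 0 Real.pi, ‖f x‖ := integral_nonneg fun _ => norm_nonneg _
    have key : ∀ ε : ℝ, 0 < ε →
        ‖∫ x in Icc 0 Real.pi, ((g x : ℝ) : ℂ) * f x‖ ≤ ε * ∫ x in Icc 0 Real.pi, ‖f x‖ := by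
      intro ε hε
      obtain ⟨p, hp⟩ := exists_polynomial_near_of_continuousOn (-1) 1 (fun t => g (Real.arccos t))
        (hg.comp Real.continuous_arccos).continuousOn ε hε
      have e1 : ∫ x in Icc 0 Real.pi, ((g x : ℝ) : ℂ) * f x
          = ∫ x in Icc 0 Real.pi, (((g x - p.eval (Real.cos x) : ℝ)) : ℂ) * f x := by
        simp only [Complex.ofReal_sub, sub_mul]
        rw [integral_sub (hbd _ hg) (hbd _ (by fun_prop)), hpoly, sub_zero]
      rw [e1, ← integral_const_mul]
      refine norm_integral_le_of_norm_le (hint.norm.const_mul ε) ?_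
      refine (ae_restrict_iff' measurableSet_Icc).2 (Eventually.of_forall fun x hx => ?_)
      rw [norm_mul]
      refine mul_le_mul_of_nonneg_right ?_ (norm_nonneg _)
      have := hp (Real.cos x) ⟨Real.neg_one_le_cos x, Real.cos_le_one x⟩
      rw [Real.arccos_cos hx.1 hx.2] at this
      rw [Complex.norm_real, Real.norm_eq_abs, abs_sub_comm]
      exact this.le
    by_contra hne
    have hpos := norm_pos_iff.2 hne
    set N := ∫ x in Icc 0 Real.pi, ‖f x‖
    set c := ‖∫ x in Icc 0 Real.pi, ((g x : ℝ) : ℂ) * f x‖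
    have h1 := key (c / (2 * (N + 1))) (by positivity)
    have h2 : c / (2 * (N + 1)) * N < c := by
      rw [div_mul_eq_mul_div, div_lt_iff₀ (by positivity)]
      nlinarith
    linarith
  have hae : ∀ᵐ x, x ∈ Ioo 0 Real.pi → f x = 0 := by
    refine isOpen_Ioo.ae_eq_zero_of_integral_contDiff_smul_eq_zero
      (hint.mono_set Ioo_subset_Icc_self).locallyIntegrableOn ?_
    intro g hg _ hsupp
    have h1 := hcont g hg.continuous
    rw [← h1, ← integral_indicator measurableSet_Icc]
    refine integral_congr_ae (Eventually.of_forall fun x => ?_)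
    by_cases hx : x ∈ Icc 0 Real.pi
    · simp [indicator_of_mem hx, Complex.real_smul]
    · have : g x = 0 := by
        by_contra hne
        exact hx (Ioo_subset_Icc_self (hsupp (subset_tsupport g hne)))
      simp [indicator_of_notMem hx, this]
  apply Subtype.ext
  apply Lp.ext
  rw [← hf]
  refine EventuallyEq.trans ?_ (Lp.coeFn_zero ℂ 2 (volume.restrict (Icc (0 : ℝ) Real.pi))).symm
  rw [EventuallyEq, Measure.restrict_congr_set Ioo_ae_eq_Icc.symm]
  exact (ae_restrict_iff' measurableSet_Ioo).2 hae

instance : CompleteSpace H := by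
  have : IsClosed (H : Set L2Top) := by
    set e : L2Top := (memLp_of_continuous (f := fun _ => (1 : ℂ)) continuous_const).toLp _
    have : (H : Set L2Top) = {η | ⟪e, η⟫_ℂ = 0} := by
      ext η
      rw [SetLike.mem_coe, mem_H_iff, mem_ofPred_eq, L2.inner_def]
      have : ∫ x in Icc 0 Real.pi, ⟪e x, η x⟫_ℂ = ∫ x in Icc 0 Real.pi, η x := by
        refine integral_congr_ae ?_
        filter_upwards [MemLp.coeFn_toLp
          (memLp_of_continuous (f := fun _ => (1 : ℂ)) continuous_const)] with x hx
        rw [hx]; simp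
      rw [this]
    rw [this]
    exact isClosed_eq (by fun_prop) continuous_const
  exact this.completeSpace_coe

/-- `(φ_k)` as a Hilbert basis of `H`. -/
def cosBasis : HilbertBasis ℕ+ ℂ H :=
  HilbertBasis.mkOfOrthogonalEqBot cosH_orthonormal (by
    rw [Submodule.eq_bot_iff]
    intro η hη
    refine eq_zero_of_coeff_eq_zero η fun k => ?_
    exact (Submodule.mem_orthogonal _ _).1 hη _ (Submodule.subset_span ⟨k, rfl⟩))

lemma cosBasis_repr (η : H) (k : ℕ+) : cosBasis.repr η k = coeff η k := by
  rw [HilbertBasis.repr_apply_apply, cosBasis, HilbertBasis.coe_mkOfOrthogonalEqBot]; rfl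

lemma coeff_add (η ψ : H) (k : ℕ+) : coeff (η + ψ) k = coeff η k + coeff ψ k := by
  unfold coeff; exact inner_add_right (𝕜 := ℂ) (cosH k) η ψ

lemma coeff_smul (c : ℂ) (η : H) (k : ℕ+) : coeff (c • η) k = c * coeff η k := by
  unfold coeff; exact inner_smul_right (𝕜 := ℂ) (cosH k) η c

lemma coeff_zero (k : ℕ+) : coeff 0 k = 0 := by
  unfold coeff; exact inner_zero_right (𝕜 := ℂ) (cosH k)

/-! ### The scale of Hilbert spaces `H_α`, `α ≥ 0` -/

lemma rpow_two_mul (k : ℕ+) (α : ℝ≥0) :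
    ((k : ℕ) : ℝ) ^ (2 * (α : ℝ)) = (((k : ℕ) : ℝ) ^ (α : ℝ)) ^ 2 := by
  rw [mul_comm, Real.rpow_mul (Nat.cast_nonneg _), ← Real.rpow_natCast]
  norm_num

lemma memlp_weighted_iff (α : ℝ≥0) (η : H) :
    Memℓp (fun k : ℕ+ => ((((k : ℕ) : ℝ) ^ (α : ℝ) : ℝ) : ℂ) * coeff η k) 2 ↔
      Summable fun k : ℕ+ => ((k : ℕ) : ℝ) ^ (2 * (α : ℝ)) * ‖coeff η k‖ ^ 2 := by
  rw [memℓp_gen_iff (by norm_num)]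
  refine summable_congr fun k => ?_
  rw [rpow_two_mul, norm_mul, Complex.norm_real, Real.norm_eq_abs]
  norm_num [mul_pow]

/-- `H_α = {η ∈ H | ∑_{k ≥ 1} k^{2α} |η_k|² < ∞}` as a subspace of `H`. -/
def HScale (α : ℝ≥0) : Submodule ℂ H where
  carrier := {η | Summable fun k : ℕ+ => ((k : ℕ) : ℝ) ^ (2 * (α : ℝ)) * ‖coeff η k‖ ^ 2}
  zero_mem' := by
    simp [coeff_zero, summable_zero]
  add_mem' := by
    intro a b ha hb
    rw [mem_ofPred_eq, ← memlp_weighted_iff] at *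
    convert ha.add hb using 1
    ext k
    simp only [coeff_add, Pi.add_apply, mul_add]
  smul_mem' := by
    intro c a ha
    rw [mem_ofPred_eq, ← memlp_weighted_iff] at *
    convert ha.const_smul c using 1
    ext k
    simp only [coeff_smul, Pi.smul_apply, smul_eq_mul]
    ring

/-- The Hilbert space `H_α`: the vector space `HScale α`, equipped below with its own inner
product `⟨η, ψ⟩_α = ∑_{k ≥ 1} k^{2α} η_k conj(ψ_k)` (and not with the one inherited from `H`). -/
def HAlpha (α : ℝ≥0) : Type := HScale α

instance (α : ℝ≥0) : AddCommGroup (HAlpha α) := inferInstanceAs (AddCommGroup (HScale α))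

instance (α : ℝ≥0) : Module ℂ (HAlpha α) := inferInstanceAs (Module ℂ (HScale α))

/-- The inclusion `H_α ⊆ H`. -/
def HAlpha.toH {α : ℝ≥0} : HAlpha α →ₗ[ℂ] H := (HScale α).subtype

/-- The map `η ↦ (k^α η_k)_k` from `H_α` to `ℓ²`. -/
def HAlpha.toSeq (α : ℝ≥0) : HAlpha α →ₗ[ℂ] lp (fun _ : ℕ+ => ℂ) 2 where
  toFun η := ⟨fun k => ((((k : ℕ) : ℝ) ^ (α : ℝ) : ℝ) : ℂ) * coeff η.toH k,
    (memlp_weighted_iff α η.toH).2 η.2⟩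
  map_add' a b := by
    ext k
    simp only [map_add, coeff_add, mul_add, lp.coeFn_add, Pi.add_apply]
  map_smul' c a := by
    ext k
    simp only [map_smul, coeff_smul, RingHom.id_apply, lp.coeFn_smul, Pi.smul_apply, smul_eq_mul]
    ring

lemma rpow_pos_cast (k : ℕ+) (a : ℝ) : 0 < ((k : ℕ) : ℝ) ^ a :=
  Real.rpow_pos_of_pos (by exact_mod_cast k.pos) _

lemma HAlpha.toSeq_injective (α : ℝ≥0) : Function.Injective (HAlpha.toSeq α) := by
  rw [injective_iff_map_eq_zero]
  intro η h
  apply Subtype.ext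
  refine eq_zero_of_coeff_eq_zero _ fun k => ?_
  have h1 : ((((k : ℕ) : ℝ) ^ (α : ℝ) : ℝ) : ℂ) * coeff η.toH k = 0 :=
    congrArg (fun s : lp (fun _ : ℕ+ => ℂ) 2 => s k) h
  rcases mul_eq_zero.1 h1 with h2 | h2
  · exact absurd (by exact_mod_cast h2) (rpow_pos_cast k α).ne'
  · exact h2

lemma HAlpha.toSeq_surjective (α : ℝ≥0) : Function.Surjective (HAlpha.toSeq α) := by
  intro s
  have hs : Memℓp (fun k : ℕ+ => ((((k : ℕ) : ℝ) ^ (-(α : ℝ)) : ℝ) : ℂ) * s k) 2 := by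
    have h0 : (0 : ℝ) < (2 : ℝ≥0∞).toReal := by norm_num
    refine (memℓp_gen_iff h0).2 (Summable.of_nonneg_of_le (fun k => by positivity) (fun k => ?_)
      ((memℓp_gen_iff h0).1 (lp.memℓp s)))
    refine Real.rpow_le_rpow (norm_nonneg _) ?_ h0.le
    rw [norm_mul, Complex.norm_real, Real.norm_eq_abs, abs_of_pos (rpow_pos_cast k _)]
    refine mul_le_of_le_one_left (norm_nonneg _) ?_
    exact Real.rpow_le_one_of_one_le_of_nonpos (by exact_mod_cast k.pos) (by simp)
  set η : H := cosBasis.repr.symm ⟨_, hs⟩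
  have hη : ∀ k, coeff η k = ((((k : ℕ) : ℝ) ^ (-(α : ℝ)) : ℝ) : ℂ) * s k := by
    intro k
    rw [← cosBasis_repr, LinearIsometryEquiv.apply_symm_apply]
  have hk : ∀ k : ℕ+, ((((k : ℕ) : ℝ) ^ (α : ℝ) : ℝ) : ℂ) * coeff η k = s k := by
    intro k
    rw [hη, ← mul_assoc, ← Complex.ofReal_mul, ← Real.rpow_add (by exact_mod_cast k.pos)]
    simp
  refine ⟨⟨η, ?_⟩, ?_⟩
  · refine (memlp_weighted_iff α η).1 ?_
    simp only [hk]
    exact lp.memℓp s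
  · ext k
    exact hk k

instance (α : ℝ≥0) : NormedAddCommGroup (HAlpha α) :=
  NormedAddCommGroup.induced _ _ (HAlpha.toSeq α) (HAlpha.toSeq_injective α)

lemma HAlpha.norm_eq {α : ℝ≥0} (η : HAlpha α) : ‖η‖ = ‖HAlpha.toSeq α η‖ := rfl

/-- The sum `∑_{k ≥ 1} k^{2α} conj(η_k) ψ_k`. -/
def HAlpha.innerSum (α : ℝ≥0) (η ψ : HAlpha α) : ℂ :=
  ∑' k : ℕ+, ((((k : ℕ) : ℝ) ^ (2 * (α : ℝ)) : ℝ) : ℂ) *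
    (starRingEnd ℂ (coeff η.toH k) * coeff ψ.toH k)

lemma HAlpha.innerSum_eq (α : ℝ≥0) (η ψ : HAlpha α) :
    HAlpha.innerSum α η ψ = ⟪HAlpha.toSeq α η, HAlpha.toSeq α ψ⟫_ℂ := by
  rw [lp.inner_eq_tsum, HAlpha.innerSum]
  refine tsum_congr fun k => ?_
  simp only [HAlpha.toSeq, LinearMap.coe_mk, AddHom.coe_mk, RCLike.inner_apply, map_mul,
    Complex.conj_ofReal, rpow_two_mul]
  push_cast
  ring

/-- The inner product of `H_α`. In Mathlib's convention (conjugate-linear in the first argument)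
`⟪ψ, η⟫ = ∑_{k ≥ 1} k^{2α} η_k conj(ψ_k)`. -/
instance (α : ℝ≥0) : InnerProductSpace ℂ (HAlpha α) where
  norm_smul_le c η := by
    rw [HAlpha.norm_eq, HAlpha.norm_eq, map_smul, norm_smul]
  inner := HAlpha.innerSum α
  norm_sq_eq_re_inner η := by
    rw [HAlpha.innerSum_eq, HAlpha.norm_eq]
    exact norm_sq_eq_re_inner _
  conj_inner_symm η ψ := by
    simp only [HAlpha.innerSum_eq]
    exact inner_conj_symm _ _
  add_left a b c := by
    simp only [HAlpha.innerSum_eq, map_add]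
    exact inner_add_left _ _ _
  smul_left a b c := by
    simp only [HAlpha.innerSum_eq, map_smul]
    exact inner_smul_left _ _ _

instance (α : ℝ≥0) : CompleteSpace (HAlpha α) := by
  have hiso : Isometry (HAlpha.toSeq α) :=
    AddMonoidHomClass.isometry_of_norm (HAlpha.toSeq α) fun η => (HAlpha.norm_eq η).symm
  rw [hiso.isUniformInducing.completeSpace_congr (HAlpha.toSeq_surjective α)]
  infer_instance

/-- The state space `X = H_{1/2} × H`, a Hilbert space with
`⟪z, z'⟫ = ⟪z₁, z'₁⟫_{1/2} + ⟪z₂, z'₂⟫`. -/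
abbrev StateSpace : Type := WithLp 2 (HAlpha (1 / 2) × H)

/-! ### Well-posed linear control systems -/

/-- The `τ`-concatenation of two functions on `[0,∞)`. -/
def concat {U : Type*} (τ : ℝ) (u v : ℝ → U) : ℝ → U :=
  fun t => if t < τ then u t else v (t - τ)

/-- `L²([0,∞); U)`. -/
abbrev L2Input (U : Type*) [NormedAddCommGroup U] : Type _ :=
  Lp U 2 (volume.restrict (Ici (0 : ℝ)))

/-- A well-posed linear control system `(𝕋, Φ)` with input space `U` and state space `X`.
Only the operators `T t`, `Φ t` with `t ≥ 0` matter. -/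
structure WellPosedSystem (U X : Type*)
    [NormedAddCommGroup U] [InnerProductSpace ℂ U] [CompleteSpace U]
    [NormedAddCommGroup X] [InnerProductSpace ℂ X] [CompleteSpace X] where
  /-- the semigroup -/
  T : ℝ → X →L[ℂ] X
  /-- the input maps -/
  Φ : ℝ → L2Input U →L[ℂ] X
  T_zero : T 0 = ContinuousLinearMap.id ℂ X
  T_add : ∀ s t : ℝ, 0 ≤ s → 0 ≤ t → T (s + t) = (T s).comp (T t)
  T_cont : ∀ x : X, Tendsto (fun t => T t x) (𝓝[>] 0) (𝓝 x)
  /-- the composition property `Φ_{τ+t} (u ◇_τ v) = 𝕋_t Φ_τ u + Φ_t v` -/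
  Φ_concat : ∀ t τ : ℝ, 0 ≤ t → 0 ≤ τ → ∀ u v w : L2Input U,
    w =ᵐ[volume.restrict (Ici (0 : ℝ))] concat τ u v → Φ (τ + t) w = T t (Φ τ u) + Φ t v

lemma MemL2Loc.memLp_truncation {U : Type*} [NormedAddCommGroup U] {u : ℝ → U}
    (hu : MemL2Loc u) (τ : ℝ) :
    MemLp ((Icc 0 τ).indicator u) 2 (volume.restrict (Ici (0 : ℝ))) := by
  have h1 : MemLp ((Icc 0 τ).indicator u) 2 volume := by
    rw [memLp_indicator_iff_restrict measurableSet_Icc]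
    exact (hu (max τ 1) (by positivity)).mono_measure
      (Measure.restrict_mono (Icc_subset_Icc_right (le_max_left _ _)) le_rfl)
  exact h1.mono_measure Measure.restrict_le_self

namespace WellPosedSystem

variable {U X : Type*}
    [NormedAddCommGroup U] [InnerProductSpace ℂ U] [CompleteSpace U]
    [NormedAddCommGroup X] [InnerProductSpace ℂ X] [CompleteSpace X]

/-- `Φ_τ u` for `u ∈ L²_loc([0,∞); U)`: the input map applied to the truncation of `u` to
`[0,τ]`. -/
def inputMap (S : WellPosedSystem U X) (τ : ℝ) (u : ℝ → U) (hu : MemL2Loc u) : X :=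
  S.Φ τ ((hu.memLp_truncation τ).toLp ((Icc 0 τ).indicator u))

/-- `A` is the generator of the semigroup: its graph consists of the pairs `(x, y)` with
`y = lim_{t → 0+} (𝕋_t x - x) / t`. -/
def IsGenerator (S : WellPosedSystem U X) (A : X →ₗ.[ℂ] X) : Prop :=
  ∀ x y : X, (x, y) ∈ A.graph ↔
    Tendsto (fun t : ℝ => t⁻¹ • (S.T t x - x)) (𝓝[>] 0) (𝓝 y)

end WellPosedSystem

/-! ### Equivalent inner products and skew-adjointness -/

/-- `E` is an inner product on `X` (conjugate-linear in the first argument) whose norm is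
equivalent to the norm of `X`. -/
structure IsEquivalentInnerProduct {X : Type*} [NormedAddCommGroup X] [InnerProductSpace ℂ X]
    (E : X → X → ℂ) : Prop where
  conj_symm : ∀ x y, starRingEnd ℂ (E y x) = E x y
  add_right : ∀ x y z, E x (y + z) = E x y + E x z
  smul_right : ∀ (c : ℂ) (x y), E x (c • y) = c * E x y
  equiv : ∃ c C : ℝ, 0 < c ∧ 0 < C ∧
    ∀ x, c * ‖x‖ ^ 2 ≤ (E x x).re ∧ (E x x).re ≤ C * ‖x‖ ^ 2

/-- The operator `A` is skew-adjoint, `A* = -A`, with respect to the inner product `E`: it is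
densely defined, and a pair `(z, w)` is in the graph of the adjoint of `A` (that is,
`E z (A x) = E w x` for all `x` in the domain of `A`) if and only if it is in the graph of
`-A`. -/
def IsSkewAdjointWrt {X : Type*} [NormedAddCommGroup X] [InnerProductSpace ℂ X]
    (E : X → X → ℂ) (A : X →ₗ.[ℂ] X) : Prop :=
  Dense (A.domain : Set X) ∧
    ∀ z w : X, (∀ x : A.domain, E z (A x) = E w x) ↔ (z, w) ∈ (-A).graph

/-- The inner product
`∑_{k ≥ 1} k tanh(k) conj(z₁,k) z'₁,k + ⟪z₂, z'₂⟫` on `H_{1/2} × H`. Here `k tanh(k)` is the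
eigenvalue at `φ_k` of the Dirichlet-to-Neumann operator of the rectangle. -/
def energyInner (z z' : StateSpace) : ℂ :=
  ∑' k : ℕ+, ((((k : ℕ) : ℝ) * Real.tanh ((k : ℕ) : ℝ) : ℝ) : ℂ) *
    (starRingEnd ℂ (coeff z.fst.toH k) * coeff z'.fst.toH k) + ⟪z.snd, z'.snd⟫_ℂ

/-! ### The Sobolev space `ℋ¹(Ω)` and traces on two sides of the rectangle -/

/-- Smooth functions with compact support in `V`. -/
def IsTestFunction (V : Set (ℝ × ℝ)) (θ : ℝ × ℝ → ℝ) : Prop :=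
  ContDiff ℝ ∞ θ ∧ HasCompactSupport θ ∧ tsupport θ ⊆ V

lemma integrable_smul_L2Omega {θ : ℝ × ℝ → ℝ} (h1 : Continuous θ) (h2 : HasCompactSupport θ)
    (f : L2Omega) : IntegrableOn (fun p => θ p • f p) Omega := by
  have hb : Bornology.IsBounded Omega := (Metric.isBounded_Ioo _ _).prod (Metric.isBounded_Ioo _ _)
  have : IsFiniteMeasure ((volume : Measure (ℝ × ℝ)).restrict Omega) :=
    ⟨by rw [Measure.restrict_apply_univ]; exact hb.measure_lt_top⟩
  have hf : Integrable f (volume.restrict Omega) := (Lp.memLp f).integrable one_le_two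
  obtain ⟨C, hC⟩ := h2.exists_bound_of_continuous h1
  exact hf.bdd_smul C h1.aestronglyMeasurable (Eventually.of_forall hC)

/-- `g` is the weak derivative in direction `e` of `f` in `Ω`. -/
def IsWeakDeriv (e : ℝ × ℝ) (f g : L2Omega) : Prop :=
  ∀ θ : ℝ × ℝ → ℝ, IsTestFunction Omega θ →
    ∫ p in Omega, fderiv ℝ θ p e • f p = -∫ p in Omega, θ p • g p

lemma IsTestFunction.integrable {V : Set (ℝ × ℝ)} {θ : ℝ × ℝ → ℝ} (h : IsTestFunction V θ)
    (f : L2Omega) : IntegrableOn (fun p => θ p • f p) Omega :=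
  integrable_smul_L2Omega h.1.continuous h.2.1 f

lemma IsTestFunction.integrable_fderiv {V : Set (ℝ × ℝ)} {θ : ℝ × ℝ → ℝ}
    (h : IsTestFunction V θ) (e : ℝ × ℝ) (f : L2Omega) :
    IntegrableOn (fun p => fderiv ℝ θ p e • f p) Omega :=
  integrable_smul_L2Omega ((h.1.continuous_fderiv (by simp)).clm_apply continuous_const)
    (h.2.1.fderiv_apply (𝕜 := ℝ) e) f

lemma setIntegral_smul_add (θ : ℝ × ℝ → ℝ) (f g : L2Omega)
    (hf : IntegrableOn (fun p => θ p • f p) Omega) (hg : IntegrableOn (fun p => θ p • g p) Omega) :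
    ∫ p in Omega, θ p • (f + g : L2Omega) p
      = (∫ p in Omega, θ p • f p) + ∫ p in Omega, θ p • g p := by
  rw [← integral_add hf hg]
  refine integral_congr_ae ?_
  filter_upwards [Lp.coeFn_add f g] with p hp
  rw [hp, Pi.add_apply, smul_add]

lemma setIntegral_smul_smul (θ : ℝ × ℝ → ℝ) (c : ℂ) (f : L2Omega) :
    ∫ p in Omega, θ p • (c • f : L2Omega) p = c • ∫ p in Omega, θ p • f p := by
  rw [← integral_smul]
  refine integral_congr_ae ?_
  filter_upwards [Lp.coeFn_smul c f] with p hp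
  rw [hp, Pi.smul_apply, smul_comm]

lemma setIntegral_smul_zero (θ : ℝ × ℝ → ℝ) :
    ∫ p in Omega, θ p • (0 : L2Omega) p = 0 := by
  have := setIntegral_smul_smul θ 0 0
  simpa using this

lemma IsWeakDeriv.zero (e : ℝ × ℝ) : IsWeakDeriv e 0 0 := by
  intro θ _
  rw [setIntegral_smul_zero (fun p => fderiv ℝ θ p e), setIntegral_smul_zero, neg_zero]

lemma IsWeakDeriv.add {e : ℝ × ℝ} {f g f' g' : L2Omega} (h : IsWeakDeriv e f g)
    (h' : IsWeakDeriv e f' g') : IsWeakDeriv e (f + f') (g + g') := by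
  intro θ hθ
  rw [setIntegral_smul_add (fun p => fderiv ℝ θ p e) _ _ (hθ.integrable_fderiv e f)
      (hθ.integrable_fderiv e f'),
    setIntegral_smul_add _ _ _ (hθ.integrable g) (hθ.integrable g'), h θ hθ, h' θ hθ, neg_add]

lemma IsWeakDeriv.smul {e : ℝ × ℝ} (c : ℂ) {f g : L2Omega} (h : IsWeakDeriv e f g) :
    IsWeakDeriv e (c • f) (c • g) := by
  intro θ hθ
  rw [setIntegral_smul_smul (fun p => fderiv ℝ θ p e), setIntegral_smul_smul, h θ hθ, smul_neg]

/-- The Sobolev space `ℋ¹(Ω)`. A function `f ∈ ℋ¹(Ω)` is represented by the triple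
`(f, ∂f/∂x, ∂f/∂y)` in `L²(Ω)³`, whose last two entries are determined by the first; so the norm
inherited from `L²(Ω)³` is the usual norm
`‖f‖₁² = ‖f‖² + ‖∂f/∂x‖² + ‖∂f/∂y‖²`. -/
def H1Omega : Submodule ℂ (PiLp 2 (fun _ : Fin 3 => L2Omega)) where
  carrier := {F | IsWeakDeriv (1, 0) (F 0) (F 1) ∧ IsWeakDeriv (0, 1) (F 0) (F 2)}
  zero_mem' := ⟨IsWeakDeriv.zero _, IsWeakDeriv.zero _⟩
  add_mem' ha hb := ⟨ha.1.add hb.1, ha.2.add hb.2⟩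
  smul_mem' c _ ha := ⟨ha.1.smul c, ha.2.smul c⟩

namespace H1Omega

/-- The function `f` itself. -/
def val (F : H1Omega) : L2Omega := F.1 0

/-- The weak derivative `∂f/∂x`. -/
def dx (F : H1Omega) : L2Omega := F.1 1

/-- The weak derivative `∂f/∂y`. -/
def dy (F : H1Omega) : L2Omega := F.1 2

end H1Omega

/-- `g ∈ L²[0,π]` is the Dirichlet trace `f(·,0)` of `f ∈ ℋ¹(Ω)` on the top of `Ω`, given by
Green's formula `∫_Ω (∂θ/∂y f + θ ∂f/∂y) = ∫₀^π θ(x,0) g(x) dx` for all smooth `θ` with compact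
support in `(0,π) × (-1,∞)` (so `θ` vanishes near the other three sides). -/
def IsTopTrace (F : H1Omega) (g : L2Top) : Prop :=
  ∀ θ : ℝ × ℝ → ℝ, IsTestFunction (Ioo 0 Real.pi ×ˢ Ioi (-1)) θ →
    ∫ p in Omega, (fderiv ℝ θ p (0, 1) • H1Omega.val F p + θ p • H1Omega.dy F p)
      = ∫ x in Icc 0 Real.pi, θ (x, 0) • g x

/-- `g ∈ L²[-1,0]` is the Dirichlet trace `f(0,·)` of `f ∈ ℋ¹(Ω)` on the left side of `Ω`, given by
Green's formula `∫_Ω (∂θ/∂x f + θ ∂f/∂x) = -∫_{-1}^0 θ(0,y) g(y) dy` for all smooth `θ` with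
compact support in `(-∞,π) × (-1,0)`. -/
def IsLeftTrace (F : H1Omega) (g : L2Side) : Prop :=
  ∀ θ : ℝ × ℝ → ℝ, IsTestFunction (Iio Real.pi ×ˢ Ioo (-1) 0) θ →
    ∫ p in Omega, (fderiv ℝ θ p (1, 0) • H1Omega.val F p + θ p • H1Omega.dx F p)
      = -∫ y in Icc (-1) 0, θ (0, y) • g y

/-! ### Solutions of the water wave equations -/

/-- `∫_Ω ∇f · conj(∇Ψ) dx dy`. -/
def gradPairing (f Ψ : H1Omega) : ℂ := ⟪H1Omega.dx Ψ, H1Omega.dx f⟫_ℂ + ⟪H1Omega.dy Ψ, H1Omega.dy f⟫_ℂ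

/-- The time derivative `dζ/dt (t)`, in `H`, of a function `ζ` on `[0,∞)` (one-sided at `0`). -/
def velocity (ζ : ℝ → HAlpha (1 / 2)) (t : ℝ) : H :=
  derivWithin (fun s => (ζ s).toH) (Ici 0) t

/-- `(φ, ζ)` is a (weak) solution of the water wave equations with input `u` and wave maker
profile `h`. Only the values for `t ≥ 0` matter. The pairings `⟪g, v⟫` below are
`∫ v conj(g)`. -/
structure IsSolution (h : L2Side) (u : ℝ → ℂ) (φ : ℝ → H1Omega) (ζ : ℝ → HAlpha (1 / 2)) :
    Prop where
  /-- `φ ∈ L²_loc([0,∞); ℋ¹(Ω))` -/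
  phi_mem : MemL2Loc φ
  /-- `ζ ∈ C([0,∞); H_{1/2})` -/
  zeta_cont : ContinuousOn ζ (Ici 0)
  /-- `ζ ∈ C¹([0,∞); H)` -/
  zeta_diff : ContDiffOn ℝ 1 (fun t => (ζ t).toH) (Ici 0)
  /-- `φ(t,·,0) + ζ(t,·) = 0` in `L²_loc([0,∞); L²[0,π])` -/
  trace_eq : ∀ᵐ t ∂(volume.restrict (Ici (0 : ℝ))), IsTopTrace (φ t) (-((ζ t).toH : L2Top))
  /-- the variational equation, for all `Ψ ∈ ℋ¹(Ω)`, with traces `g = Ψ(·,0)`, `g' = Ψ(0,·)` -/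
  weak_eq : ∀ (Ψ : H1Omega) (g : L2Top) (g' : L2Side), IsTopTrace Ψ g → IsLeftTrace Ψ g' →
    ∀ t : ℝ, 0 < t →
      ⟪g, (velocity ζ t : L2Top)⟫_ℂ - ⟪g, (velocity ζ 0 : L2Top)⟫_ℂ
        = (∫ σ in (0 : ℝ)..t, gradPairing (φ σ) Ψ) - (∫ σ in (0 : ℝ)..t, u σ * ⟪g', h⟫_ℂ)

end WaterWave
end

open WaterWave

noncomputable section

namespace WaterWave

/-! ### The product rule for an exponential and an absolutely continuous function -/

/-! The problem splits into forced harmonic oscillators. The function `harm k`, that is φ_k(x)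
cosh(k(y+1))/cosh k, is harmonic, has vanishing normal derivative on the bottom and on both vertical
sides, and has normal derivative k tanh k times its trace on the top. Tested against `harm k`, the
weak equation sees the potential only through its top trace -ζ (`gradPairing_harm`). The
coefficients of a solution therefore satisfy ζ_k'' = -k tanh(k) ζ_k + b_k u in integrated form,
where b_k = -√(2/π) ∫ h(y) cosh(k(y+1))/cosh k dy.

With ω_k = √(k tanh k), the coordinates (ω_k ζ_k ± i ζ_k')/√2 decouple this into scalar equations
with rates ∓iω_k. They map X isomorphically onto ℓ² and carry the energy inner product to the
standard one (`stateEquiv`, `energyInner_eq`). The semigroup is thus a diagonal group of phases, and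
its generator is multiplication by imaginary numbers on the maximal domain, hence skew-adjoint
(`isSkewAdjointWrt_diagGen`). The bounds tanh(1) k ≤ k tanh k ≤ k identify this domain as H_1 ×
H_{1/2}. Duhamel's formula in each coordinate shows that every solution is a trajectory of the
system (`IsSolution.eq_waveTraj`), which gives uniqueness of ζ.

The control operator is bounded because (b_k) is square summable for every h in L². As
cosh(k(y+1))/cosh k ≤ 2 exp(ky), this is a Hilbert-type inequality for the numbers ∫ |h(y)| exp(ky)
dy, obtained from a weighted Cauchy-Schwarz inequality and a telescoping sum of arctangents
(`summable_sq_integral_mul_exp`).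

For existence, φ = -Dζ + uN, where D is the harmonic extension `dirExt` and N vanishes on the top
and carries the Neumann datum of the wave maker (Lax-Milgram, with Poincaré's inequality). The weak
equation has to hold for every Ψ. One writes Ψ = c + Dη + Ψ₀ with Ψ₀ zero on the top, which requires
that traces lie in H_{1/2} modulo constants (`exists_trace_decomposition`); the constant drops out
because h has mean zero. For uniqueness of φ, the difference of two potentials has zero top trace
and, for almost every t, is orthogonal in the Dirichlet form to the countable family of
eigenfunctions cos(kx) cos((m+1/2)π(y+1)), so it vanishes.

Weak derivatives and traces are defined by test functions supported away from the other sides. The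
lemmas `green_x`, `green_y` and `green_left` extend these identities by cut-offs to products
a(x)c(y) that vanish only at the endpoints where this is needed. -/

lemma hasDerivAt_exp_const_mul (c : ℂ) (x : ℝ) :
    HasDerivAt (fun s : ℝ => Complex.exp (c * s)) (c * Complex.exp (c * x)) x := by
  simpa [mul_comm] using ((hasDerivAt_id (x : ℂ)).const_mul c).cexp.comp_ofReal

/-- Fubini on the triangle r ≤ s turns the first term into the integral of (exp(ct) - exp(cr)) g(r),
and the second term cancels the subtracted part. No differentiability of the primitive of g is used,
so g need only be integrable. -/
lemma integral_exp_mul_add (c : ℂ) {g : ℝ → ℂ} {t : ℝ} (ht : 0 ≤ t)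
    (hg : IntervalIntegrable g volume 0 t) :
    ∫ s in (0 : ℝ)..t, (c * Complex.exp (c * s) * (∫ r in (0 : ℝ)..s, g r)
      + Complex.exp (c * s) * g s) = Complex.exp (c * t) * ∫ r in (0 : ℝ)..t, g r := by
  set μ : Measure ℝ := volume.restrict (Ioc 0 t) with hμ
  have hg1 : Integrable g μ := (intervalIntegrable_iff_integrableOn_Ioc_of_le ht).1 hg
  have hE : Continuous fun s : ℝ => c * Complex.exp (c * s) := by fun_prop
  have hE1 : Integrable (fun s : ℝ => c * Complex.exp (c * s)) μ :=
    (hE.intervalIntegrable 0 t).1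
  have hS : MeasurableSet {q : ℝ × ℝ | q.2 ≤ q.1} := measurableSet_le measurable_snd measurable_fst
  have hswap := integral_integral_swap (μ := μ) (ν := μ)
    (f := fun s r => indicator {q : ℝ × ℝ | q.2 ≤ q.1}
      (fun q => c * Complex.exp (c * q.1) * g q.2) (s, r)) ((hE1.mul_prod hg1).indicator hS)
  have h1 : ∀ s ∈ Ioc 0 t, ∫ r, indicator {q : ℝ × ℝ | q.2 ≤ q.1}
      (fun q => c * Complex.exp (c * q.1) * g q.2) (s, r) ∂μ
      = c * Complex.exp (c * s) * ∫ r in (0 : ℝ)..s, g r := by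
    intro s hs
    rw [intervalIntegral.integral_of_le hs.1.le, ← integral_const_mul]
    have : ∀ r, indicator {q : ℝ × ℝ | q.2 ≤ q.1} (fun q => c * Complex.exp (c * q.1) * g q.2) (s, r)
        = indicator (Iic s) (fun r => c * Complex.exp (c * s) * g r) r := by
      intro r
      simp [indicator]
    simp only [this]
    rw [integral_indicator measurableSet_Iic, hμ, Measure.restrict_restrict measurableSet_Iic]
    congr 2
    ext r
    simp only [mem_inter_iff, mem_Iic, mem_Ioc]
    constructor
    · rintro ⟨a, b, c⟩; exact ⟨b, a⟩
    · rintro ⟨a, b⟩; exact ⟨b, a, b.trans hs.2⟩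
  have h2 : ∀ r ∈ Ioc 0 t, ∫ s, indicator {q : ℝ × ℝ | q.2 ≤ q.1}
      (fun q => c * Complex.exp (c * q.1) * g q.2) (s, r) ∂μ
      = (Complex.exp (c * t) - Complex.exp (c * r)) * g r := by
    intro r hr
    have hd : ∀ x ∈ uIcc r t, HasDerivAt (fun s : ℝ => Complex.exp (c * s))
        (c * Complex.exp (c * x)) x := by
      exact fun x _ => hasDerivAt_exp_const_mul c x
    rw [← intervalIntegral.integral_eq_sub_of_hasDerivAt hd (hE.intervalIntegrable _ _),
      ← intervalIntegral.integral_mul_const, intervalIntegral.integral_of_le hr.2]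
    have : ∀ s, indicator {q : ℝ × ℝ | q.2 ≤ q.1} (fun q => c * Complex.exp (c * q.1) * g q.2) (s, r)
        = indicator (Ici r) (fun s => c * Complex.exp (c * s) * g r) s := by
      intro s
      simp [indicator]
    simp only [this]
    rw [integral_indicator measurableSet_Ici, hμ, Measure.restrict_restrict measurableSet_Ici]
    have : Ici r ∩ Ioc 0 t = Icc r t := by
      ext s
      simp only [mem_inter_iff, mem_Ici, mem_Icc, mem_Ioc]
      constructor
      · rintro ⟨a, b, c⟩; exact ⟨a, c⟩
      · rintro ⟨a, b⟩; exact ⟨a, hr.1.trans_le a, b⟩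
    rw [this, integral_Icc_eq_integral_Ioc]
  rw [setIntegral_congr_fun measurableSet_Ioc h1, setIntegral_congr_fun measurableSet_Ioc h2] at hswap
  have hEg : IntervalIntegrable (fun s : ℝ => Complex.exp (c * s) * g s) volume 0 t :=
    hg.continuousOn_mul (by fun_prop)
  have hGc : ContinuousOn (fun s => ∫ r in (0 : ℝ)..s, g r) (uIcc 0 t) :=
    intervalIntegral.continuousOn_primitive_interval (by
      rw [uIcc_of_le ht, integrableOn_Icc_iff_integrableOn_Ioc]; exact hg1)
  have hEG : IntervalIntegrable (fun s : ℝ => c * Complex.exp (c * s) * ∫ r in (0 : ℝ)..s, g r)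
      volume 0 t := (hE.continuousOn.mul hGc).intervalIntegrable
  rw [intervalIntegral.integral_add hEG hEg, intervalIntegral.integral_of_le ht, hswap,
    ← intervalIntegral.integral_of_le ht, ← intervalIntegral.integral_add _ hEg,
    ← intervalIntegral.integral_const_mul]
  · refine intervalIntegral.integral_congr fun s _ => ?_
    ring
  · simp only [sub_mul]
    exact (hg.const_mul _).sub hEg

/-- Variation of constants for the scalar equation `p' = a p + f` in integrated form. -/
lemma duhamel_of_integral_eq {a p₀ : ℂ} {p f : ℝ → ℂ} {T : ℝ} (hT : 0 ≤ T)
    (hp : ContinuousOn p (Icc 0 T)) (hf : IntervalIntegrable f volume 0 T)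
    (h : ∀ t ∈ Icc 0 T, p t = p₀ + ∫ s in (0 : ℝ)..t, (a * p s + f s)) :
    p T = Complex.exp (a * T) * p₀ + ∫ s in (0 : ℝ)..T, Complex.exp (a * (T - s : ℝ)) * f s := by
  have hpi : IntervalIntegrable p volume 0 T :=
    ContinuousOn.intervalIntegrable (by rwa [uIcc_of_le hT])
  -- Integrating factor exp(-as). The primitive of a p + f is p - p₀, so the terms containing p(s)
  -- cancel.
  have key := integral_exp_mul_add (-a) hT ((hpi.const_mul a).add hf)
  have e1 : ∀ s ∈ uIcc 0 T, -a * Complex.exp (-a * s) * (∫ r in (0 : ℝ)..s, (a * p r + f r))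
      + Complex.exp (-a * s) * (a * p s + f s)
      = a * Complex.exp (-a * s) * p₀ + Complex.exp (-a * s) * f s := by
    intro s hs
    rw [uIcc_of_le hT] at hs
    have := h s hs
    rw [← sub_eq_iff_eq_add'] at this
    rw [← this]; ring
  rw [intervalIntegral.integral_congr e1, intervalIntegral.integral_add
    (Continuous.intervalIntegrable (by fun_prop) _ _) (hf.continuousOn_mul (by fun_prop))] at key
  have hd : ∀ x ∈ uIcc 0 T, HasDerivAt (fun s : ℝ => -Complex.exp (-a * s) * p₀)
      (a * Complex.exp (-a * x) * p₀) x := by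
    intro x _
    simpa using (hasDerivAt_exp_const_mul (-a) x).fun_neg.mul_const p₀
  rw [intervalIntegral.integral_eq_sub_of_hasDerivAt hd
    (Continuous.intervalIntegrable (by fun_prop) _ _)] at key
  have h2 := h T ⟨hT, le_rfl⟩
  rw [← sub_eq_iff_eq_add'] at h2
  rw [← h2] at key
  have h3 : ∫ s in (0 : ℝ)..T, Complex.exp (a * (T - s : ℝ)) * f s
      = Complex.exp (a * T) * ∫ s in (0 : ℝ)..T, Complex.exp (-a * s) * f s := by
    rw [← intervalIntegral.integral_const_mul]
    refine intervalIntegral.integral_congr fun s _ => ?_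
    rw [← mul_assoc, ← Complex.exp_add]; congr 2; push_cast; ring
  have h4 : Complex.exp (a * T) * Complex.exp (-a * T) = 1 := by
    rw [← Complex.exp_add]; simp
  rw [h3]
  simp only [Complex.ofReal_zero, mul_zero, Complex.exp_zero] at key
  linear_combination (-p T) * h4 + p₀ * h4 - Complex.exp (a * T) * key + (-p₀) * h4

/-- The variation of constants formula solves `q' = a q + f` in integrated form. -/
lemma integral_eq_of_duhamel {a p₀ : ℂ} {q f : ℝ → ℂ} {T : ℝ} (hT : 0 ≤ T)
    (hf : IntervalIntegrable f volume 0 T)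
    (h : ∀ t ∈ Icc 0 T, q t = Complex.exp (a * t) * p₀
      + ∫ s in (0 : ℝ)..t, Complex.exp (a * (t - s : ℝ)) * f s) :
    q T = p₀ + ∫ s in (0 : ℝ)..T, (a * q s + f s) := by
  have hf' : IntervalIntegrable (fun s : ℝ => Complex.exp (-a * s) * f s) volume 0 T :=
    hf.continuousOn_mul (by fun_prop)
  -- Here q(s) = exp(as) (p₀ + ∫₀^s exp(-ar) f(r) dr), and the product rule for this expression
  -- reproduces a q + f.
  have key := integral_exp_mul_add a hT hf'
  have h3 : ∀ t : ℝ, ∫ s in (0 : ℝ)..t, Complex.exp (a * (t - s : ℝ)) * f s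
      = Complex.exp (a * t) * ∫ s in (0 : ℝ)..t, Complex.exp (-a * s) * f s := by
    intro t
    rw [← intervalIntegral.integral_const_mul]
    refine intervalIntegral.integral_congr fun s _ => ?_
    rw [← mul_assoc, ← Complex.exp_add]; congr 2; push_cast; ring
  have hGc : ContinuousOn (fun s => ∫ r in (0 : ℝ)..s, Complex.exp (-a * r) * f r) (uIcc 0 T) :=
    intervalIntegral.continuousOn_primitive_interval (by
      rw [uIcc_of_le hT, integrableOn_Icc_iff_integrableOn_Ioc]; exact hf'.1)
  have e : ∀ s ∈ uIcc 0 T, a * q s + f s = a * Complex.exp (a * s) * p₀ +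
      (a * Complex.exp (a * s) * (∫ r in (0 : ℝ)..s, Complex.exp (-a * r) * f r)
        + Complex.exp (a * s) * (Complex.exp (-a * s) * f s)) := by
    intro s hs
    rw [uIcc_of_le hT] at hs
    have h4 : Complex.exp (a * s) * Complex.exp (-a * s) = 1 := by
      rw [← Complex.exp_add]; simp
    rw [h s hs, h3]
    linear_combination (-f s) * h4
  have hd : ∀ x ∈ uIcc 0 T, HasDerivAt (fun s : ℝ => Complex.exp (a * s) * p₀)
      (a * Complex.exp (a * x) * p₀) x := by
    exact fun x _ => (hasDerivAt_exp_const_mul a x).mul_const p₀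
  rw [intervalIntegral.integral_congr e, intervalIntegral.integral_add
    (Continuous.intervalIntegrable (by fun_prop) _ _), key,
    intervalIntegral.integral_eq_sub_of_hasDerivAt hd
    (Continuous.intervalIntegrable (by fun_prop) _ _), h T ⟨hT, le_rfl⟩, h3]
  · simp only [Complex.ofReal_zero, mul_zero, Complex.exp_zero]; ring
  · refine IntervalIntegrable.add (ContinuousOn.intervalIntegrable
      (ContinuousOn.mul (by fun_prop) hGc)) (hf'.continuousOn_mul (by fun_prop))

/-! ### Diagonal unitary groups -/

lemma hasDerivAt_phase (θ s : ℝ) :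
    HasDerivAt (fun s : ℝ => Complex.exp ((θ * s : ℝ) * Complex.I))
      (θ * Complex.I * Complex.exp ((θ * s : ℝ) * Complex.I)) s := by
  have h := hasDerivAt_exp_const_mul (θ * Complex.I) s
  have e : ∀ r : ℝ, (θ * Complex.I * r : ℂ) = (θ * r : ℝ) * Complex.I := by
    intro r; push_cast; ring
  simpa only [e] using h

section Diagonal

variable {ι : Type*} {X : Type*} [NormedAddCommGroup X] [InnerProductSpace ℂ X]

lemma memℓp_phase (θ : ι → ℝ) {x : ι → ℂ} (h : Memℓp x 2) :
    Memℓp (fun j => Complex.exp (θ j * Complex.I) * x j) 2 := by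
  rw [memℓp_gen_iff (by norm_num)] at h ⊢
  simpa [Complex.norm_exp_ofReal_mul_I] using h

/-- Multiplication by the phases `exp(i θ_j)` on `ℓ²(ι)`. -/
def phaseMul (θ : ι → ℝ) : lp (fun _ : ι => ℂ) 2 →ₗᵢ[ℂ] lp (fun _ : ι => ℂ) 2 where
  toFun x := ⟨fun j => Complex.exp (θ j * Complex.I) * x j, memℓp_phase θ (lp.memℓp x)⟩
  map_add' x y := by
    ext j
    exact mul_add _ _ _
  map_smul' c x := by
    ext j
    simp [mul_left_comm]
  norm_map' x := by
    rw [lp.norm_eq_tsum_rpow (by norm_num), lp.norm_eq_tsum_rpow (by norm_num)]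
    simp [Complex.norm_exp_ofReal_mul_I]

lemma phaseMul_apply (θ : ι → ℝ) (x : lp (fun _ : ι => ℂ) 2) (j : ι) :
    phaseMul θ x j = Complex.exp (θ j * Complex.I) * x j := rfl

/-- The group on `X` which becomes `diag(exp(i Ω_j t))` under `E : X ≃ ℓ²(ι)`. -/
def diagGroup (E : X ≃L[ℂ] lp (fun _ : ι => ℂ) 2) (Ω : ι → ℝ) (t : ℝ) : X →L[ℂ] X :=
  (E.symm : lp (fun _ : ι => ℂ) 2 →L[ℂ] X).comp
    ((phaseMul fun j => Ω j * t).toContinuousLinearMap.comp (E : X →L[ℂ] _))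

variable (E : X ≃L[ℂ] lp (fun _ : ι => ℂ) 2) (Ω : ι → ℝ)

lemma diagGroup_eq (t : ℝ) (x : X) :
    diagGroup E Ω t x = E.symm (phaseMul (fun j => Ω j * t) (E x)) := rfl

lemma diagGroup_coord (t : ℝ) (x : X) (j : ι) :
    E (diagGroup E Ω t x) j = Complex.exp ((Ω j * t : ℝ) * Complex.I) * E x j := by
  rw [diagGroup_eq, ContinuousLinearEquiv.apply_symm_apply, phaseMul_apply]

variable {E} in
lemma ext_coord {x y : X} (h : ∀ j, E x j = E y j) : x = y :=
  E.injective (lp.ext (funext h))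

lemma diagGroup_zero : diagGroup E Ω 0 = ContinuousLinearMap.id ℂ X := by
  ext x
  refine ext_coord (E := E) fun j => ?_
  simp [diagGroup_coord]

lemma diagGroup_add (s t : ℝ) :
    diagGroup E Ω (s + t) = (diagGroup E Ω s).comp (diagGroup E Ω t) := by
  ext x
  refine ext_coord (E := E) fun j => ?_
  rw [ContinuousLinearMap.comp_apply, diagGroup_coord, diagGroup_coord, diagGroup_coord,
    ← mul_assoc, ← Complex.exp_add]
  congr 2
  push_cast; ring

/-- The phases are isometric on ℓ², so only the norms of `E` and its inverse enter, uniformly in t.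
The given norm of X need not itself be preserved. -/
lemma norm_diagGroup_le : ∃ M : ℝ, ∀ t x, ‖diagGroup E Ω t x‖ ≤ M * ‖x‖ := by
  refine ⟨‖(E.symm : lp (fun _ : ι => ℂ) 2 →L[ℂ] X)‖ * ‖(E : X →L[ℂ] lp (fun _ : ι => ℂ) 2)‖,
    fun t x => ?_⟩
  rw [diagGroup_eq, mul_assoc]
  refine ((E.symm : lp (fun _ : ι => ℂ) 2 →L[ℂ] X).le_opNorm _).trans ?_
  rw [LinearIsometry.norm_map]
  gcongr
  exact (E : X →L[ℂ] lp (fun _ : ι => ℂ) 2).le_opNorm x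

lemma norm_sq_lp (x : lp (fun _ : ι => ℂ) 2) : ‖x‖ ^ 2 = ∑' j, ‖x j‖ ^ 2 := by
  have := lp.norm_rpow_eq_tsum (p := 2) (by norm_num) x
  simpa using this

lemma summable_norm_sq_lp (x : lp (fun _ : ι => ℂ) 2) : Summable fun j => ‖x j‖ ^ 2 := by
  have := (memℓp_gen_iff (p := 2) (by norm_num)).1 (lp.memℓp x)
  simpa using this

/-- The rates may be unbounded, so continuity is only strong: dominated convergence in the series of
squared coordinates, with majorant 4|y_j|². -/
lemma continuous_diagGroup (x : X) : Continuous fun t => diagGroup E Ω t x := by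
  simp only [diagGroup_eq]
  refine E.symm.continuous.comp (continuous_iff_continuousAt.2 fun t => ?_)
  rw [ContinuousAt, tendsto_iff_norm_sub_tendsto_zero]
  set y := E x
  have h : Tendsto (fun s : ℝ => ‖phaseMul (fun j => Ω j * s) y - phaseMul (fun j => Ω j * t) y‖ ^ 2)
      (𝓝 t) (𝓝 (∑' j : ι, (0 : ℝ))) := by
    simp only [norm_sq_lp]
    refine tendsto_tsum_of_dominated_convergence (bound := fun j => 4 * ‖y j‖ ^ 2)
      ((summable_norm_sq_lp y).mul_left 4) (fun j => ?_) (Eventually.of_forall fun s j => ?_)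
    · have hc : Continuous fun s : ℝ =>
        ‖phaseMul (fun j => Ω j * s) y j - phaseMul (fun j => Ω j * t) y j‖ ^ 2 := by
        simp only [phaseMul_apply]
        fun_prop
      simpa using hc.tendsto t
    · rw [Real.norm_of_nonneg (by positivity)]
      have : ‖(phaseMul (fun j => Ω j * s) y - phaseMul (fun j => Ω j * t) y : lp _ 2) j‖
          ≤ 2 * ‖y j‖ := by
        refine (norm_sub_le _ _).trans ?_
        simp [phaseMul_apply, Complex.norm_exp, two_mul]
      calc _ ≤ (2 * ‖y j‖) ^ 2 := by gcongr
        _ = _ := by ring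
  rw [tsum_zero] at h
  have h2 := h.sqrt
  simpa [Real.sqrt_sq (norm_nonneg _)] using h2

/-- The generator of `diagGroup E Ω`: multiplication by `i Ω_j` with its maximal domain. -/
def diagGen : X →ₗ.[ℂ] X where
  domain :=
    { carrier := {x | Memℓp (fun j => Ω j * Complex.I * E x j) 2}
      zero_mem' := by
        have : (fun j => Ω j * Complex.I * E 0 j) = (0 : ι → ℂ) := by
          ext j; simp
        rw [mem_ofPred_eq, this]
        exact zero_memℓp
      add_mem' := by
        intro x y hx hy
        have : (fun j => Ω j * Complex.I * E (x + y) j)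
            = (fun j => Ω j * Complex.I * E x j) + fun j => Ω j * Complex.I * E y j := by
          ext j; simp [mul_add]
        rw [mem_ofPred_eq, this]
        exact Memℓp.add hx hy
      smul_mem' := by
        intro c x hx
        have : (fun j => Ω j * Complex.I * E (c • x) j)
            = c • fun j => Ω j * Complex.I * E x j := by
          ext j; simp [mul_left_comm]
        rw [mem_ofPred_eq, this]
        exact Memℓp.const_smul hx c }
  toFun :=
    { toFun := fun x => E.symm ⟨_, x.2⟩
      map_add' := by
        intro x y
        rw [← map_add]
        congr 1
        ext j
        simp only [Submodule.coe_add, map_add, lp.coeFn_add, Pi.add_apply]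
        exact mul_add _ _ _
      map_smul' := by
        intro c x
        rw [← map_smul]
        congr 1
        ext j
        simp [mul_left_comm] }

lemma mem_diagGen_domain (x : X) :
    x ∈ (diagGen E Ω).domain ↔ Memℓp (fun j => Ω j * Complex.I * E x j) 2 := Iff.rfl

lemma diagGen_coord (x : (diagGen E Ω).domain) (j : ι) :
    E (diagGen E Ω x) j = Ω j * Complex.I * E x j := by
  change E (E.symm _) j = _
  rw [ContinuousLinearEquiv.apply_symm_apply]

/-- Maximality of the domain: the coordinate identity alone makes the multiplied sequence equal to E
y, which lies in ℓ², so no separate domain condition remains. -/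
lemma mem_diagGen_graph (x y : X) :
    (x, y) ∈ (diagGen E Ω).graph ↔ ∀ j, E y j = Ω j * Complex.I * E x j := by
  rw [LinearPMap.mem_graph_iff]
  constructor
  · rintro ⟨z, hz, hy⟩ j
    simp only at hz hy
    rw [← hy, diagGen_coord, hz]
  · intro h
    have hx : x ∈ (diagGen E Ω).domain := by
      rw [mem_diagGen_domain]
      have : (fun j => Ω j * Complex.I * E x j) = E y := funext fun j => (h j).symm
      rw [this]
      exact lp.memℓp _
    refine ⟨⟨x, hx⟩, rfl, ext_coord (E := E) fun j => ?_⟩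
    rw [diagGen_coord, h]

/-- The `j`-th coordinate of `E x`, as a bounded functional of `x`. -/
def coordCLM (j : ι) : X →L[ℂ] ℂ :=
  (lp.evalCLM ℂ (fun _ : ι => ℂ) 2 j).comp (E : X →L[ℂ] lp (fun _ : ι => ℂ) 2)

lemma coordCLM_apply (j : ι) (x : X) : coordCLM E j x = E x j := rfl

/-- Vectors with finitely many nonzero coordinates lie in the domain, and the partial sums of the
coordinate expansion converge. -/
lemma dense_diagGen_domain : Dense ((diagGen E Ω).domain : Set X) := by
  classical
  intro x
  have h1 := lp.hasSum_single (p := 2) ENNReal.ofNat_ne_top (E x)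
  have h2 : HasSum (fun j => E.symm (lp.single 2 j (E x j))) x := by
    simpa using h1.mapL (E.symm : lp (fun _ : ι => ℂ) 2 →L[ℂ] X)
  refine mem_closure_of_tendsto h2 (Eventually.of_forall fun s => ?_)
  refine Submodule.sum_mem _ fun j _ => ?_
  rw [mem_diagGen_domain]
  have : (fun i => Ω i * Complex.I * E (E.symm (lp.single 2 j (E x j))) i)
      = lp.single (E := fun _ : ι => ℂ) 2 j (Ω j * Complex.I * E x j) := by
    ext i
    rw [ContinuousLinearEquiv.apply_symm_apply]
    by_cases hij : i = j
    · subst hij; simp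
    · simp [hij]
  rw [this]
  exact lp.memℓp _

/-- Testing the adjoint relation on the unit vector e_j gives w_j = -iΩ_j z_j for every j. By
maximality of the domain this already places (z, -w) in the graph. The converse holds term by term
because iΩ_j is imaginary. -/
lemma isSkewAdjointWrt_diagGen :
    IsSkewAdjointWrt (fun x y => ⟪E x, E y⟫_ℂ) (diagGen E Ω) := by
  classical
  refine ⟨dense_diagGen_domain E Ω, fun z w => ?_⟩
  have hneg : (z, w) ∈ (-diagGen E Ω).graph ↔ (z, -w) ∈ (diagGen E Ω).graph := by
    simp only [LinearPMap.mem_graph_iff]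
    constructor
    · rintro ⟨y, h1, h2⟩
      refine ⟨y, h1, ?_⟩
      rw [← h2]; simp
    · rintro ⟨y, h1, h2⟩
      refine ⟨y, h1, ?_⟩
      rw [LinearPMap.neg_apply, h2, neg_neg]
  rw [hneg, mem_diagGen_graph]
  constructor
  · intro h j
    set x : X := E.symm (lp.single 2 j (1 : ℂ)) with hx
    have hEx : E x = lp.single 2 j (1 : ℂ) := by simp [hx]
    have hxm : x ∈ (diagGen E Ω).domain := by
      rw [mem_diagGen_domain, hEx]
      have : (fun i => Ω i * Complex.I * (lp.single (E := fun _ : ι => ℂ) 2 j (1 : ℂ)) i)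
          = lp.single (E := fun _ : ι => ℂ) 2 j (Ω j * Complex.I) := by
        ext i
        by_cases hij : i = j
        · subst hij; simp
        · simp [hij]
      rw [this]
      exact lp.memℓp _
    have h1 := h ⟨x, hxm⟩
    have h2 : E (diagGen E Ω ⟨x, hxm⟩) = lp.single 2 j (Ω j * Complex.I) := by
      ext i
      rw [diagGen_coord, hEx]
      by_cases hij : i = j
      · subst hij; simp
      · simp [hij]
    simp only [h2, hEx, lp.inner_single_right] at h1
    have h3 := congrArg (starRingEnd ℂ) h1
    simp at h3
    rw [map_neg, lp.coeFn_neg, Pi.neg_apply, ← h3]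
    ring
  · intro h x
    simp only [lp.inner_eq_tsum]
    refine tsum_congr fun j => ?_
    have h1 := h j
    rw [map_neg, lp.coeFn_neg, Pi.neg_apply, neg_eq_iff_eq_neg] at h1
    rw [diagGen_coord, h1]
    simp
    ring

/-! #### The control system with a one-dimensional bounded control operator -/

lemma memLp_kernel (b : X) (τ : ℝ) :
    MemLp ((Ioc 0 τ).indicator fun σ => diagGroup E Ω (τ - σ) b) 2
      (volume.restrict (Ici (0 : ℝ))) := by
  obtain ⟨M, hM⟩ := norm_diagGroup_le E Ω
  have hc : Continuous fun σ => diagGroup E Ω (τ - σ) b :=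
    (continuous_diagGroup E Ω b).comp (by fun_prop)
  have h1 : MemLp ((Ioc 0 τ).indicator fun σ => diagGroup E Ω (τ - σ) b) 2 volume := by
    rw [memLp_indicator_iff_restrict measurableSet_Ioc]
    exact MemLp.of_bound hc.aestronglyMeasurable (M * ‖b‖) (Eventually.of_forall fun σ => hM _ _)
  exact h1.mono_measure Measure.restrict_le_self

lemma intervalIntegrable_smul_diagGroup (b : X) {u : ℝ → ℂ} {s t : ℝ} (τ : ℝ)
    (hu : IntervalIntegrable u volume s t) :
    IntervalIntegrable (fun σ => u σ • diagGroup E Ω (τ - σ) b) volume s t :=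
  hu.smul_continuousOn ((continuous_diagGroup E Ω b).comp (by fun_prop)).continuousOn

/-! ### Orbits as integrals, the generator, and the input maps. -/

variable [CompleteSpace X]

/-- Coordinates commute with the integral, and in each coordinate this is the fundamental theorem of
calculus for a scalar exponential. -/
lemma diagGroup_sub_eq_integral {x y : X} (h : ∀ j, E y j = Ω j * Complex.I * E x j) (t : ℝ) :
    diagGroup E Ω t x - x = ∫ s in (0 : ℝ)..t, diagGroup E Ω s y := by
  refine ext_coord (E := E) fun j => ?_
  have h1 := (coordCLM E j).intervalIntegral_comp_comm
    ((continuous_diagGroup E Ω y).intervalIntegrable (μ := volume) 0 t)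
  simp only [coordCLM_apply, diagGroup_coord, h] at h1
  rw [← h1, map_sub, lp.coeFn_sub, Pi.sub_apply, diagGroup_coord]
  have hd : ∀ s ∈ uIcc 0 t, HasDerivAt
      (fun s : ℝ => Complex.exp ((Ω j * s : ℝ) * Complex.I) * E x j)
      (Complex.exp ((Ω j * s : ℝ) * Complex.I) * (Ω j * Complex.I * E x j)) s := by
    intro s _
    exact ((hasDerivAt_phase (Ω j) s).mul_const (E x j)).congr_deriv
      (by rw [mul_comm (_ * Complex.I), mul_assoc])
  rw [intervalIntegral.integral_eq_sub_of_hasDerivAt hd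
    (Continuous.intervalIntegrable (by fun_prop) _ _)]
  simp

/-- If the coordinate identity holds, the orbit is the primitive of a continuous function, hence
differentiable at 0. Conversely, a limit of difference quotients can be read off in each coordinate,
where it is the derivative of a scalar exponential. -/
lemma mem_diagGen_graph_iff_tendsto (x y : X) : (x, y) ∈ (diagGen E Ω).graph ↔
    Tendsto (fun t : ℝ => t⁻¹ • (diagGroup E Ω t x - x)) (𝓝[>] 0) (𝓝 y) := by
  rw [mem_diagGen_graph]
  constructor
  · intro h
    have hd : HasDerivAt (fun t => ∫ s in (0 : ℝ)..t, diagGroup E Ω s y) (diagGroup E Ω 0 y) 0 :=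
      (continuous_diagGroup E Ω y).integral_hasStrictDerivAt 0 0 |>.hasDerivAt
    rw [diagGroup_zero, ContinuousLinearMap.id_apply] at hd
    have := hd.tendsto_slope_zero_right
    simpa [← diagGroup_sub_eq_integral E Ω h] using this
  · intro h j
    have h1 := ((coordCLM E j).continuous.tendsto y).comp h
    have hd : HasDerivAt (fun s : ℝ => Complex.exp ((Ω j * s : ℝ) * Complex.I) * E x j)
        (Ω j * Complex.I * E x j) 0 := by
      simpa using (hasDerivAt_phase (Ω j) 0).mul_const (E x j)
    have h2 := hd.tendsto_slope_zero_right
    refine tendsto_nhds_unique h1 (h2.congr fun t => ?_)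
    simp [coordCLM_apply, diagGroup_coord]

/-- The input map `u ↦ ∫₀^τ 𝕋_{τ-σ} b u(σ) dσ`. -/
def inputOp (b : X) (τ : ℝ) : L2Input ℂ →L[ℂ] X :=
  ((ContinuousLinearMap.lsmul ℂ ℂ).lpPairing (volume.restrict (Ici (0 : ℝ))) 2 2).flip
    (memLp_kernel E Ω b τ).toLp

lemma inputOp_eq (b : X) (τ : ℝ) (u : L2Input ℂ) :
    inputOp E Ω b τ u = ∫ σ in Ioc 0 τ, u σ • diagGroup E Ω (τ - σ) b := by
  rw [inputOp, ContinuousLinearMap.flip_apply, ContinuousLinearMap.lpPairing_eq_integral]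
  have h : ∀ᵐ σ ∂(volume.restrict (Ici (0 : ℝ))), ContinuousLinearMap.lsmul ℂ ℂ (u σ)
      ((memLp_kernel E Ω b τ).toLp _ σ)
      = (Ioc 0 τ).indicator (fun σ => u σ • diagGroup E Ω (τ - σ) b) σ := by
    filter_upwards [(memLp_kernel E Ω b τ).coeFn_toLp] with σ hσ
    rw [hσ]
    by_cases h : σ ∈ Ioc 0 τ <;> simp [h]
  rw [integral_congr_ae h, integral_indicator measurableSet_Ioc,
    Measure.restrict_restrict measurableSet_Ioc,
    inter_eq_left.2 (Ioc_subset_Ioi_self.trans Ioi_subset_Ici_self)]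

lemma L2Input.intervalIntegrable (u : L2Input ℂ) {s t : ℝ} (hs : 0 ≤ s) (ht : s ≤ t) :
    IntervalIntegrable u volume s t := by
  rw [intervalIntegrable_iff_integrableOn_Ioc_of_le ht]
  have h1 : MemLp u 2 (volume.restrict (Ioc s t)) := (Lp.memLp u).mono_measure
    (Measure.restrict_mono (fun x hx => hs.trans hx.1.le) le_rfl)
  exact h1.integrable one_le_two

/-- Split the integral at τ. Before τ the group law factors out the evolution over time t; after τ a
translation of the variable gives the input map for v. -/
lemma inputOp_concat (b : X) {t τ : ℝ} (ht : 0 ≤ t) (hτ : 0 ≤ τ) (u v w : L2Input ℂ)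
    (hw : w =ᵐ[volume.restrict (Ici (0 : ℝ))] concat τ u v) :
    inputOp E Ω b (τ + t) w = diagGroup E Ω t (inputOp E Ω b τ u) + inputOp E Ω b t v := by
  simp only [inputOp_eq]
  rw [← intervalIntegral.integral_of_le (by positivity), ← intervalIntegral.integral_of_le hτ,
    ← intervalIntegral.integral_of_le ht]
  rw [EventuallyEq, ae_restrict_iff' measurableSet_Ici] at hw
  have hu := intervalIntegrable_smul_diagGroup E Ω b τ (L2Input.intervalIntegrable u le_rfl hτ)
  rw [← intervalIntegral.integral_add_adjacent_intervals
    (intervalIntegrable_smul_diagGroup E Ω b (τ + t) (L2Input.intervalIntegrable w le_rfl hτ))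
    (intervalIntegrable_smul_diagGroup E Ω b (τ + t)
      (L2Input.intervalIntegrable w hτ (le_add_of_nonneg_right ht))),
    ← ContinuousLinearMap.intervalIntegral_comp_comm _ hu]
  congr 1
  · refine intervalIntegral.integral_congr_ae ?_
    -- The concatenation takes the value of v at σ = τ, while the first integral runs over (0,τ];
    -- the endpoint is discarded as a null set.
    have hne : ∀ᵐ σ : ℝ, σ ≠ τ := by simp [ae_iff, measure_singleton]
    filter_upwards [hw, hne] with σ h hn hσ
    rw [uIoc_of_le hτ] at hσ
    rw [h hσ.1.le, concat, if_pos (lt_of_le_of_ne hσ.2 hn), map_smul, add_comm τ t, add_sub_assoc,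
      diagGroup_add, ContinuousLinearMap.comp_apply]
  · have h1 := intervalIntegral.integral_comp_sub_right (a := τ) (b := τ + t)
      (fun σ => v σ • diagGroup E Ω (t - σ) b) τ
    rw [sub_self, add_sub_cancel_left] at h1
    rw [← h1]
    refine intervalIntegral.integral_congr_ae ?_
    filter_upwards [hw] with σ h hσ
    rw [uIoc_of_le (le_add_of_nonneg_right ht)] at hσ
    rw [h (hτ.trans hσ.1.le), concat, if_neg (not_lt.2 hσ.1.le)]
    congr 3
    ring

/-- The well-posed system `(exp(tA), Φ)` with `A = diagGen E Ω` and control operator `c ↦ c • b`. -/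
def diagSystem (b : X) : WellPosedSystem ℂ X where
  T := diagGroup E Ω
  Φ := inputOp E Ω b
  T_zero := diagGroup_zero E Ω
  T_add s t _ _ := diagGroup_add E Ω s t
  T_cont x := by
    have h := ((continuous_diagGroup E Ω x).tendsto 0).mono_left
      (nhdsWithin_le_nhds (s := Ioi (0 : ℝ)))
    simpa [diagGroup_zero] using h
  Φ_concat t τ ht hτ u v w hw := inputOp_concat E Ω b ht hτ u v w hw

lemma MemL2Loc.intervalIntegrable {u : ℝ → ℂ} (hu : MemL2Loc u) {t : ℝ} (ht : 0 ≤ t) :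
    IntervalIntegrable u volume 0 t := by
  rw [intervalIntegrable_iff_integrableOn_Ioc_of_le ht]
  -- `MemL2Loc` speaks only of positive lengths, so max(t,1) is used to include t = 0.
  have h1 : MemLp u 2 (volume.restrict (Ioc 0 t)) := (hu (max t 1) (by positivity)).mono_measure
    (Measure.restrict_mono (Ioc_subset_Icc_self.trans (Icc_subset_Icc_right (le_max_left _ _)))
      le_rfl)
  exact h1.integrable one_le_two

lemma diagSystem_inputMap (b : X) {u : ℝ → ℂ} (hu : MemL2Loc u) {τ : ℝ} (hτ : 0 ≤ τ) :
    (diagSystem E Ω b).inputMap τ u hu = ∫ σ in (0 : ℝ)..τ, u σ • diagGroup E Ω (τ - σ) b := by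
  rw [WellPosedSystem.inputMap]
  change inputOp E Ω b τ _ = _
  rw [inputOp_eq, intervalIntegral.integral_of_le hτ]
  refine integral_congr_ae ?_
  have h := (hu.memLp_truncation τ).coeFn_toLp
  rw [EventuallyEq, ae_restrict_iff' measurableSet_Ici] at h
  rw [EventuallyEq, ae_restrict_iff' measurableSet_Ioc]
  filter_upwards [h] with σ hσ h1
  rw [hσ h1.1.le, indicator_of_mem (Ioc_subset_Icc_self h1)]

/-- The state trajectory `𝕋_τ x₀ + ∫₀^τ 𝕋_{τ-σ} b u(σ) dσ`. -/
def trajectory (b : X) (u : ℝ → ℂ) (x₀ : X) (τ : ℝ) : X :=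
  diagGroup E Ω τ x₀ + ∫ σ in (0 : ℝ)..τ, u σ • diagGroup E Ω (τ - σ) b

lemma trajectory_coord (b : X) {u : ℝ → ℂ} (hu : MemL2Loc u) (x₀ : X) {τ : ℝ} (hτ : 0 ≤ τ)
    (j : ι) : E (trajectory E Ω b u x₀ τ) j = Complex.exp (Ω j * Complex.I * τ) * E x₀ j
      + ∫ σ in (0 : ℝ)..τ, Complex.exp (Ω j * Complex.I * (τ - σ : ℝ)) * (u σ * E b j) := by
  have h1 := (coordCLM E j).intervalIntegral_comp_comm
    (intervalIntegrable_smul_diagGroup E Ω b τ (hu.intervalIntegrable hτ))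
  rw [trajectory, map_add, lp.coeFn_add, Pi.add_apply, diagGroup_coord]
  rw [coordCLM_apply] at h1
  rw [← h1]
  congr 1
  · congr 2; push_cast; ring
  · refine intervalIntegral.integral_congr fun σ _ => ?_
    simp only [map_smul, coordCLM_apply, diagGroup_coord, smul_eq_mul]
    rw [show ((Ω j * (τ - σ) : ℝ) : ℂ) * Complex.I = Ω j * Complex.I * (τ - σ : ℝ) by
      push_cast; ring]
    ring

/-- Since the evolution is a group, the convolution equals T_τ applied to ∫₀^τ u(σ) T_{-σ} b dσ.
This integral is a continuous primitive, and a uniformly bounded, strongly continuous group maps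
continuous paths to continuous paths. -/
lemma continuousOn_trajectory (b : X) {u : ℝ → ℂ} (hu : MemL2Loc u) (x₀ : X) :
    ContinuousOn (trajectory E Ω b u x₀) (Ici 0) := by
  obtain ⟨M, hM⟩ := norm_diagGroup_le E Ω
  have key : ∀ T : ℝ, 0 ≤ T → ContinuousOn
      (fun τ => ∫ σ in (0 : ℝ)..τ, u σ • diagGroup E Ω (-σ) b) (Icc 0 T) := by
    intro T hT
    rw [← uIcc_of_le hT]
    refine intervalIntegral.continuousOn_primitive_interval ?_
    rw [uIcc_of_le hT, integrableOn_Icc_iff_integrableOn_Ioc,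
      ← intervalIntegrable_iff_integrableOn_Ioc_of_le hT]
    simpa using intervalIntegrable_smul_diagGroup E Ω b 0 (hu.intervalIntegrable hT)
  have key' : ContinuousOn (fun τ => ∫ σ in (0 : ℝ)..τ, u σ • diagGroup E Ω (-σ) b) (Ici 0) := by
    intro t ht
    refine ((key (t + 1) (by simp at ht; linarith)) t ⟨ht, by linarith⟩).mono_of_mem_nhdsWithin ?_
    rw [← Ici_inter_Iic]
    exact inter_mem self_mem_nhdsWithin (mem_nhdsWithin_of_mem_nhds (Iic_mem_nhds (by linarith)))
  have hjoint : ∀ {f : ℝ → X}, ContinuousOn f (Ici 0) →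
      ContinuousOn (fun t => diagGroup E Ω t (f t)) (Ici 0) := by
    intro f hf t ht
    rw [ContinuousWithinAt, tendsto_iff_norm_sub_tendsto_zero]
    have h1 : Tendsto (fun s => M * ‖f s - f t‖ + ‖diagGroup E Ω s (f t) - diagGroup E Ω t (f t)‖)
        (𝓝[Ici 0] t) (𝓝 (M * 0 + 0)) := by
      refine Tendsto.add (Tendsto.const_mul _ ?_) ?_
      · exact tendsto_iff_norm_sub_tendsto_zero.1 (hf t ht)
      · exact tendsto_iff_norm_sub_tendsto_zero.1
          (((continuous_diagGroup E Ω (f t)).tendsto t).mono_left nhdsWithin_le_nhds)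
    rw [mul_zero, add_zero] at h1
    refine squeeze_zero (fun _ => norm_nonneg _) (fun s => ?_) h1
    calc ‖diagGroup E Ω s (f s) - diagGroup E Ω t (f t)‖
        = ‖diagGroup E Ω s (f s - f t) + (diagGroup E Ω s (f t) - diagGroup E Ω t (f t))‖ := by
          rw [map_sub]; congr 1; abel
      _ ≤ _ := (norm_add_le _ _).trans (by gcongr; exact hM _ _)
  refine ((continuous_diagGroup E Ω x₀).continuousOn.add (hjoint key')).congr fun t ht => ?_
  rw [trajectory]
  congr 1
  beta_reduce
  rw [← ContinuousLinearMap.intervalIntegral_comp_comm]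
  · refine intervalIntegral.integral_congr fun σ _ => ?_
    simp only [map_smul]
    rw [sub_eq_add_neg, diagGroup_add, ContinuousLinearMap.comp_apply]
  · simpa using intervalIntegrable_smul_diagGroup E Ω b 0 (hu.intervalIntegrable ht)

end Diagonal

/-! ### Cosine moments -/

/-- The variable cos(κ(x-l)) maps [l,r] bijectively onto [-1,1]. Vanishing cosine moments give
vanishing integrals against polynomials in this variable, then by Weierstrass against all continuous
functions. The scaling serves both [0,π] and [-1,0]. -/
lemma ae_eq_zero_of_cos_moments {l r κ : ℝ} (hκ : 0 < κ) (hlr : κ * (r - l) = Real.pi) {f : ℝ → ℂ}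
    (hint : IntegrableOn f (Icc l r))
    (hcos : ∀ k : ℕ, ∫ x in Icc l r, ((Real.cos (k * (κ * (x - l))) : ℝ) : ℂ) * f x = 0) :
    f =ᵐ[volume.restrict (Icc l r)] 0 := by
  have hbd : ∀ g : ℝ → ℝ, Continuous g →
      IntegrableOn (fun x => ((g x : ℝ) : ℂ) * f x) (Icc l r) := fun g hg =>
    hint.continuousOn_mul (by fun_prop) isCompact_Icc
  have hcosZ : ∀ k : ℤ, ∫ x in Icc l r, ((Real.cos (k * (κ * (x - l))) : ℝ) : ℂ) * f x = 0 := by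
    intro k
    rw [← hcos k.natAbs]
    congr 1
    ext x
    congr 2
    rw [Nat.cast_natAbs, Int.cast_abs]
    rcases abs_choice (k : ℝ) with hk' | hk'
    · rw [hk']
    · rw [hk', neg_mul, Real.cos_neg]
  -- The product-to-sum formula trades one power of the cosine for the frequencies k ± 1, so the
  -- induction has to run over all integers k.
  have hpow : ∀ n : ℕ, ∀ k : ℤ, ∫ x in Icc l r,
      ((Real.cos (κ * (x - l)) ^ n * Real.cos (k * (κ * (x - l))) : ℝ) : ℂ) * f x = 0 := by
    intro n
    induction n with
    | zero => intro k; simpa using hcosZ k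
    | succ n ih =>
      intro k
      have e : ∀ x : ℝ,
          ((Real.cos (κ * (x - l)) ^ (n + 1) * Real.cos (k * (κ * (x - l))) : ℝ) : ℂ) * f x
          = (1 / 2 : ℂ) *
            (((Real.cos (κ * (x - l)) ^ n * Real.cos ((k + 1 : ℤ) * (κ * (x - l))) : ℝ) : ℂ) * f x
            + ((Real.cos (κ * (x - l)) ^ n * Real.cos ((k - 1 : ℤ) * (κ * (x - l))) : ℝ) : ℂ)
              * f x) := by
        intro x
        have : Real.cos (κ * (x - l)) * Real.cos (k * (κ * (x - l)))
            = 1 / 2 * (Real.cos ((k + 1 : ℤ) * (κ * (x - l)))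
              + Real.cos ((k - 1 : ℤ) * (κ * (x - l)))) := by
          push_cast
          rw [add_mul, sub_mul, one_mul, Real.cos_add, Real.cos_sub]; ring
        rw [pow_succ, mul_assoc, this]; push_cast; ring
      simp only [e]
      rw [integral_const_mul, integral_add (hbd _ (by fun_prop)) (hbd _ (by fun_prop)), ih, ih]
      simp
  have hpoly : ∀ p : Polynomial ℝ,
      ∫ x in Icc l r, ((p.eval (Real.cos (κ * (x - l))) : ℝ) : ℂ) * f x = 0 := by
    intro p
    induction p using Polynomial.induction_on' with
    | add p q hp hq =>
      simp only [Polynomial.eval_add, Complex.ofReal_add, add_mul]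
      rw [integral_add (hbd _ (by fun_prop)) (hbd _ (by fun_prop)), hp, hq, add_zero]
    | monomial n a =>
      have := hpow n 0
      simp only [Int.cast_zero, zero_mul, Real.cos_zero, mul_one] at this
      simp only [Polynomial.eval_monomial, Complex.ofReal_mul, mul_assoc]
      rw [integral_const_mul, this, mul_zero]
  have hcont : ∀ g : ℝ → ℝ, Continuous g → ∫ x in Icc l r, ((g x : ℝ) : ℂ) * f x = 0 := by
    intro g hg
    have hN : 0 ≤ ∫ x in Icc l r, ‖f x‖ := integral_nonneg fun _ => norm_nonneg _
    have key : ∀ ε : ℝ, 0 < ε →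
        ‖∫ x in Icc l r, ((g x : ℝ) : ℂ) * f x‖ ≤ ε * ∫ x in Icc l r, ‖f x‖ := by
      intro ε hε
      -- The approximated function is g expressed in the variable t = cos(κ(x-l)).
      obtain ⟨p, hp⟩ := exists_polynomial_near_of_continuousOn (-1) 1
        (fun t => g (l + κ⁻¹ * Real.arccos t))
        (hg.comp (by have := Real.continuous_arccos; fun_prop)).continuousOn ε hε
      have e1 : ∫ x in Icc l r, ((g x : ℝ) : ℂ) * f x
          = ∫ x in Icc l r, (((g x - p.eval (Real.cos (κ * (x - l))) : ℝ)) : ℂ) * f x := by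
        simp only [Complex.ofReal_sub, sub_mul]
        rw [integral_sub (hbd _ hg) (hbd _ (by fun_prop)), hpoly, sub_zero]
      rw [e1, ← integral_const_mul]
      refine norm_integral_le_of_norm_le (hint.norm.const_mul ε) ?_
      refine (ae_restrict_iff' measurableSet_Icc).2 (Eventually.of_forall fun x hx => ?_)
      rw [norm_mul]
      refine mul_le_mul_of_nonneg_right ?_ (norm_nonneg _)
      have := hp (Real.cos (κ * (x - l))) ⟨Real.neg_one_le_cos _, Real.cos_le_one _⟩
      have h0 : 0 ≤ κ * (x - l) := mul_nonneg hκ.le (sub_nonneg.2 hx.1)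
      have h1 : κ * (x - l) ≤ Real.pi := by
        rw [← hlr]; exact mul_le_mul_of_nonneg_left (by linarith [hx.2]) hκ.le
      rw [Real.arccos_cos h0 h1, inv_mul_cancel_left₀ hκ.ne', add_sub_cancel] at this
      rw [Complex.norm_real, Real.norm_eq_abs, abs_sub_comm]
      exact this.le
    by_contra hne
    have hpos := norm_pos_iff.2 hne
    set N := ∫ x in Icc l r, ‖f x‖
    set c := ‖∫ x in Icc l r, ((g x : ℝ) : ℂ) * f x‖
    -- This ε makes ε N smaller than c; adding 1 covers the case N = 0.
    have h1 := key (c / (2 * (N + 1))) (by positivity)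
    have h2 : c / (2 * (N + 1)) * N < c := by
      rw [div_mul_eq_mul_div, div_lt_iff₀ (by positivity)]
      nlinarith
    linarith
  have hae : ∀ᵐ x, x ∈ Ioo l r → f x = 0 := by
    refine isOpen_Ioo.ae_eq_zero_of_integral_contDiff_smul_eq_zero
      (hint.mono_set Ioo_subset_Icc_self).locallyIntegrableOn ?_
    intro g hg _ hsupp
    have h1 := hcont g hg.continuous
    rw [← h1, ← integral_indicator measurableSet_Icc]
    refine integral_congr_ae (Eventually.of_forall fun x => ?_)
    by_cases hx : x ∈ Icc l r
    · simp [indicator_of_mem hx, Complex.real_smul]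
    · have : g x = 0 := by
        by_contra hne
        exact hx (Ioo_subset_Icc_self (hsupp (subset_tsupport g hne)))
      simp [indicator_of_notMem hx, this]
  rw [EventuallyEq, Measure.restrict_congr_set Ioo_ae_eq_Icc.symm]
  exact (ae_restrict_iff' measurableSet_Ioo).2 hae

/-! ### A Hilbert-type inequality -/

/-- The function κ ↦ 2 arctan √(κs) has derivative s/(√(κs)(1+κs)), which decreases in κ. The mean
value theorem on [n,n+1] bounds the increment below by the value at n+1, and exp(-x) ≤ 1/(1+x). The
increments telescope when summed over n. -/
lemma div_sqrt_mul_exp_le_arctan_sub {s : ℝ} (hs : 0 < s) (n : ℕ) :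
    s / Real.sqrt ((n + 1) * s) * Real.exp (-((n + 1) * s))
      ≤ 2 * Real.arctan (Real.sqrt ((n + 1 : ℝ) * s)) - 2 * Real.arctan (Real.sqrt (n * s)) := by
  obtain ⟨ξ, hξ, he⟩ := exists_hasDerivAt_eq_slope (fun κ : ℝ => 2 * Real.arctan (Real.sqrt (κ * s)))
    (fun κ => 2 * (1 / (1 + Real.sqrt (κ * s) ^ 2) * (s / (2 * Real.sqrt (κ * s)))))
    (show (n : ℝ) < n + 1 by linarith)
    (by
      have := Real.continuous_arctan
      fun_prop)
    (by
      intro κ hκ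
      have hκ0 : 0 < κ := lt_of_le_of_lt (Nat.cast_nonneg n) hκ.1
      have h1 : HasDerivAt (fun κ : ℝ => κ * s) s κ := by
        simpa using (hasDerivAt_id κ).mul_const s
      have h2 := h1.sqrt (by positivity)
      exact h2.arctan.const_mul 2)
  rw [add_sub_cancel_left, div_one] at he
  rw [← he]
  have hξ0 : 0 < ξ := lt_of_le_of_lt (Nat.cast_nonneg n) hξ.1
  have hn : (0 : ℝ) < n + 1 := by positivity
  have h3 : Real.exp (-((n + 1) * s)) ≤ 1 / (1 + (n + 1) * s) := by
    rw [Real.exp_neg, ← one_div]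
    refine one_div_le_one_div_of_le (by positivity) ?_
    linarith [Real.add_one_le_exp ((n + 1) * s)]
  rw [Real.sq_sqrt (by positivity)]
  have h4 : Real.sqrt (ξ * s) ≤ Real.sqrt ((n + 1) * s) :=
    Real.sqrt_le_sqrt (mul_le_mul_of_nonneg_right hξ.2.le hs.le)
  have h5 : 0 < Real.sqrt (ξ * s) := Real.sqrt_pos.2 (by positivity)
  have h6 : 1 / (1 + (n + 1) * s) ≤ 1 / (1 + ξ * s) :=
    one_div_le_one_div_of_le (by positivity)
      (by linarith [mul_le_mul_of_nonneg_right hξ.2.le hs.le])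
  calc s / Real.sqrt ((n + 1) * s) * Real.exp (-((n + 1) * s))
      ≤ s / Real.sqrt (ξ * s) * (1 / (1 + ξ * s)) := by
        gcongr
        exact h3.trans h6
    _ = _ := by
        field_simp

lemma integrableOn_exp_div_sqrt {k : ℝ} (hk : 0 < k) :
    IntegrableOn (fun s : ℝ => Real.exp (-(k * s)) / Real.sqrt s) (Ioi 0) ∧
    ∫ s in Ioi (0 : ℝ), Real.exp (-(k * s)) / Real.sqrt s = Real.sqrt Real.pi / Real.sqrt k := by
  have e : ∀ s ∈ Ioi (0 : ℝ), Real.exp (-(k * s)) / Real.sqrt s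
      = s ^ ((1 / 2 : ℝ) - 1) * Real.exp (-(k * s)) := by
    intro s hs
    have hs : 0 < s := hs
    rw [show (1 / 2 : ℝ) - 1 = -(1 / 2) by norm_num, Real.rpow_neg hs.le, ← Real.sqrt_eq_rpow]
    rw [div_eq_inv_mul]
  have h := Real.integral_rpow_mul_exp_neg_mul_Ioi (a := 1 / 2) (r := k) (by norm_num) hk
  have hv : ∫ s in Ioi (0 : ℝ), Real.exp (-(k * s)) / Real.sqrt s
      = Real.sqrt Real.pi / Real.sqrt k := by
    rw [setIntegral_congr_fun measurableSet_Ioi e, h, Real.Gamma_one_half_eq,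
      ← Real.sqrt_eq_rpow, one_div, Real.sqrt_inv]
    ring
  refine ⟨?_, hv⟩
  -- A function that is not integrable has integral zero by convention, whereas the value just
  -- computed is positive.
  by_contra hni
  have h0 := integral_undef hni
  rw [hv] at h0
  have : 0 < Real.sqrt Real.pi / Real.sqrt k := by positivity
  exact this.ne' h0

/-- With s = -y and k = n+1, Cauchy-Schwarz is applied after splitting exp(-ks) as s^{1/4}
exp(-ks/2) times s^{-1/4} exp(-ks/2). The square of the second factor integrates to at most √(π/k).
The powers are chosen so that the remaining weights have a sum over n bounded uniformly in s. -/
lemma sq_integral_mul_exp_le (h : L2Side) (n : ℕ) :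
    (∫ y in Icc (-1 : ℝ) 0, ‖h y‖ * Real.exp ((n + 1) * y)) ^ 2
      ≤ Real.sqrt Real.pi * ∫ y in Icc (-1 : ℝ) 0, ‖h y‖ ^ 2 *
        (-y / Real.sqrt ((n + 1) * (-y)) * Real.exp (-((n + 1) * (-y)))) := by
  set k : ℝ := n + 1 with hk
  have hk0 : 0 < k := by positivity
  have hh : MemLp (fun y => ‖h y‖) 2 (volume.restrict (Icc (-1 : ℝ) 0)) := (Lp.memLp h).norm
  -- The point y = 0, where the weights divide by zero, is removed.
  have hae : ∀ᵐ y ∂(volume.restrict (Icc (-1 : ℝ) 0)), y ∈ Ico (-1 : ℝ) 0 := by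
    rw [Measure.restrict_congr_set Ico_ae_eq_Icc.symm]
    exact ae_restrict_mem measurableSet_Ico
  set F : ℝ → ℝ := fun y => ‖h y‖ * Real.sqrt (Real.sqrt (-y) * Real.exp (-(k * (-y))))
  set G : ℝ → ℝ := fun y => Real.sqrt (Real.exp (-(k * (-y))) / Real.sqrt (-y))
  have hF : MemLp F 2 (volume.restrict (Icc (-1 : ℝ) 0)) := by
    refine hh.of_le_mul (c := 1) ?_ ?_
    · exact hh.aestronglyMeasurable.mul (Continuous.aestronglyMeasurable (by fun_prop))
    · filter_upwards [hae] with y hy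
      rw [norm_mul, mul_comm]
      gcongr
      rw [Real.norm_of_nonneg (Real.sqrt_nonneg _), Real.sqrt_le_one]
      refine mul_le_one₀ ?_ (Real.exp_pos _).le ?_
      · rw [Real.sqrt_le_one]; linarith [hy.1]
      · rw [Real.exp_le_one_iff]; nlinarith [hy.2]
  have hGsq : ∀ y, G y ^ 2 = Real.exp (-(k * (-y))) / Real.sqrt (-y) := fun y =>
    Real.sq_sqrt (by positivity)
  have hneg : IntegrableOn (fun y : ℝ => Real.exp (-(k * (-y))) / Real.sqrt (-y)) (Iio 0) := by
    have := (integrableOn_exp_div_sqrt hk0).1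
    have h2 := ((Measure.measurePreserving_neg (volume : Measure ℝ)).integrableOn_comp_preimage
      (MeasurableEquiv.neg ℝ).measurableEmbedding).2 this
    have e : Neg.neg ⁻¹' Ioi (0 : ℝ) = Iio 0 := by ext; simp
    rwa [e] at h2
  have hGi : IntegrableOn (fun y : ℝ => Real.exp (-(k * (-y))) / Real.sqrt (-y)) (Icc (-1) 0) := by
    rw [IntegrableOn, ← Measure.restrict_congr_set Ico_ae_eq_Icc]
    exact hneg.mono_set (fun y hy => hy.2)
  have hG : MemLp G 2 (volume.restrict (Icc (-1 : ℝ) 0)) := by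
    rw [memLp_two_iff_integrable_sq]
    · simp only [hGsq]
      exact hGi
    · exact Measurable.aestronglyMeasurable (by fun_prop)
  have hCS := integral_mul_le_Lp_mul_Lq_of_nonneg (μ := volume.restrict (Icc (-1 : ℝ) 0))
    Real.HolderConjugate.two_two (f := F) (g := G) (Eventually.of_forall fun y => by positivity)
    (Eventually.of_forall fun y => by positivity) (by simpa using hF) (by simpa using hG)
  have e1 : ∫ y in Icc (-1 : ℝ) 0, F y * G y = ∫ y in Icc (-1 : ℝ) 0, ‖h y‖ * Real.exp (k * y) := by
    refine integral_congr_ae ?_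
    filter_upwards [hae] with y hy
    have h0 : 0 < Real.sqrt (-y) := Real.sqrt_pos.2 (by linarith [hy.2])
    simp only [F, G]
    rw [mul_assoc, ← Real.sqrt_mul (by positivity)]
    congr 1
    rw [show Real.sqrt (-y) * Real.exp (-(k * -y)) * (Real.exp (-(k * -y)) / Real.sqrt (-y))
      = Real.exp (k * y) ^ 2 by rw [mul_neg, neg_neg]; field_simp]
    exact Real.sqrt_sq (Real.exp_pos _).le
  rw [e1] at hCS
  have hA0 : 0 ≤ ∫ y in Icc (-1 : ℝ) 0, ‖h y‖ * Real.exp (k * y) :=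
    integral_nonneg fun y => by positivity
  have hsq := pow_le_pow_left₀ hA0 hCS 2
  have hF0 : 0 ≤ ∫ y in Icc (-1 : ℝ) 0, F y ^ (2 : ℝ) := integral_nonneg fun y => by positivity
  have hG0 : 0 ≤ ∫ y in Icc (-1 : ℝ) 0, G y ^ (2 : ℝ) := integral_nonneg fun y => by positivity
  rw [mul_pow, ← Real.sqrt_eq_rpow, ← Real.sqrt_eq_rpow, Real.sq_sqrt hF0, Real.sq_sqrt hG0] at hsq
  simp only [Real.rpow_two, hGsq] at hsq
  have hGle : ∫ y in Icc (-1 : ℝ) 0, Real.exp (-(k * (-y))) / Real.sqrt (-y)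
      ≤ Real.sqrt Real.pi / Real.sqrt k := by
    rw [← (integrableOn_exp_div_sqrt hk0).2]
    have h2 := integral_comp_neg_Ioi 0 (fun s : ℝ => Real.exp (-(k * (-s))) / Real.sqrt (-s))
    simp only [neg_neg, neg_zero] at h2
    rw [h2, ← Measure.restrict_congr_set Ico_ae_eq_Icc, integral_Iic_eq_integral_Iio]
    exact setIntegral_mono_set hneg (Eventually.of_forall fun y => by positivity)
      (LE.le.eventuallyLE fun y hy => hy.2)
  calc _ ≤ (∫ y in Icc (-1 : ℝ) 0, F y ^ 2) * (Real.sqrt Real.pi / Real.sqrt k) := by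
        refine hsq.trans (mul_le_mul_of_nonneg_left hGle ?_)
        simpa only [Real.rpow_two] using hF0
    _ = _ := by
        rw [mul_comm, div_mul_eq_mul_div, mul_div_assoc, ← integral_div]
        congr 1
        refine integral_congr_ae ?_
        filter_upwards [hae] with y hy
        have hy0 : 0 < -y := by linarith [hy.2]
        simp only [F]
        rw [mul_pow, Real.sq_sqrt (by positivity), Real.sqrt_mul hk0.le]
        have h2 : 0 < Real.sqrt (-y) := Real.sqrt_pos.2 hy0
        have h3 : 0 < Real.sqrt k := Real.sqrt_pos.2 hk0
        field_simp
        rw [Real.sq_sqrt hy0.le]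
        ring

/-- Schur's test for the Laplace transform sampled at the integers: the weights from Cauchy-Schwarz
sum pointwise to at most π, by telescoping arctangents. Hence the partial sums are bounded by √π · π
‖h‖², without any decay of h near y = 0. -/
lemma summable_sq_integral_mul_exp (h : L2Side) :
    Summable fun k : ℕ+ => (∫ y in Icc (-1 : ℝ) 0, ‖h y‖ * Real.exp ((k : ℕ) * y)) ^ 2 := by
  have hpn := (summable_pnat_iff_summable_succ
    (f := fun k : ℕ => (∫ y in Icc (-1 : ℝ) 0, ‖h y‖ * Real.exp ((k : ℝ) * y)) ^ 2)).2
  refine hpn ?_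
  have hh : Integrable (fun y => ‖h y‖ ^ 2) (volume.restrict (Icc (-1 : ℝ) 0)) :=
    (Lp.memLp h).integrable_norm_pow (p := 2) (by norm_num)
  have hae : ∀ᵐ y ∂(volume.restrict (Icc (-1 : ℝ) 0)), y ∈ Ico (-1 : ℝ) 0 := by
    rw [Measure.restrict_congr_set Ico_ae_eq_Icc.symm]
    exact ae_restrict_mem measurableSet_Ico
  set w : ℕ → ℝ → ℝ := fun n y => -y / Real.sqrt ((n + 1) * (-y)) * Real.exp (-((n + 1) * (-y)))
  have hsum : ∀ y ∈ Ico (-1 : ℝ) 0, ∀ N : ℕ, ∑ n ∈ Finset.range N, w n y ≤ Real.pi := by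
    intro y hy N
    have h1 : ∑ n ∈ Finset.range N, w n y ≤ ∑ n ∈ Finset.range N,
        (2 * Real.arctan (Real.sqrt ((n + 1 : ℕ) * -y)) - 2 * Real.arctan (Real.sqrt (n * -y))) := by
      refine Finset.sum_le_sum fun n _ => ?_
      have := div_sqrt_mul_exp_le_arctan_sub (s := -y) (by linarith [hy.2]) n
      push_cast
      exact this
    rw [Finset.sum_range_sub (fun n : ℕ => 2 * Real.arctan (Real.sqrt (n * -y)))] at h1
    have := Real.arctan_lt_pi_div_two (Real.sqrt (N * -y))
    simp only [Nat.cast_zero, zero_mul, Real.sqrt_zero, Real.arctan_zero, mul_zero, sub_zero] at h1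
    linarith
  have hw0 : ∀ n, ∀ y ∈ Ico (-1 : ℝ) 0, 0 ≤ w n y := by
    intro n y hy
    have : 0 < -y := by linarith [hy.2]
    positivity
  have hwi : ∀ n, Integrable (fun y => ‖h y‖ ^ 2 * w n y) (volume.restrict (Icc (-1 : ℝ) 0)) := by
    intro n
    refine (hh.mul_const Real.pi).mono' ?_ ?_
    · exact hh.aestronglyMeasurable.mul (Measurable.aestronglyMeasurable (by fun_prop))
    · filter_upwards [hae] with y hy
      rw [norm_mul, Real.norm_of_nonneg (hw0 n y hy), Real.norm_of_nonneg (by positivity)]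
      gcongr
      refine le_trans ?_ (hsum y hy (n + 1))
      exact Finset.single_le_sum (f := fun n => w n y) (fun i _ => hw0 i y hy) (by simp)
  refine summable_of_sum_range_le
    (c := Real.sqrt Real.pi * ∫ y in Icc (-1 : ℝ) 0, ‖h y‖ ^ 2 * Real.pi)
    (fun n => by positivity) fun N => ?_
  calc _ ≤ ∑ n ∈ Finset.range N, Real.sqrt Real.pi * ∫ y in Icc (-1 : ℝ) 0, ‖h y‖ ^ 2 * w n y := by
        refine Finset.sum_le_sum fun n _ => ?_
        have := sq_integral_mul_exp_le h n
        push_cast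
        exact this
    _ = Real.sqrt Real.pi * ∫ y in Icc (-1 : ℝ) 0, ∑ n ∈ Finset.range N, ‖h y‖ ^ 2 * w n y := by
        rw [← Finset.mul_sum, integral_finsetSum _ fun n _ => hwi n]
    _ ≤ _ := by
        refine mul_le_mul_of_nonneg_left ?_ (Real.sqrt_nonneg _)
        refine integral_mono_ae (integrable_finsetSum _ fun n _ => hwi n) (hh.mul_const _) ?_
        filter_upwards [hae] with y hy
        rw [← Finset.mul_sum]
        exact mul_le_mul_of_nonneg_left (hsum y hy N) (by positivity)

/-! ### Smooth cut-offs on an interval -/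

/-- A smooth function vanishing for `t ≤ 1/(n+1)` and equal to `1` for `t ≥ 2/(n+1)`. -/
def cutoff (n : ℕ) (t : ℝ) : ℝ := Real.smoothTransition ((n + 1) * t - 1)

lemma contDiff_cutoff (n : ℕ) : ContDiff ℝ ∞ (cutoff n) :=
  Real.smoothTransition.contDiff.comp (by fun_prop)

lemma abs_cutoff_le (n : ℕ) (t : ℝ) : |cutoff n t| ≤ 1 := by
  rw [cutoff, abs_of_nonneg (Real.smoothTransition.nonneg _)]
  exact Real.smoothTransition.le_one _

lemma cutoff_eq_zero {n : ℕ} {t : ℝ} (h : t ≤ 1 / (n + 1)) : cutoff n t = 0 := by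
  refine Real.smoothTransition.zero_of_nonpos ?_
  rw [le_div_iff₀ (by positivity)] at h
  linarith

lemma eventually_cutoff_eq_one {t : ℝ} (ht : 0 < t) : ∀ᶠ n : ℕ in atTop, cutoff n t = 1 := by
  have h : Tendsto (fun n : ℕ => ((n : ℝ) + 1) * t - 1) atTop atTop := by
    refine tendsto_atTop_add_const_right _ _ (Tendsto.atTop_mul_const ht ?_)
    exact tendsto_atTop_add_const_right _ _ tendsto_natCast_atTop_atTop
  filter_upwards [h.eventually_ge_atTop 1] with n hn
  exact Real.smoothTransition.one_of_one_le hn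

lemma deriv_cutoff (n : ℕ) (t : ℝ) :
    deriv (cutoff n) t = (n + 1) * deriv Real.smoothTransition ((n + 1) * t - 1) := by
  have h1 : HasDerivAt (fun t : ℝ => ((n : ℝ) + 1) * t - 1) (n + 1) t := by
    simpa using ((hasDerivAt_id t).const_mul ((n : ℝ) + 1)).sub_const 1
  have h2 : HasDerivAt Real.smoothTransition
      (deriv Real.smoothTransition ((n + 1) * t - 1)) ((n + 1) * t - 1) :=
    ((Real.smoothTransition.contDiff (n := 1)).differentiable (by simp) _).hasDerivAt
  rw [mul_comm]
  exact (h2.comp t h1).deriv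

lemma deriv_smoothTransition_of_lt {x : ℝ} (h : x < 0) : deriv Real.smoothTransition x = 0 := by
  have : Real.smoothTransition =ᶠ[𝓝 x] fun _ => 0 := by
    filter_upwards [Iio_mem_nhds h] with y hy
    exact Real.smoothTransition.zero_of_nonpos (le_of_lt hy)
  rw [this.deriv_eq, deriv_const]

lemma deriv_smoothTransition_of_gt {x : ℝ} (h : 1 < x) : deriv Real.smoothTransition x = 0 := by
  have : Real.smoothTransition =ᶠ[𝓝 x] fun _ => 1 := by
    filter_upwards [Ioi_mem_nhds h] with y hy
    exact Real.smoothTransition.one_of_one_le (le_of_lt hy)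
  rw [this.deriv_eq, deriv_const]

lemma eventually_deriv_cutoff_eq_zero {t : ℝ} (ht : 0 < t) :
    ∀ᶠ n : ℕ in atTop, deriv (cutoff n) t = 0 := by
  have h : Tendsto (fun n : ℕ => ((n : ℝ) + 1) * t - 1) atTop atTop := by
    refine tendsto_atTop_add_const_right _ _ (Tendsto.atTop_mul_const ht ?_)
    exact tendsto_atTop_add_const_right _ _ tendsto_natCast_atTop_atTop
  filter_upwards [h.eventually_gt_atTop 1] with n hn
  rw [deriv_cutoff, deriv_smoothTransition_of_gt hn, mul_zero]

/-- Scale invariance: with x = (n+1)t - 1 and S the smooth transition, the product equals (x+1)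
S'(x), which does not depend on n otherwise and vanishes outside [0,1]. -/
lemma exists_abs_mul_deriv_cutoff_le : ∃ M : ℝ, ∀ n t, |t * deriv (cutoff n) t| ≤ M := by
  have hc : Continuous fun x : ℝ => (x + 1) * deriv Real.smoothTransition x :=
    (by fun_prop : Continuous fun x : ℝ => x + 1).mul
      ((Real.smoothTransition.contDiff (n := 1)).continuous_deriv le_rfl)
  obtain ⟨M, hM⟩ := (isCompact_Icc (a := (0 : ℝ)) (b := 1)).exists_bound_of_continuousOn
    hc.continuousOn
  have hM0 : 0 ≤ M := (norm_nonneg _).trans (hM 0 (by simp))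
  refine ⟨M, fun n t => ?_⟩
  rw [deriv_cutoff, ← mul_assoc]
  set x := ((n : ℝ) + 1) * t - 1 with hx
  rw [show t * ((n : ℝ) + 1) = x + 1 by rw [hx]; ring]
  by_cases h0 : x < 0
  · simpa [deriv_smoothTransition_of_lt h0] using hM0
  by_cases h1 : 1 < x
  · simpa [deriv_smoothTransition_of_gt h1] using hM0
  · exact hM x ⟨not_lt.1 h0, not_lt.1 h1⟩

/-- `P n` is a bounded family of smooth functions, equal to `1` at each point of `I` from some `n`
on, such that `a (P n)'` remains bounded. -/
structure IsCutoffFor (I : Set ℝ) (a : ℝ → ℝ) (P : ℕ → ℝ → ℝ) : Prop where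
  contDiff : ∀ n, ContDiff ℝ ∞ (P n)
  le_one : ∀ n, ∀ x ∈ I, |P n x| ≤ 1
  bound : ∃ M, ∀ n, ∀ x ∈ I, |a x * deriv (P n) x| ≤ M
  eventually_eq : ∀ x ∈ I, ∀ᶠ n in atTop, P n x = 1 ∧ deriv (P n) x = 0

lemma exists_abs_le_mul_abs_sub {a : ℝ → ℝ} (ha : ContDiff ℝ ∞ a) {l r z : ℝ} (hz : z ∈ Icc l r)
    (h0 : a z = 0) : ∃ L, 0 ≤ L ∧ ∀ x ∈ Icc l r, |a x| ≤ L * |x - z| := by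
  obtain ⟨L, hL⟩ := (isCompact_Icc (a := l) (b := r)).exists_bound_of_continuousOn
    (ha.continuous_deriv (by simp)).continuousOn
  refine ⟨L, (norm_nonneg _).trans (hL z hz), fun x hx => ?_⟩
  have := (convex_Icc l r).norm_image_sub_le_of_norm_deriv_le
    (fun y _ => ha.differentiable (by simp) y) hL hz hx
  simpa [h0] using this

/-- Because a(l) = 0, |a(x)| is at most a constant times |x - l|, which compensates the growth of
the derivative of the cut-off. -/
lemma isCutoffFor_left {a : ℝ → ℝ} (ha : ContDiff ℝ ∞ a) {l r : ℝ} (hl : a l = 0) :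
    IsCutoffFor (Ioc l r) a fun n x => cutoff n (x - l) where
  contDiff n := (contDiff_cutoff n).comp (by fun_prop)
  le_one n x _ := abs_cutoff_le _ _
  bound := by
    obtain ⟨M, hM⟩ := exists_abs_mul_deriv_cutoff_le
    rcases lt_or_ge r l with h | h
    · exact ⟨0, fun n x hx => absurd (hx.1.trans_le hx.2) (not_lt.2 h.le)⟩
    obtain ⟨L, hL0, hL⟩ := exists_abs_le_mul_abs_sub ha (left_mem_Icc.2 h) hl
    refine ⟨L * M, fun n x hx => ?_⟩
    rw [deriv_comp_sub_const, abs_mul]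
    calc |a x| * |deriv (cutoff n) (x - l)| ≤ L * |x - l| * |deriv (cutoff n) (x - l)| := by
          gcongr; exact hL x (Ioc_subset_Icc_self hx)
      _ = L * |(x - l) * deriv (cutoff n) (x - l)| := by rw [abs_mul, mul_assoc]
      _ ≤ L * M := by gcongr; exact hM _ _
  eventually_eq x hx := by
    have h0 : 0 < x - l := sub_pos.2 hx.1
    filter_upwards [eventually_cutoff_eq_one h0, eventually_deriv_cutoff_eq_zero h0] with n h1 h2
    exact ⟨h1, by rw [deriv_comp_sub_const, h2]⟩

lemma isCutoffFor_right {a : ℝ → ℝ} (ha : ContDiff ℝ ∞ a) {l r : ℝ} (hr : a r = 0) :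
    IsCutoffFor (Ico l r) a fun n x => cutoff n (r - x) where
  contDiff n := (contDiff_cutoff n).comp (by fun_prop)
  le_one n x _ := abs_cutoff_le _ _
  bound := by
    obtain ⟨M, hM⟩ := exists_abs_mul_deriv_cutoff_le
    rcases lt_or_ge r l with h | h
    · exact ⟨0, fun n x hx => absurd (hx.1.trans_lt hx.2) (not_lt.2 h.le)⟩
    obtain ⟨L, hL0, hL⟩ := exists_abs_le_mul_abs_sub ha (right_mem_Icc.2 h) hr
    refine ⟨L * M, fun n x hx => ?_⟩
    rw [deriv_comp_const_sub, abs_mul, abs_neg]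
    calc |a x| * |deriv (cutoff n) (r - x)| ≤ L * |x - r| * |deriv (cutoff n) (r - x)| := by
          gcongr; exact hL x (Ico_subset_Icc_self hx)
      _ = L * |(r - x) * deriv (cutoff n) (r - x)| := by rw [abs_mul, mul_assoc, abs_sub_comm]
      _ ≤ L * M := by gcongr; exact hM _ _
  eventually_eq x hx := by
    have h0 : 0 < r - x := sub_pos.2 hx.2
    filter_upwards [eventually_cutoff_eq_one h0, eventually_deriv_cutoff_eq_zero h0] with n h1 h2
    exact ⟨h1, by rw [deriv_comp_const_sub, h2, neg_zero]⟩

/-- The transition takes place between r+1 and r+2, beyond the interval, so this cut-off only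
produces compact support and needs no condition on a. -/
lemma isCutoffFor_upper (a : ℝ → ℝ) (r : ℝ) :
    IsCutoffFor (Iic r) a fun _ x => Real.smoothTransition (r + 2 - x) := by
  have hd : ∀ x ∈ Iic r, deriv (fun x => Real.smoothTransition (r + 2 - x)) x = 0 := by
    intro x hx
    rw [deriv_comp_const_sub, deriv_smoothTransition_of_gt (by linarith [mem_Iic.1 hx]), neg_zero]
  exact {
    contDiff := fun n => Real.smoothTransition.contDiff.comp (by fun_prop)
    le_one := fun n x _ => by
      rw [abs_of_nonneg (Real.smoothTransition.nonneg _)]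
      exact Real.smoothTransition.le_one _
    bound := ⟨0, fun n x hx => by rw [hd x hx]; simp⟩
    eventually_eq := fun x hx => Eventually.of_forall fun n =>
      ⟨Real.smoothTransition.one_of_one_le (by linarith [mem_Iic.1 hx]), hd x hx⟩ }

lemma isCutoffFor_lower (a : ℝ → ℝ) (l : ℝ) :
    IsCutoffFor (Ici l) a fun _ x => Real.smoothTransition (x - (l - 2)) := by
  have hd : ∀ x ∈ Ici l, deriv (fun x => Real.smoothTransition (x - (l - 2))) x = 0 := by
    intro x hx
    rw [deriv_comp_sub_const, deriv_smoothTransition_of_gt (by linarith [mem_Ici.1 hx])]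
  exact {
    contDiff := fun n => Real.smoothTransition.contDiff.comp (by fun_prop)
    le_one := fun n x _ => by
      rw [abs_of_nonneg (Real.smoothTransition.nonneg _)]
      exact Real.smoothTransition.le_one _
    bound := ⟨0, fun n x hx => by rw [hd x hx]; simp⟩
    eventually_eq := fun x hx => Eventually.of_forall fun n =>
      ⟨Real.smoothTransition.one_of_one_le (by linarith [mem_Ici.1 hx]), hd x hx⟩ }

lemma IsCutoffFor.mono {I J : Set ℝ} {a : ℝ → ℝ} {P : ℕ → ℝ → ℝ} (h : IsCutoffFor J a P)
    (hIJ : I ⊆ J) : IsCutoffFor I a P where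
  contDiff := h.contDiff
  le_one n x hx := h.le_one n x (hIJ hx)
  bound := h.bound.imp fun _ hM n x hx => hM n x (hIJ hx)
  eventually_eq x hx := h.eventually_eq x (hIJ hx)

/-- Bounded pointwise approximation on `I` by smooth functions. -/
structure ApproxBdd (I : Set ℝ) (A : ℕ → ℝ → ℝ) (a : ℝ → ℝ) : Prop where
  contDiff : ∀ n, ContDiff ℝ ∞ (A n)
  bound : ∃ C, ∀ n, ∀ x ∈ I, |A n x| ≤ C
  lim : ∀ x ∈ I, Tendsto (fun n => A n x) atTop (𝓝 (a x))

/-- Bounded pointwise approximation on `I` by smooth functions, together with the derivatives. -/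
structure ApproxBddDeriv (I : Set ℝ) (A : ℕ → ℝ → ℝ) (a : ℝ → ℝ) : Prop extends
    ApproxBdd I A a where
  bound_deriv : ∃ C, ∀ n, ∀ x ∈ I, |deriv (A n) x| ≤ C
  lim_deriv : ∀ x ∈ I, Tendsto (fun n => deriv (A n) x) atTop (𝓝 (deriv a x))

lemma exists_abs_le_of_continuous {a : ℝ → ℝ} (ha : Continuous a) {I : Set ℝ}
    (hI : Bornology.IsBounded I) : ∃ C, 0 ≤ C ∧ ∀ x ∈ I, |a x| ≤ C := by
  obtain ⟨C, hC⟩ := hI.isCompact_closure.exists_bound_of_continuousOn ha.continuousOn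
  exact ⟨max C 0, le_max_right _ _, fun x hx => (hC x (subset_closure hx)).trans (le_max_left _ _)⟩

lemma IsCutoffFor.approxBdd {I : Set ℝ} (hI : Bornology.IsBounded I) {a b b' : ℝ → ℝ}
    (ha : ContDiff ℝ ∞ a) {P Q : ℕ → ℝ → ℝ} (hP : IsCutoffFor I b P) (hQ : IsCutoffFor I b' Q) :
    ApproxBdd I (fun n x => a x * (P n x * Q n x)) a where
  contDiff n := ha.mul ((hP.contDiff n).mul (hQ.contDiff n))
  bound := by
    obtain ⟨C, hC0, hC⟩ := exists_abs_le_of_continuous ha.continuous hI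
    refine ⟨C, fun n x hx => ?_⟩
    rw [abs_mul, abs_mul]
    calc _ ≤ C * (1 * 1) := by
          gcongr
          exacts [hC x hx, hP.le_one n x hx, hQ.le_one n x hx]
      _ = C := by ring
  lim x hx := by
    refine tendsto_const_nhds.congr' ?_
    filter_upwards [hP.eventually_eq x hx, hQ.eventually_eq x hx] with n h1 h2
    rw [h1.1, h2.1]; ring

/-- In Leibniz' rule the dangerous terms contain a P' or a Q'. They are bounded by the cut-off
condition and vanish eventually at each point. -/
lemma IsCutoffFor.approxBddDeriv {I : Set ℝ} (hI : Bornology.IsBounded I) {a : ℝ → ℝ}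
    (ha : ContDiff ℝ ∞ a) {P Q : ℕ → ℝ → ℝ} (hP : IsCutoffFor I a P) (hQ : IsCutoffFor I a Q) :
    ApproxBddDeriv I (fun n x => a x * (P n x * Q n x)) a := by
  have hd : ∀ n x, deriv (fun x => a x * (P n x * Q n x)) x
      = deriv a x * (P n x * Q n x) + (a x * deriv (P n) x * Q n x + P n x * (a x * deriv (Q n) x)) := by
    intro n x
    have h1 := (ha.differentiable (by simp) x).hasDerivAt
    have h2 := ((hP.contDiff n).differentiable (by simp) x).hasDerivAt
    have h3 := ((hQ.contDiff n).differentiable (by simp) x).hasDerivAt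
    refine (h1.mul (h2.mul h3)).deriv.trans ?_
    simp only [Pi.mul_apply]
    ring
  refine { hP.approxBdd hI ha hQ with bound_deriv := ?_, lim_deriv := fun x hx => ?_ }
  · obtain ⟨C, hC0, hC⟩ := exists_abs_le_of_continuous (ha.continuous_deriv (by simp)) hI
    obtain ⟨M, hM⟩ := hP.bound
    obtain ⟨M', hM'⟩ := hQ.bound
    refine ⟨C * (1 * 1) + (M * 1 + 1 * M'), fun n x hx => ?_⟩
    have hP1 := hP.le_one n x hx
    have hQ1 := hQ.le_one n x hx
    have hM0 : 0 ≤ M := (abs_nonneg _).trans (hM n x hx)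
    rw [hd]
    refine (abs_add_le _ _).trans (add_le_add ?_ ((abs_add_le _ _).trans (add_le_add ?_ ?_)))
    · rw [abs_mul, abs_mul]
      gcongr
      exact hC x hx
    · rw [abs_mul]
      gcongr
      exact hM n x hx
    · rw [abs_mul]
      gcongr
      exact hM' n x hx
  · refine tendsto_const_nhds.congr' ?_
    filter_upwards [hP.eventually_eq x hx, hQ.eventually_eq x hx] with n h1 h2
    rw [hd, h1.1, h2.1, h1.2, h2.2]; ring

/-- Each `A n` vanishes outside a compact subset of `V`. -/
def CompactlySupportedIn (V : Set ℝ) (A : ℕ → ℝ → ℝ) : Prop :=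
  ∀ n, ∃ K ⊆ V, IsCompact K ∧ ∀ x ∉ K, A n x = 0

lemma compactlySupportedIn_mul {V : Set ℝ} (a : ℝ → ℝ) {P Q : ℕ → ℝ → ℝ}
    (h : ∀ n, ∃ s t, Icc s t ⊆ V ∧ (∀ x < s, P n x = 0) ∧ ∀ x > t, Q n x = 0) :
    CompactlySupportedIn V fun n x => a x * (P n x * Q n x) := by
  intro n
  obtain ⟨s, t, h1, h2, h3⟩ := h n
  refine ⟨Icc s t, h1, isCompact_Icc, fun x hx => ?_⟩
  rw [mem_Icc, not_and_or, not_le, not_le] at hx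
  beta_reduce
  rcases hx with hx | hx
  · rw [h2 x hx]; ring
  · rw [h3 x hx]; ring

lemma cutoff_left_eq_zero {n : ℕ} {l x : ℝ} (h : x < l + 1 / (n + 1)) : cutoff n (x - l) = 0 :=
  cutoff_eq_zero (by linarith)

lemma cutoff_right_eq_zero {n : ℕ} {r x : ℝ} (h : r - 1 / (n + 1) < x) : cutoff n (r - x) = 0 :=
  cutoff_eq_zero (by linarith)

/-- No derivative has to be controlled here, so a needs no boundary condition; the cut-offs are
taken relative to the zero function. -/
lemma exists_approx_Ioo {l r : ℝ} {a : ℝ → ℝ} (ha : ContDiff ℝ ∞ a) :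
    ∃ A, ApproxBdd (Ioo l r) A a ∧ CompactlySupportedIn (Ioo l r) A := by
  refine ⟨_, IsCutoffFor.approxBdd (Metric.isBounded_Ioo l r) ha
    ((isCutoffFor_left (a := fun _ => 0) (r := r) contDiff_const rfl).mono Ioo_subset_Ioc_self)
    ((isCutoffFor_right (a := fun _ => 0) (l := l) contDiff_const rfl).mono Ioo_subset_Ico_self),
    compactlySupportedIn_mul a fun n => ⟨l + 1 / (n + 1), r - 1 / (n + 1), fun x hx => ?_,
      fun x hx => cutoff_left_eq_zero hx, fun x hx => cutoff_right_eq_zero hx⟩⟩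
  have : (0 : ℝ) < 1 / (n + 1) := by positivity
  exact ⟨by linarith [hx.1], by linarith [hx.2]⟩

lemma exists_approx_deriv_Ioo {l r : ℝ} {a : ℝ → ℝ} (ha : ContDiff ℝ ∞ a) (hl : a l = 0)
    (hr : a r = 0) : ∃ A, ApproxBddDeriv (Ioo l r) A a ∧ CompactlySupportedIn (Ioo l r) A := by
  refine ⟨_, IsCutoffFor.approxBddDeriv (Metric.isBounded_Ioo l r) ha
    ((isCutoffFor_left (r := r) ha hl).mono Ioo_subset_Ioc_self)
    ((isCutoffFor_right (l := l) ha hr).mono Ioo_subset_Ico_self),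
    compactlySupportedIn_mul a fun n => ⟨l + 1 / (n + 1), r - 1 / (n + 1), fun x hx => ?_,
      fun x hx => cutoff_left_eq_zero hx, fun x hx => cutoff_right_eq_zero hx⟩⟩
  have : (0 : ℝ) < 1 / (n + 1) := by positivity
  exact ⟨by linarith [hx.1], by linarith [hx.2]⟩

/-- The endpoint r belongs to the set of convergence and the supports may extend past it. This keeps
the boundary value at r in Green's formula on the top. -/
lemma exists_approx_deriv_Ioc {l r : ℝ} {a : ℝ → ℝ} (ha : ContDiff ℝ ∞ a) (hl : a l = 0) :
    ∃ A, ApproxBddDeriv (Ioc l r) A a ∧ CompactlySupportedIn (Ioi l) A := by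
  refine ⟨_, IsCutoffFor.approxBddDeriv (Metric.isBounded_Ioc l r) ha
    (isCutoffFor_left (r := r) ha hl) ((isCutoffFor_upper a r).mono Ioc_subset_Iic_self),
    compactlySupportedIn_mul a fun n => ⟨l + 1 / (n + 1), r + 2, fun x hx => ?_,
      fun x hx => cutoff_left_eq_zero hx,
      fun x hx => Real.smoothTransition.zero_of_nonpos (by linarith)⟩⟩
  have : (0 : ℝ) < 1 / (n + 1) := by positivity
  exact mem_Ioi.2 (by linarith [hx.1])

lemma exists_approx_deriv_Ico {l r : ℝ} {a : ℝ → ℝ} (ha : ContDiff ℝ ∞ a) (hr : a r = 0) :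
    ∃ A, ApproxBddDeriv (Ico l r) A a ∧ CompactlySupportedIn (Iio r) A := by
  refine ⟨_, IsCutoffFor.approxBddDeriv (Metric.isBounded_Ico l r) ha
    ((isCutoffFor_lower a l).mono Ico_subset_Ici_self) (isCutoffFor_right (l := l) ha hr),
    compactlySupportedIn_mul a fun n => ⟨l - 2, r - 1 / (n + 1), fun x hx => ?_,
      fun x hx => Real.smoothTransition.zero_of_nonpos (by linarith),
      fun x hx => cutoff_right_eq_zero hx⟩⟩
  have : (0 : ℝ) < 1 / (n + 1) := by positivity
  exact mem_Iio.2 (by linarith [hx.2])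

/-! ### Continuous functions as elements of the `L²` spaces -/

lemma restrict_Omega : (volume : Measure (ℝ × ℝ)).restrict Omega
    = (volume.restrict (Icc 0 Real.pi)).prod (volume.restrict (Icc (-1) 0)) := by
  rw [Omega, ← Measure.restrict_congr_set (Ioo_ae_eq_Icc (a := (0 : ℝ)) (b := Real.pi)),
    ← Measure.restrict_congr_set (Ioo_ae_eq_Icc (a := (-1 : ℝ)) (b := 0)), Measure.prod_restrict]
  rfl

instance : IsFiniteMeasure ((volume : Measure (ℝ × ℝ)).restrict Omega) := by
  rw [restrict_Omega]; infer_instance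

lemma measurableSet_Omega : MeasurableSet Omega := measurableSet_Ioo.prod measurableSet_Ioo

lemma Omega_subset_Icc : Omega ⊆ Icc 0 Real.pi ×ˢ Icc (-1) 0 :=
  prod_mono Ioo_subset_Icc_self Ioo_subset_Icc_self

lemma memLp_Omega_of_continuous {θ : ℝ × ℝ → ℝ} (hθ : Continuous θ) :
    MemLp (fun p => (θ p : ℂ)) 2 (volume.restrict Omega) := by
  obtain ⟨C, hC⟩ := (isCompact_Icc.prod isCompact_Icc :
    IsCompact (Icc 0 Real.pi ×ˢ Icc (-1 : ℝ) 0)).exists_bound_of_continuousOn hθ.continuousOn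
  refine MemLp.of_bound (by fun_prop : Continuous fun p => (θ p : ℂ)).aestronglyMeasurable C ?_
  refine (ae_restrict_iff' measurableSet_Omega).2 (Eventually.of_forall fun p hp => ?_)
  rw [Complex.norm_real]
  exact hC p (Omega_subset_Icc hp)

lemma memLp_Icc_of_continuous {l r : ℝ} {a : ℝ → ℝ} (ha : Continuous a) :
    MemLp (fun x => (a x : ℂ)) 2 (volume.restrict (Icc l r)) := by
  obtain ⟨C, hC⟩ := (isCompact_Icc (a := l) (b := r)).exists_bound_of_continuousOn ha.continuousOn
  refine MemLp.of_bound (by fun_prop : Continuous fun p => (a p : ℂ)).aestronglyMeasurable C ?_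
  refine (ae_restrict_iff' measurableSet_Icc).2 (Eventually.of_forall fun p hp => ?_)
  rw [Complex.norm_real]
  exact hC p hp

open Classical in
/-- A continuous function as an element of `L²(Ω)` (and `0` if it is not continuous). -/
def omegaFun (θ : ℝ × ℝ → ℝ) : L2Omega :=
  if h : Continuous θ then (memLp_Omega_of_continuous h).toLp else 0

open Classical in
/-- A continuous function as an element of `L²[0,π]`. -/
def topFun (a : ℝ → ℝ) : L2Top :=
  if h : Continuous a then (memLp_Icc_of_continuous h).toLp else 0

open Classical in
/-- A continuous function as an element of `L²[-1,0]`. -/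
def sideFun (a : ℝ → ℝ) : L2Side :=
  if h : Continuous a then (memLp_Icc_of_continuous h).toLp else 0

lemma coeFn_omegaFun {θ : ℝ × ℝ → ℝ} (hθ : Continuous θ) :
    omegaFun θ =ᵐ[volume.restrict Omega] fun p => (θ p : ℂ) := by
  rw [omegaFun, dif_pos hθ]; exact MemLp.coeFn_toLp _

lemma coeFn_topFun {a : ℝ → ℝ} (ha : Continuous a) :
    topFun a =ᵐ[volume.restrict (Icc 0 Real.pi)] fun x => (a x : ℂ) := by
  rw [topFun, dif_pos ha]; exact MemLp.coeFn_toLp _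

lemma coeFn_sideFun {a : ℝ → ℝ} (ha : Continuous a) :
    sideFun a =ᵐ[volume.restrict (Icc (-1) 0)] fun x => (a x : ℂ) := by
  rw [sideFun, dif_pos ha]; exact MemLp.coeFn_toLp _

lemma inner_omegaFun {θ : ℝ × ℝ → ℝ} (hθ : Continuous θ) (f : L2Omega) :
    ⟪omegaFun θ, f⟫_ℂ = ∫ p in Omega, θ p • f p := by
  rw [L2.inner_def]
  refine integral_congr_ae ?_
  filter_upwards [coeFn_omegaFun hθ] with p hp
  rw [hp, RCLike.inner_apply, Complex.conj_ofReal, Complex.real_smul, mul_comm]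

lemma inner_topFun {a : ℝ → ℝ} (ha : Continuous a) (g : L2Top) :
    ⟪topFun a, g⟫_ℂ = ∫ x in Icc 0 Real.pi, a x • g x := by
  rw [L2.inner_def]
  refine integral_congr_ae ?_
  filter_upwards [coeFn_topFun ha] with p hp
  rw [hp, RCLike.inner_apply, Complex.conj_ofReal, Complex.real_smul, mul_comm]

lemma inner_sideFun {a : ℝ → ℝ} (ha : Continuous a) (g : L2Side) :
    ⟪sideFun a, g⟫_ℂ = ∫ x in Icc (-1) 0, a x • g x := by
  rw [L2.inner_def]
  refine integral_congr_ae ?_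
  filter_upwards [coeFn_sideFun ha] with p hp
  rw [hp, RCLike.inner_apply, Complex.conj_ofReal, Complex.real_smul, mul_comm]

/-- `a(x) c(y)` as an element of `L²(Ω)`. -/
def prodFun (a c : ℝ → ℝ) : L2Omega := omegaFun fun p => a p.1 * c p.2

lemma coeFn_prodFun {a c : ℝ → ℝ} (ha : Continuous a) (hc : Continuous c) :
    prodFun a c =ᵐ[volume.restrict Omega] fun p => ((a p.1 * c p.2 : ℝ) : ℂ) :=
  coeFn_omegaFun (by fun_prop)

lemma inner_prodFun {a c : ℝ → ℝ} (ha : Continuous a) (hc : Continuous c) (f : L2Omega) :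
    ⟪prodFun a c, f⟫_ℂ = ∫ p in Omega, (a p.1 * c p.2) • f p :=
  inner_omegaFun (by fun_prop) f

lemma omegaFun_const_mul (k : ℝ) {θ : ℝ × ℝ → ℝ} (hθ : Continuous θ) :
    omegaFun (fun p => k * θ p) = (k : ℂ) • omegaFun θ := by
  apply Lp.ext
  filter_upwards [coeFn_omegaFun hθ, coeFn_omegaFun (θ := fun p => k * θ p) (by fun_prop),
    Lp.coeFn_smul (k : ℂ) (omegaFun θ)] with p h1 h2 h3
  rw [h2, h3, Pi.smul_apply, h1]
  simp

lemma prodFun_mul_left (k : ℝ) {a c : ℝ → ℝ} (ha : Continuous a) (hc : Continuous c) :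
    prodFun (fun x => k * a x) c = (k : ℂ) • prodFun a c := by
  rw [prodFun, prodFun, ← omegaFun_const_mul k (by fun_prop)]
  simp only [mul_assoc]

lemma prodFun_mul_right (k : ℝ) {a c : ℝ → ℝ} (ha : Continuous a) (hc : Continuous c) :
    prodFun a (fun x => k * c x) = (k : ℂ) • prodFun a c := by
  rw [prodFun, prodFun, ← omegaFun_const_mul k (by fun_prop)]
  simp only [mul_left_comm]

lemma inner_prodFun_prodFun {a c a' c' : ℝ → ℝ} (ha : Continuous a) (hc : Continuous c)
    (ha' : Continuous a') (hc' : Continuous c') : ⟪prodFun a c, prodFun a' c'⟫_ℂ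
      = (((∫ x in Icc 0 Real.pi, a x * a' x) * ∫ y in Icc (-1) 0, c y * c' y : ℝ) : ℂ) := by
  rw [inner_prodFun ha hc, ← integral_prod_mul (fun x => a x * a' x) (fun y => c y * c' y),
    ← restrict_Omega, ← integral_complex_ofReal]
  refine integral_congr_ae ?_
  filter_upwards [coeFn_prodFun ha' hc'] with p hp
  rw [hp, Complex.real_smul]
  push_cast; ring

/-! ### Closedness of weak derivatives and traces -/

lemma IsTestFunction.continuous_fderiv_apply {V : Set (ℝ × ℝ)} {θ : ℝ × ℝ → ℝ}
    (h : IsTestFunction V θ) (e : ℝ × ℝ) : Continuous fun p => fderiv ℝ θ p e :=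
  (h.1.continuous_fderiv (by simp)).clm_apply continuous_const

lemma isWeakDeriv_iff (e : ℝ × ℝ) (f g : L2Omega) : IsWeakDeriv e f g ↔
    ∀ θ : ℝ × ℝ → ℝ, IsTestFunction Omega θ →
      ⟪omegaFun fun p => fderiv ℝ θ p e, f⟫_ℂ = -⟪omegaFun θ, g⟫_ℂ := by
  refine forall₂_congr fun θ hθ => ?_
  rw [inner_omegaFun (hθ.continuous_fderiv_apply e), inner_omegaFun hθ.1.continuous]

/-- Written with inner products, each test function imposes the equality of two continuous
functionals. -/
lemma isClosed_H1Omega : IsClosed (H1Omega : Set (PiLp 2 (fun _ : Fin 3 => L2Omega))) := by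
  have h : (H1Omega : Set (PiLp 2 (fun _ : Fin 3 => L2Omega)))
      = {F | ∀ θ : ℝ × ℝ → ℝ, IsTestFunction Omega θ →
        ⟪omegaFun fun p => fderiv ℝ θ p (1, 0), F 0⟫_ℂ = -⟪omegaFun θ, F 1⟫_ℂ} ∩
        {F | ∀ θ : ℝ × ℝ → ℝ, IsTestFunction Omega θ →
        ⟪omegaFun fun p => fderiv ℝ θ p (0, 1), F 0⟫_ℂ = -⟪omegaFun θ, F 2⟫_ℂ} := by
    ext F
    exact and_congr (isWeakDeriv_iff _ _ _) (isWeakDeriv_iff _ _ _)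
  rw [h]
  refine IsClosed.inter ?_ ?_ <;>
  · simp only [ofPred_forall]
    exact isClosed_iInter fun θ => isClosed_iInter fun hθ => isClosed_eq (by fun_prop) (by fun_prop)

instance : CompleteSpace H1Omega := isClosed_H1Omega.completeSpace_coe

namespace H1Omega

/-- `val` as a bounded operator. -/
def valL : H1Omega →L[ℂ] L2Omega := (PiLp.proj 2 (fun _ : Fin 3 => L2Omega) 0).comp H1Omega.subtypeL

/-- `dx` as a bounded operator. -/
def dxL : H1Omega →L[ℂ] L2Omega := (PiLp.proj 2 (fun _ : Fin 3 => L2Omega) 1).comp H1Omega.subtypeL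

/-- `dy` as a bounded operator. -/
def dyL : H1Omega →L[ℂ] L2Omega := (PiLp.proj 2 (fun _ : Fin 3 => L2Omega) 2).comp H1Omega.subtypeL

lemma inner_eq (F G : H1Omega) :
    ⟪F, G⟫_ℂ = ⟪val F, val G⟫_ℂ + ⟪dx F, dx G⟫_ℂ + ⟪dy F, dy G⟫_ℂ := by
  rw [Submodule.coe_inner, PiLp.inner_apply, Fin.sum_univ_three]
  rfl

lemma norm_sq_eq (F : H1Omega) : ‖F‖ ^ 2 = ‖val F‖ ^ 2 + ‖dx F‖ ^ 2 + ‖dy F‖ ^ 2 := by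
  rw [Submodule.coe_norm, PiLp.norm_sq_eq_of_L2, Fin.sum_univ_three]
  rfl

end H1Omega

lemma gradPairing_eq (F G : H1Omega) : gradPairing F G
    = ⟪H1Omega.dxL G, H1Omega.dxL F⟫_ℂ + ⟪H1Omega.dyL G, H1Omega.dyL F⟫_ℂ := rfl

lemma gradPairing_conj (F G : H1Omega) : starRingEnd ℂ (gradPairing G F) = gradPairing F G := by
  rw [gradPairing, gradPairing, map_add, inner_conj_symm, inner_conj_symm]

lemma isTopTrace_iff (F : H1Omega) (g : L2Top) : IsTopTrace F g ↔
    ∀ θ : ℝ × ℝ → ℝ, IsTestFunction (Ioo 0 Real.pi ×ˢ Ioi (-1)) θ →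
      ⟪omegaFun fun p => fderiv ℝ θ p (0, 1), H1Omega.valL F⟫_ℂ
        + ⟪omegaFun θ, H1Omega.dyL F⟫_ℂ = ⟪topFun fun x => θ (x, 0), g⟫_ℂ := by
  refine forall₂_congr fun θ hθ => ?_
  have hc := hθ.1.continuous
  rw [inner_omegaFun (hθ.continuous_fderiv_apply _), inner_omegaFun hc,
    inner_topFun (by fun_prop), integral_add (hθ.integrable_fderiv _ _) (hθ.integrable _)]
  rfl

lemma isLeftTrace_iff (F : H1Omega) (g : L2Side) : IsLeftTrace F g ↔
    ∀ θ : ℝ × ℝ → ℝ, IsTestFunction (Iio Real.pi ×ˢ Ioo (-1) 0) θ →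
      ⟪omegaFun fun p => fderiv ℝ θ p (1, 0), H1Omega.valL F⟫_ℂ
        + ⟪omegaFun θ, H1Omega.dxL F⟫_ℂ = -⟪sideFun fun y => θ (0, y), g⟫_ℂ := by
  refine forall₂_congr fun θ hθ => ?_
  have hc := hθ.1.continuous
  rw [inner_omegaFun (hθ.continuous_fderiv_apply _), inner_omegaFun hc,
    inner_sideFun (by fun_prop), integral_add (hθ.integrable_fderiv _ _) (hθ.integrable _)]
  rfl

/-- The graph of the top trace, a closed subspace. -/
def topTraceGraph : Submodule ℂ (H1Omega × L2Top) where
  carrier := {q | IsTopTrace q.1 q.2}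
  zero_mem' := by
    rw [mem_ofPred_eq, isTopTrace_iff]
    intro θ _
    simp
  add_mem' := by
    intro q q' h h'
    rw [mem_ofPred_eq, isTopTrace_iff] at *
    intro θ hθ
    simp only [Prod.fst_add, Prod.snd_add, map_add, inner_add_right]
    linear_combination h θ hθ + h' θ hθ
  smul_mem' := by
    intro c q h
    rw [mem_ofPred_eq, isTopTrace_iff] at *
    intro θ hθ
    simp only [Prod.smul_fst, Prod.smul_snd, map_smul, inner_smul_right]
    linear_combination c * h θ hθ

lemma isClosed_topTraceGraph : IsClosed (topTraceGraph : Set (H1Omega × L2Top)) := by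
  have h : (topTraceGraph : Set (H1Omega × L2Top)) = {q | ∀ θ : ℝ × ℝ → ℝ,
      IsTestFunction (Ioo 0 Real.pi ×ˢ Ioi (-1)) θ →
      ⟪omegaFun fun p => fderiv ℝ θ p (0, 1), H1Omega.valL q.1⟫_ℂ
        + ⟪omegaFun θ, H1Omega.dyL q.1⟫_ℂ = ⟪topFun fun x => θ (x, 0), q.2⟫_ℂ} := by
    ext q
    exact isTopTrace_iff _ _
  rw [h]
  simp only [ofPred_forall]
  exact isClosed_iInter fun θ => isClosed_iInter fun hθ => isClosed_eq (by fun_prop) (by fun_prop)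

lemma IsTopTrace.add {F G : H1Omega} {f g : L2Top} (h : IsTopTrace F f) (h' : IsTopTrace G g) :
    IsTopTrace (F + G) (f + g) := topTraceGraph.add_mem (x := (F, f)) (y := (G, g)) h h'

lemma IsTopTrace.sub {F G : H1Omega} {f g : L2Top} (h : IsTopTrace F f) (h' : IsTopTrace G g) :
    IsTopTrace (F - G) (f - g) := topTraceGraph.sub_mem (x := (F, f)) (y := (G, g)) h h'

lemma IsTopTrace.smul {F : H1Omega} {f : L2Top} (c : ℂ) (h : IsTopTrace F f) :
    IsTopTrace (c • F) (c • f) := topTraceGraph.smul_mem c (x := (F, f)) h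

lemma IsTopTrace.neg {F : H1Omega} {f : L2Top} (h : IsTopTrace F f) :
    IsTopTrace (-F) (-f) := topTraceGraph.neg_mem (x := (F, f)) h

/-! ### Smooth product functions in `ℋ¹(Ω)` -/

lemma Omega_ae_eq_Icc : Omega =ᵐ[volume] Icc ((0 : ℝ), (-1 : ℝ)) (Real.pi, 0) := by
  rw [Omega, ← Icc_prod_Icc]
  exact Measure.set_prod_ae_eq Ioo_ae_eq_Icc Ioo_ae_eq_Icc

lemma integral_Omega_fderiv_snd {G : ℝ × ℝ → ℝ} (hG : ContDiff ℝ 1 G) :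
    ∫ p in Omega, fderiv ℝ G p (0, 1)
      = (∫ x in Icc 0 Real.pi, G (x, 0)) - ∫ x in Icc 0 Real.pi, G (x, -1) := by
  have hc : Continuous fun p => fderiv ℝ G p (0, 1) :=
    (hG.continuous_fderiv one_ne_zero).clm_apply continuous_const
  have h := integral_divergence_prod_Icc_of_hasFDerivAt_of_le (fun _ => (0 : ℝ)) G
    (fun _ => 0) (fderiv ℝ G) (0, -1) (Real.pi, 0)
    ⟨Real.pi_pos.le, by norm_num⟩ continuousOn_const hG.continuous.continuousOn
    (fun x _ => hasFDerivAt_const _ _)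
    (fun x _ => (hG.differentiable (by simp) x).hasFDerivAt)
    (by simpa using hc.continuousOn.integrableOn_compact isCompact_Icc)
  simp only [zero_apply, zero_add, intervalIntegral.integral_zero, add_zero,
    sub_zero] at h
  rw [Measure.restrict_congr_set Omega_ae_eq_Icc, h,
    intervalIntegral.integral_of_le Real.pi_pos.le, intervalIntegral.integral_of_le Real.pi_pos.le,
    integral_Icc_eq_integral_Ioc, integral_Icc_eq_integral_Ioc]

lemma integral_Omega_fderiv_fst {G : ℝ × ℝ → ℝ} (hG : ContDiff ℝ 1 G) :
    ∫ p in Omega, fderiv ℝ G p (1, 0)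
      = (∫ y in Icc (-1) 0, G (Real.pi, y)) - ∫ y in Icc (-1) 0, G (0, y) := by
  have hc : Continuous fun p => fderiv ℝ G p (1, 0) :=
    (hG.continuous_fderiv one_ne_zero).clm_apply continuous_const
  have h := integral_divergence_prod_Icc_of_hasFDerivAt_of_le G (fun _ => (0 : ℝ))
    (fderiv ℝ G) (fun _ => 0) (0, -1) (Real.pi, 0)
    ⟨Real.pi_pos.le, by norm_num⟩ hG.continuous.continuousOn continuousOn_const
    (fun x _ => (hG.differentiable (by simp) x).hasFDerivAt)
    (fun x _ => hasFDerivAt_const _ _)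
    (by simpa using hc.continuousOn.integrableOn_compact isCompact_Icc)
  simp only [zero_apply, zero_add, intervalIntegral.integral_zero, add_zero,
    sub_zero] at h
  rw [Measure.restrict_congr_set Omega_ae_eq_Icc, h,
    intervalIntegral.integral_of_le (by norm_num), intervalIntegral.integral_of_le (by norm_num),
    integral_Icc_eq_integral_Ioc, integral_Icc_eq_integral_Ioc]

lemma fderiv_prod_fst {a c : ℝ → ℝ} (ha : Differentiable ℝ a) (hc : Differentiable ℝ c)
    (p : ℝ × ℝ) : fderiv ℝ (fun p : ℝ × ℝ => a p.1 * c p.2) p (1, 0) = deriv a p.1 * c p.2 := by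
  have h1 := (ha p.1).hasDerivAt.hasFDerivAt.comp p hasFDerivAt_fst
  have h2 := (hc p.2).hasDerivAt.hasFDerivAt.comp p hasFDerivAt_snd
  have h3 := (h1.mul h2).fderiv
  change fderiv ℝ (fun p : ℝ × ℝ => a p.1 * c p.2) p = _ at h3
  rw [h3]
  simp [mul_comm]

lemma fderiv_prod_snd {a c : ℝ → ℝ} (ha : Differentiable ℝ a) (hc : Differentiable ℝ c)
    (p : ℝ × ℝ) : fderiv ℝ (fun p : ℝ × ℝ => a p.1 * c p.2) p (0, 1) = a p.1 * deriv c p.2 := by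
  have h1 := (ha p.1).hasDerivAt.hasFDerivAt.comp p hasFDerivAt_fst
  have h2 := (hc p.2).hasDerivAt.hasFDerivAt.comp p hasFDerivAt_snd
  have h3 := (h1.mul h2).fderiv
  change fderiv ℝ (fun p : ℝ × ℝ => a p.1 * c p.2) p = _ at h3
  rw [h3]
  simp

/-- The identity `∫ (∂θ/∂e) f + θ (∂f/∂e) = ∫ ∂(θ f)/∂e` for smooth `f`. -/
lemma inner_fderiv_add_inner {V : Set (ℝ × ℝ)} {θ f : ℝ × ℝ → ℝ} (hθ : IsTestFunction V θ)
    (hf : ContDiff ℝ ∞ f) (e : ℝ × ℝ) :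
    ⟪omegaFun fun p => fderiv ℝ θ p e, omegaFun f⟫_ℂ
      + ⟪omegaFun θ, omegaFun fun p => fderiv ℝ f p e⟫_ℂ
      = ((∫ p in Omega, fderiv ℝ (fun p => θ p * f p) p e : ℝ) : ℂ) := by
  have hfc : Continuous fun p => fderiv ℝ f p e :=
    (hf.continuous_fderiv (by simp)).clm_apply continuous_const
  rw [inner_omegaFun (hθ.continuous_fderiv_apply e), inner_omegaFun hθ.1.continuous,
    ← integral_add (hθ.integrable_fderiv _ _) (hθ.integrable _), ← integral_complex_ofReal]
  refine integral_congr_ae ?_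
  filter_upwards [coeFn_omegaFun hf.continuous, coeFn_omegaFun hfc] with p h1 h2
  rw [h1, h2, fderiv_fun_mul (hθ.1.differentiable (by simp) p) (hf.differentiable (by simp) p)]
  simp
  ring

lemma IsTestFunction.eq_zero {V : Set (ℝ × ℝ)} {θ : ℝ × ℝ → ℝ} (h : IsTestFunction V θ)
    {p : ℝ × ℝ} (hp : p ∉ V) : θ p = 0 := by
  by_contra hne
  exact hp (h.2.2 (subset_tsupport θ hne))

section ProdH1

variable {a c : ℝ → ℝ} (ha : ContDiff ℝ ∞ a) (hc : ContDiff ℝ ∞ c)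

lemma contDiff_prod (ha : ContDiff ℝ ∞ a) (hc : ContDiff ℝ ∞ c) :
    ContDiff ℝ ∞ fun p : ℝ × ℝ => a p.1 * c p.2 :=
  (ha.comp contDiff_fst).mul (hc.comp contDiff_snd)

lemma omegaFun_fderiv_fst (ha : ContDiff ℝ ∞ a) (hc : ContDiff ℝ ∞ c) :
    (omegaFun fun p => fderiv ℝ (fun p : ℝ × ℝ => a p.1 * c p.2) p (1, 0))
      = prodFun (deriv a) c := by
  rw [prodFun]
  congr 1
  ext p
  exact fderiv_prod_fst (ha.differentiable (by simp)) (hc.differentiable (by simp)) p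

lemma omegaFun_fderiv_snd (ha : ContDiff ℝ ∞ a) (hc : ContDiff ℝ ∞ c) :
    (omegaFun fun p => fderiv ℝ (fun p : ℝ × ℝ => a p.1 * c p.2) p (0, 1))
      = prodFun a (deriv c) := by
  rw [prodFun]
  congr 1
  ext p
  exact fderiv_prod_snd (ha.differentiable (by simp)) (hc.differentiable (by simp)) p

/-- `a(x) c(y)` as an element of `ℋ¹(Ω)`. -/
def prodH1 : H1Omega := ⟨WithLp.toLp 2 ![prodFun a c, prodFun (deriv a) c, prodFun a (deriv c)], by
  constructor
  · rw [isWeakDeriv_iff]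
    intro θ hθ
    change ⟪_, prodFun a c⟫_ℂ = -⟪_, prodFun (deriv a) c⟫_ℂ
    rw [eq_neg_iff_add_eq_zero, ← omegaFun_fderiv_fst ha hc, prodFun,
      inner_fderiv_add_inner hθ (contDiff_prod ha hc),
      integral_Omega_fderiv_fst ((hθ.1.mul (contDiff_prod ha hc)).of_le (by simp))]
    have h1 : ∀ y, θ (Real.pi, y) = 0 := fun y => hθ.eq_zero fun h => lt_irrefl _ h.1.2
    have h2 : ∀ y, θ (0, y) = 0 := fun y => hθ.eq_zero fun h => lt_irrefl _ h.1.1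
    simp [h1, h2]
  · rw [isWeakDeriv_iff]
    intro θ hθ
    change ⟪_, prodFun a c⟫_ℂ = -⟪_, prodFun a (deriv c)⟫_ℂ
    rw [eq_neg_iff_add_eq_zero, ← omegaFun_fderiv_snd ha hc, prodFun,
      inner_fderiv_add_inner hθ (contDiff_prod ha hc),
      integral_Omega_fderiv_snd ((hθ.1.mul (contDiff_prod ha hc)).of_le (by simp))]
    have h1 : ∀ x, θ (x, 0) = 0 := fun y => hθ.eq_zero fun h => lt_irrefl _ h.2.2
    have h2 : ∀ x, θ (x, -1) = 0 := fun y => hθ.eq_zero fun h => lt_irrefl _ h.2.1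
    simp [h1, h2]⟩

lemma val_prodH1 : H1Omega.val (prodH1 ha hc) = prodFun a c := rfl
lemma dx_prodH1 : H1Omega.dx (prodH1 ha hc) = prodFun (deriv a) c := rfl
lemma dy_prodH1 : H1Omega.dy (prodH1 ha hc) = prodFun a (deriv c) := rfl

lemma isTopTrace_prodH1 : IsTopTrace (prodH1 ha hc) (((c 0 : ℝ) : ℂ) • topFun a) := by
  rw [isTopTrace_iff]
  intro θ hθ
  have hcont := hθ.1.continuous
  have hac := ha.continuous
  change ⟪_, prodFun a c⟫_ℂ + ⟪_, prodFun a (deriv c)⟫_ℂ = _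
  rw [← omegaFun_fderiv_snd ha hc, prodFun, inner_fderiv_add_inner hθ (contDiff_prod ha hc),
      integral_Omega_fderiv_snd ((hθ.1.mul (contDiff_prod ha hc)).of_le (by simp))]
  have h2 : ∀ x, θ (x, -1) = 0 := fun y => hθ.eq_zero fun h => lt_irrefl _ (mem_Ioi.1 h.2)
  simp only [h2, zero_mul, integral_zero, sub_zero]
  rw [inner_smul_right, inner_topFun (by fun_prop), ← integral_const_mul, ← integral_complex_ofReal]
  refine integral_congr_ae ?_
  filter_upwards [coeFn_topFun hac] with x hx
  rw [hx, Complex.real_smul]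
  push_cast; ring

lemma isLeftTrace_prodH1 : IsLeftTrace (prodH1 ha hc) (((a 0 : ℝ) : ℂ) • sideFun c) := by
  rw [isLeftTrace_iff]
  intro θ hθ
  have hcont := hθ.1.continuous
  have hcc := hc.continuous
  change ⟪_, prodFun a c⟫_ℂ + ⟪_, prodFun (deriv a) c⟫_ℂ = _
  rw [← omegaFun_fderiv_fst ha hc, prodFun, inner_fderiv_add_inner hθ (contDiff_prod ha hc),
      integral_Omega_fderiv_fst ((hθ.1.mul (contDiff_prod ha hc)).of_le (by simp))]
  have h2 : ∀ y, θ (Real.pi, y) = 0 := fun y => hθ.eq_zero fun h => lt_irrefl _ (mem_Iio.1 h.1)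
  simp only [h2, zero_mul, integral_zero, zero_sub]
  rw [inner_smul_right, inner_sideFun (by fun_prop), ← integral_const_mul, Complex.ofReal_neg,
    ← integral_complex_ofReal]
  congr 1
  refine integral_congr_ae ?_
  filter_upwards [coeFn_sideFun hcc] with x hx
  rw [hx, Complex.real_smul]
  push_cast; ring

end ProdH1

/-! ### Green's formula with product test functions -/

lemma tendsto_integral_smul {α : Type*} [MeasurableSpace α] {μ : Measure α} {f : α → ℂ}
    (hf : Integrable f μ) {θ : ℕ → α → ℝ} {θ₀ : α → ℝ}
    (hm : ∀ n, AEStronglyMeasurable (θ n) μ) {C : ℝ} (hb : ∀ n, ∀ᵐ x ∂μ, |θ n x| ≤ C)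
    (hl : ∀ᵐ x ∂μ, Tendsto (fun n => θ n x) atTop (𝓝 (θ₀ x))) :
    Tendsto (fun n => ∫ x, θ n x • f x ∂μ) atTop (𝓝 (∫ x, θ₀ x • f x ∂μ)) := by
  refine tendsto_integral_of_dominated_convergence (fun x => C * ‖f x‖)
    (fun n => (hm n).smul hf.aestronglyMeasurable) (hf.norm.const_mul C) (fun n => ?_) ?_
  · filter_upwards [hb n] with x hx
    rw [norm_smul]
    exact mul_le_mul_of_nonneg_right hx (norm_nonneg _)
  · filter_upwards [hl] with x hx
    exact hx.smul_const _

lemma tendsto_inner_prodFun {I J : Set ℝ} (hI : Ioo 0 Real.pi ⊆ I) (hJ : Ioo (-1) 0 ⊆ J)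
    {A C : ℕ → ℝ → ℝ} {a c : ℝ → ℝ} (hA : ∀ n, Continuous (A n)) (hC : ∀ n, Continuous (C n))
    (ha : Continuous a) (hc : Continuous c)
    (bA : ∃ K, ∀ n, ∀ x ∈ I, |A n x| ≤ K) (bC : ∃ K, ∀ n, ∀ x ∈ J, |C n x| ≤ K)
    (lA : ∀ x ∈ I, Tendsto (fun n => A n x) atTop (𝓝 (a x)))
    (lC : ∀ x ∈ J, Tendsto (fun n => C n x) atTop (𝓝 (c x))) (f : L2Omega) :
    Tendsto (fun n => ⟪prodFun (A n) (C n), f⟫_ℂ) atTop (𝓝 ⟪prodFun a c, f⟫_ℂ) := by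
  obtain ⟨K, hK⟩ := bA
  obtain ⟨L, hL⟩ := bC
  simp only [inner_prodFun (hA _) (hC _), inner_prodFun ha hc]
  refine tendsto_integral_smul ((Lp.memLp f).integrable one_le_two) (C := K * L)
    (fun n => Continuous.aestronglyMeasurable
      (((hA n).comp continuous_fst).mul ((hC n).comp continuous_snd))) (fun n => ?_) ?_
  · refine (ae_restrict_iff' measurableSet_Omega).2 (Eventually.of_forall fun p hp => ?_)
    rw [abs_mul]
    exact mul_le_mul (hK n _ (hI hp.1)) (hL n _ (hJ hp.2)) (abs_nonneg _)
      ((abs_nonneg _).trans (hK n _ (hI hp.1)))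
  · refine (ae_restrict_iff' measurableSet_Omega).2 (Eventually.of_forall fun p hp => ?_)
    exact (lA _ (hI hp.1)).mul (lC _ (hJ hp.2))

lemma isTestFunction_prod {U V : Set ℝ} {A C : ℕ → ℝ → ℝ} {n : ℕ}
    (hA : ContDiff ℝ ∞ (A n)) (hC : ContDiff ℝ ∞ (C n))
    (sA : CompactlySupportedIn U A) (sC : CompactlySupportedIn V C) :
    IsTestFunction (U ×ˢ V) fun p => A n p.1 * C n p.2 := by
  obtain ⟨K, hKU, hK, hK0⟩ := sA n
  obtain ⟨L, hLV, hL, hL0⟩ := sC n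
  have h0 : ∀ p ∉ K ×ˢ L, A n p.1 * C n p.2 = 0 := by
    intro p hp
    rw [mem_prod, not_and_or] at hp
    rcases hp with hp | hp
    · rw [hK0 _ hp, zero_mul]
    · rw [hL0 _ hp, mul_zero]
  refine ⟨contDiff_prod hA hC, HasCompactSupport.intro (hK.prod hL) h0, ?_⟩
  refine (closure_minimal ?_ (hK.prod hL).isClosed).trans (prod_mono hKU hLV)
  exact Function.support_subset_iff'.2 h0

variable {a c : ℝ → ℝ}

/-- The definition of the weak derivative passes to the limit along cut-offs. Only a is
differentiated, so a must vanish at 0 and π while c is arbitrary; no trace on the vertical sides is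
involved. -/
lemma green_x (ha : ContDiff ℝ ∞ a) (hc : ContDiff ℝ ∞ c) (h0 : a 0 = 0) (hπ : a Real.pi = 0)
    (F : H1Omega) :
    ⟪prodFun (deriv a) c, H1Omega.val F⟫_ℂ + ⟪prodFun a c, H1Omega.dx F⟫_ℂ = 0 := by
  obtain ⟨A, hA, sA⟩ := exists_approx_deriv_Ioo ha h0 hπ
  obtain ⟨C, hC, sC⟩ := exists_approx_Ioo (l := -1) (r := 0) hc
  have l1 := tendsto_inner_prodFun subset_rfl subset_rfl
    (fun n => (hA.contDiff n).continuous_deriv (by simp)) (fun n => (hC.contDiff n).continuous)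
    (ha.continuous_deriv (by simp)) hc.continuous hA.bound_deriv hC.bound hA.lim_deriv hC.lim
    (H1Omega.val F)
  have l2 := tendsto_inner_prodFun subset_rfl subset_rfl
    (fun n => (hA.contDiff n).continuous) (fun n => (hC.contDiff n).continuous)
    ha.continuous hc.continuous hA.bound hC.bound hA.lim hC.lim (H1Omega.dx F)
  refine tendsto_nhds_unique (l1.add l2) (tendsto_const_nhds.congr fun n => ?_)
  have ht : IsTestFunction Omega _ := isTestFunction_prod (hA.contDiff n) (hC.contDiff n) sA sC
  have h := (isWeakDeriv_iff _ _ _).1 F.2.1 _ ht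
  rw [omegaFun_fderiv_fst (hA.contDiff n) (hC.contDiff n)] at h
  change ⟪_, H1Omega.val F⟫_ℂ = -⟪_, H1Omega.dx F⟫_ℂ at h
  rw [h]
  exact (neg_add_cancel _).symm

/-- The same limit in the trace identity. The condition c(-1) = 0 removes the bottom, the value c(0)
keeps the top, and a is arbitrary because it is not differentiated. -/
lemma green_y (ha : ContDiff ℝ ∞ a) (hc : ContDiff ℝ ∞ c) (h0 : c (-1) = 0) {F : H1Omega}
    {g : L2Top} (hF : IsTopTrace F g) :
    ⟪prodFun a (deriv c), H1Omega.val F⟫_ℂ + ⟪prodFun a c, H1Omega.dy F⟫_ℂ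
      = c 0 * ⟪topFun a, g⟫_ℂ := by
  obtain ⟨A, hA, sA⟩ := exists_approx_Ioo (l := 0) (r := Real.pi) ha
  obtain ⟨C, hC, sC⟩ := exists_approx_deriv_Ioc (r := 0) hc h0
  have l1 := tendsto_inner_prodFun subset_rfl Ioo_subset_Ioc_self
    (fun n => (hA.contDiff n).continuous) (fun n => (hC.contDiff n).continuous_deriv (by simp))
    ha.continuous (hc.continuous_deriv (by simp)) hA.bound hC.bound_deriv hA.lim hC.lim_deriv
    (H1Omega.val F)
  have l2 := tendsto_inner_prodFun subset_rfl Ioo_subset_Ioc_self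
    (fun n => (hA.contDiff n).continuous) (fun n => (hC.contDiff n).continuous)
    ha.continuous hc.continuous hA.bound hC.bound hA.lim hC.lim (H1Omega.dy F)
  have hIoo : ∀ᵐ x ∂(volume.restrict (Icc 0 Real.pi)), x ∈ Ioo 0 Real.pi := by
    rw [Measure.restrict_congr_set Ioo_ae_eq_Icc.symm]
    exact ae_restrict_mem measurableSet_Ioo
  have l3 : Tendsto (fun n => (C n 0 : ℂ) * ⟪topFun (A n), g⟫_ℂ) atTop
      (𝓝 (c 0 * ⟪topFun a, g⟫_ℂ)) := by
    have hl := hC.lim 0 (by simp)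
    refine Tendsto.mul (Complex.continuous_ofReal.continuousAt.tendsto.comp hl) ?_
    simp only [inner_topFun (hA.contDiff _).continuous, inner_topFun ha.continuous]
    obtain ⟨K, hK⟩ := hA.bound
    refine tendsto_integral_smul ((Lp.memLp g).integrable one_le_two) (C := K)
      (fun n => (hA.contDiff n).continuous.aestronglyMeasurable) (fun n => ?_) ?_
    · filter_upwards [hIoo] with x hx using hK n x hx
    · filter_upwards [hIoo] with x hx using hA.lim x hx
  refine tendsto_nhds_unique (l1.add l2) (l3.congr fun n => ?_)
  have ht := isTestFunction_prod (hA.contDiff n) (hC.contDiff n) sA sC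
  have h := (isTopTrace_iff _ _).1 hF _ ht
  rw [omegaFun_fderiv_snd (hA.contDiff n) (hC.contDiff n)] at h
  refine Eq.trans ?_ h.symm
  rw [inner_topFun (hA.contDiff n).continuous,
    inner_topFun (a := fun x => A n x * C n 0) ((hA.contDiff n).continuous.mul continuous_const),
    ← integral_const_mul]
  congr 1
  ext x
  simp only [Complex.real_smul]
  push_cast; ring

/-- Here a(π) = 0 removes the right side; the minus sign comes from the outward normal on the left
side. -/
lemma green_left (ha : ContDiff ℝ ∞ a) (hc : ContDiff ℝ ∞ c) (h0 : a Real.pi = 0) {F : H1Omega}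
    {g : L2Side} (hF : IsLeftTrace F g) :
    ⟪prodFun (deriv a) c, H1Omega.val F⟫_ℂ + ⟪prodFun a c, H1Omega.dx F⟫_ℂ
      = -(a 0 * ⟪sideFun c, g⟫_ℂ) := by
  obtain ⟨C, hC, sC⟩ := exists_approx_Ioo (l := -1) (r := 0) hc
  obtain ⟨A, hA, sA⟩ := exists_approx_deriv_Ico (l := 0) ha h0
  have l1 := tendsto_inner_prodFun Ioo_subset_Ico_self subset_rfl
    (fun n => (hA.contDiff n).continuous_deriv (by simp)) (fun n => (hC.contDiff n).continuous)
    (ha.continuous_deriv (by simp)) hc.continuous hA.bound_deriv hC.bound hA.lim_deriv hC.lim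
    (H1Omega.val F)
  have l2 := tendsto_inner_prodFun Ioo_subset_Ico_self subset_rfl
    (fun n => (hA.contDiff n).continuous) (fun n => (hC.contDiff n).continuous)
    ha.continuous hc.continuous hA.bound hC.bound hA.lim hC.lim (H1Omega.dx F)
  have hIoo : ∀ᵐ y ∂(volume.restrict (Icc (-1 : ℝ) 0)), y ∈ Ioo (-1 : ℝ) 0 := by
    rw [Measure.restrict_congr_set Ioo_ae_eq_Icc.symm]
    exact ae_restrict_mem measurableSet_Ioo
  have l3 : Tendsto (fun n => -((A n 0 : ℂ) * ⟪sideFun (C n), g⟫_ℂ)) atTop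
      (𝓝 (-(a 0 * ⟪sideFun c, g⟫_ℂ))) := by
    have hl := hA.lim 0 (by simp [Real.pi_pos])
    refine (Tendsto.mul (Complex.continuous_ofReal.continuousAt.tendsto.comp hl) ?_).neg
    simp only [inner_sideFun (hC.contDiff _).continuous, inner_sideFun hc.continuous]
    obtain ⟨K, hK⟩ := hC.bound
    refine tendsto_integral_smul ((Lp.memLp g).integrable one_le_two) (C := K)
      (fun n => (hC.contDiff n).continuous.aestronglyMeasurable) (fun n => ?_) ?_
    · filter_upwards [hIoo] with x hx using hK n x hx
    · filter_upwards [hIoo] with x hx using hC.lim x hx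
  refine tendsto_nhds_unique (l1.add l2) (l3.congr fun n => ?_)
  have ht := isTestFunction_prod (hA.contDiff n) (hC.contDiff n) sA sC
  have h := (isLeftTrace_iff _ _).1 hF _ ht
  rw [omegaFun_fderiv_fst (hA.contDiff n) (hC.contDiff n)] at h
  refine Eq.trans ?_ h.symm
  rw [inner_sideFun (hC.contDiff n).continuous,
    inner_sideFun (a := fun y => A n 0 * C n y) (continuous_const.mul (hC.contDiff n).continuous),
    ← integral_const_mul]
  congr 2
  ext x
  simp only [Complex.real_smul]
  push_cast; ring

/-! ### Separation by smooth functions -/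

lemma L2Omega_eq_zero {f : L2Omega} (h : ∀ θ, IsTestFunction Omega θ → ⟪omegaFun θ, f⟫_ℂ = 0) :
    f = 0 := by
  have hO : IsOpen Omega := isOpen_Ioo.prod isOpen_Ioo
  have hi : IntegrableOn f Omega := (Lp.memLp f).integrable one_le_two
  have hae := hO.ae_eq_zero_of_integral_contDiff_smul_eq_zero hi.locallyIntegrableOn
    (fun g hg hs ht => by
      rw [← h g ⟨hg, hs, ht⟩, inner_omegaFun hg.continuous,
        setIntegral_eq_integral_of_forall_compl_eq_zero]
      intro p hp
      rw [IsTestFunction.eq_zero ⟨hg, hs, ht⟩ hp, zero_smul])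
  apply Lp.ext
  refine EventuallyEq.trans ?_ (Lp.coeFn_zero ℂ 2 (volume.restrict Omega)).symm
  exact (ae_restrict_iff' measurableSet_Omega).2 hae

lemma L2Side_eq_zero {f : L2Side} (h : ∀ c : ℝ → ℝ, ContDiff ℝ ∞ c → ⟪sideFun c, f⟫_ℂ = 0) :
    f = 0 := by
  have hi : IntegrableOn f (Icc (-1) 0) := (Lp.memLp f).integrable one_le_two
  have hae := isOpen_Ioo.ae_eq_zero_of_integral_contDiff_smul_eq_zero
    (hi.mono_set Ioo_subset_Icc_self).locallyIntegrableOn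
    (fun g hg hs ht => by
      rw [← h g hg, inner_sideFun hg.continuous, setIntegral_eq_integral_of_forall_compl_eq_zero]
      intro p hp
      have : g p = 0 := by
        by_contra hne
        exact hp (Ioo_subset_Icc_self (ht (subset_tsupport g hne)))
      rw [this, zero_smul])
  apply Lp.ext
  refine EventuallyEq.trans ?_ (Lp.coeFn_zero ℂ 2 (volume.restrict (Icc (-1 : ℝ) 0))).symm
  have e : ae ((volume : Measure ℝ).restrict (Icc (-1) 0)) = ae (volume.restrict (Ioo (-1) 0)) := by
    rw [Measure.restrict_congr_set Ioo_ae_eq_Icc]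
  rw [EventuallyEq, e]
  exact (ae_restrict_iff' measurableSet_Ioo).2 hae

/-- Weak derivatives are determined by the function, since test functions separate points of L²(Ω).
-/
lemma H1Omega.eq_zero_of_val_eq_zero {F : H1Omega} (h : H1Omega.val F = 0) : F = 0 := by
  have hx : H1Omega.dx F = 0 := L2Omega_eq_zero fun θ hθ => by
    have := (isWeakDeriv_iff _ _ _).1 F.2.1 θ hθ
    change ⟪_, H1Omega.val F⟫_ℂ = -⟪_, H1Omega.dx F⟫_ℂ at this
    rw [h, inner_zero_right] at this
    exact neg_eq_zero.1 this.symm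
  have hy : H1Omega.dy F = 0 := L2Omega_eq_zero fun θ hθ => by
    have := (isWeakDeriv_iff _ _ _).1 F.2.2 θ hθ
    change ⟪_, H1Omega.val F⟫_ℂ = -⟪_, H1Omega.dy F⟫_ℂ at this
    rw [h, inner_zero_right] at this
    exact neg_eq_zero.1 this.symm
  have := H1Omega.norm_sq_eq F
  rw [h, hx, hy] at this
  simpa using this

/-! ### Eigenfunctions of the mixed Laplacian -/

/-- The normalized functions `cos(kx)` on `[0,π]`, `k ≥ 0`. -/
def cosX (k : ℕ) (x : ℝ) : ℝ :=
  Real.sqrt ((if k = 0 then 1 else 2) / Real.pi) * Real.cos (k * x)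

/-- `m ↦ (m + 1/2)π`. -/
def freqY (m : ℕ) : ℝ := (m + 1 / 2) * Real.pi

/-- The functions `√2 cos((m+1/2)π(y+1))` on `[-1,0]`. -/
def cosY (m : ℕ) (y : ℝ) : ℝ := Real.sqrt 2 * Real.cos (freqY m * (y + 1))

/-- The functions `√2 sin((m+1/2)π(y+1))` on `[-1,0]`. -/
def sinY (m : ℕ) (y : ℝ) : ℝ := Real.sqrt 2 * Real.sin (freqY m * (y + 1))

lemma contDiff_cosX (k : ℕ) : ContDiff ℝ ∞ (cosX k) := by unfold cosX; fun_prop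
lemma contDiff_cosY (k : ℕ) : ContDiff ℝ ∞ (cosY k) := by unfold cosY; fun_prop
lemma contDiff_sinY (k : ℕ) : ContDiff ℝ ∞ (sinY k) := by unfold sinY; fun_prop

lemma one_le_freqY (m : ℕ) : 1 ≤ freqY m := by
  have := Real.pi_gt_three
  have hm : (0 : ℝ) ≤ m := Nat.cast_nonneg m
  unfold freqY
  nlinarith

lemma hasDerivAt_affine (k s x : ℝ) : HasDerivAt (fun x => k * (x + s)) k x := by
  simpa using ((hasDerivAt_id x).add_const s).const_mul k

lemma deriv_cosY (m : ℕ) : deriv (cosY m) = fun y => -freqY m * sinY m y := by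
  ext y
  refine (((hasDerivAt_affine (freqY m) 1 y).cos.const_mul (Real.sqrt 2)).deriv).trans ?_
  rw [sinY]; ring

lemma deriv_sinY (m : ℕ) : deriv (sinY m) = fun y => freqY m * cosY m y := by
  ext y
  refine (((hasDerivAt_affine (freqY m) 1 y).sin.const_mul (Real.sqrt 2)).deriv).trans ?_
  rw [cosY]; ring

lemma deriv_cosX (k : ℕ) : deriv (cosX k) = fun x =>
    Real.sqrt ((if k = 0 then 1 else 2) / Real.pi) * (-k * Real.sin (k * x)) := by
  ext x
  have h : HasDerivAt (fun x : ℝ => (k : ℝ) * x) k x := by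
    simpa using (hasDerivAt_id x).const_mul (k : ℝ)
  refine ((h.cos.const_mul _).deriv).trans ?_
  ring

lemma deriv_deriv_cosX (k : ℕ) : deriv (deriv (cosX k)) = fun x => -(k : ℝ) ^ 2 * cosX k x := by
  rw [deriv_cosX]
  ext x
  have h : HasDerivAt (fun x : ℝ => (k : ℝ) * x) k x := by
    simpa using (hasDerivAt_id x).const_mul (k : ℝ)
  refine (((h.sin.const_mul (-(k : ℝ))).const_mul _).deriv).trans ?_
  rw [cosX]; ring

lemma sinY_neg_one (m : ℕ) : sinY m (-1) = 0 := by simp [sinY]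

lemma cosY_zero (m : ℕ) : cosY m 0 = 0 := by
  rw [cosY, zero_add, mul_one, freqY, add_mul, one_div, inv_mul_eq_div, Real.cos_add_pi_div_two,
    Real.sin_nat_mul_pi]
  simp

lemma deriv_cosX_zero (k : ℕ) : deriv (cosX k) 0 = 0 := by simp [deriv_cosX]
lemma deriv_cosX_pi (k : ℕ) : deriv (cosX k) Real.pi = 0 := by simp [deriv_cosX]

lemma integral_cos_side (n : ℤ) :
    ∫ y in Icc (-1 : ℝ) 0, Real.cos (n * (Real.pi * (y + 1))) = if n = 0 then 1 else 0 := by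
  rw [integral_Icc_eq_integral_Ioc, ← intervalIntegral.integral_of_le (by norm_num)]
  split_ifs with h
  · subst h; simp
  · have hn : (n : ℝ) * Real.pi ≠ 0 := mul_ne_zero (by exact_mod_cast h) Real.pi_ne_zero
    have e : ∀ y : ℝ, Real.cos (n * (Real.pi * (y + 1)))
        = (fun z => Real.cos z) (n * Real.pi * y + n * Real.pi) := by
      intro y; congr 1; ring
    simp only [e]
    rw [intervalIntegral.integral_comp_mul_add (fun x => Real.cos x) hn]
    simp

lemma integral_cosX_mul (j k : ℕ) :
    ∫ x in Icc 0 Real.pi, cosX j x * cosX k x = if j = k then 1 else 0 := by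
  have e : ∀ x, cosX j x * cosX k x
      = Real.sqrt ((if j = 0 then 1 else 2) / Real.pi) *
        Real.sqrt ((if k = 0 then 1 else 2) / Real.pi) * (1 / 2) *
        (Real.cos (((j : ℤ) - k : ℤ) * x) + Real.cos (((j : ℤ) + k : ℤ) * x)) := by
    intro x
    push_cast
    rw [cosX, cosX, sub_mul, add_mul, Real.cos_sub, Real.cos_add]
    ring
  simp only [e]
  have hci : ∀ n : ℤ, IntegrableOn (fun x : ℝ => Real.cos (n * x)) (Icc 0 Real.pi) := fun n =>
    (by fun_prop : Continuous fun x : ℝ => Real.cos (n * x)).continuousOn.integrableOn_compact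
      isCompact_Icc
  rw [integral_const_mul, integral_add (hci _) (hci _), integral_cos_int, integral_cos_int]
  by_cases hjk : j = k
  · subst hjk
    rw [Real.mul_self_sqrt (by split_ifs <;> positivity)]
    by_cases hj : j = 0
    · subst hj; simp; field_simp; norm_num
    · have : ((j : ℤ) + j) ≠ 0 := by omega
      simp only [sub_self, hj, this, if_false, if_true, add_zero]
      field_simp
  · have h1 : ((j : ℤ) - k) ≠ 0 := by omega
    have h2 : ((j : ℤ) + k) ≠ 0 := by omega
    rw [if_neg h1, if_neg h2, if_neg hjk]; simp

lemma integrableOn_cos_side (n : ℤ) :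
    IntegrableOn (fun y : ℝ => Real.cos (n * (Real.pi * (y + 1)))) (Icc (-1) 0) :=
  (by fun_prop : Continuous fun y : ℝ =>
    Real.cos (n * (Real.pi * (y + 1)))).continuousOn.integrableOn_compact isCompact_Icc

/-- The frequencies are half-integer multiples of π, so their sums and differences are integer
multiples, and the sum j+k+1 is never zero. -/
lemma integral_cosY_mul (j k : ℕ) :
    ∫ y in Icc (-1) 0, cosY j y * cosY k y = if j = k then 1 else 0 := by
  have e : ∀ y, cosY j y * cosY k y = Real.cos (((j : ℤ) - k : ℤ) * (Real.pi * (y + 1)))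
      + Real.cos (((j : ℤ) + k + 1 : ℤ) * (Real.pi * (y + 1))) := by
    intro y
    push_cast
    rw [cosY, cosY, show ((j : ℝ) - k) * (Real.pi * (y + 1))
        = freqY j * (y + 1) - freqY k * (y + 1) by rw [freqY, freqY]; ring,
      show ((j : ℝ) + k + 1) * (Real.pi * (y + 1))
        = freqY j * (y + 1) + freqY k * (y + 1) by rw [freqY, freqY]; ring,
      Real.cos_sub, Real.cos_add]
    have := Real.mul_self_sqrt (show (0 : ℝ) ≤ 2 by norm_num)
    linear_combination Real.cos (freqY j * (y + 1)) * Real.cos (freqY k * (y + 1)) * this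
  simp only [e]
  rw [integral_add (integrableOn_cos_side _) (integrableOn_cos_side _), integral_cos_side,
    integral_cos_side, if_neg (show ((j : ℤ) + k + 1) ≠ 0 by omega), add_zero]
  exact if_congr (by omega) rfl rfl

lemma integral_sinY_mul (j k : ℕ) :
    ∫ y in Icc (-1) 0, sinY j y * sinY k y = if j = k then 1 else 0 := by
  have e : ∀ y, sinY j y * sinY k y = Real.cos (((j : ℤ) - k : ℤ) * (Real.pi * (y + 1)))
      - Real.cos (((j : ℤ) + k + 1 : ℤ) * (Real.pi * (y + 1))) := by
    intro y
    push_cast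
    rw [sinY, sinY, show ((j : ℝ) - k) * (Real.pi * (y + 1))
        = freqY j * (y + 1) - freqY k * (y + 1) by rw [freqY, freqY]; ring,
      show ((j : ℝ) + k + 1) * (Real.pi * (y + 1))
        = freqY j * (y + 1) + freqY k * (y + 1) by rw [freqY, freqY]; ring,
      Real.cos_sub, Real.cos_add]
    have := Real.mul_self_sqrt (show (0 : ℝ) ≤ 2 by norm_num)
    linear_combination Real.sin (freqY j * (y + 1)) * Real.sin (freqY k * (y + 1)) * this
  simp only [e]
  rw [integral_sub (integrableOn_cos_side _) (integrableOn_cos_side _), integral_cos_side,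
    integral_cos_side, if_neg (show ((j : ℤ) + k + 1) ≠ 0 by omega), sub_zero]
  exact if_congr (by omega) rfl rfl

lemma orthonormal_cosX_cosY :
    Orthonormal ℂ fun q : ℕ × ℕ => prodFun (cosX q.1) (cosY q.2) := by
  rw [orthonormal_iff_ite]
  intro p q
  rw [inner_prodFun_prodFun (contDiff_cosX _).continuous (contDiff_cosY _).continuous
    (contDiff_cosX _).continuous (contDiff_cosY _).continuous, integral_cosX_mul, integral_cosY_mul]
  by_cases h1 : p.1 = q.1 <;> by_cases h2 : p.2 = q.2 <;> simp [h1, h2, Prod.ext_iff]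

lemma orthonormal_cosX_sinY :
    Orthonormal ℂ fun q : ℕ × ℕ => prodFun (cosX q.1) (sinY q.2) := by
  rw [orthonormal_iff_ite]
  intro p q
  rw [inner_prodFun_prodFun (contDiff_cosX _).continuous (contDiff_sinY _).continuous
    (contDiff_cosX _).continuous (contDiff_sinY _).continuous, integral_cosX_mul, integral_sinY_mul]
  by_cases h1 : p.1 = q.1 <;> by_cases h2 : p.2 = q.2 <;> simp [h1, h2, Prod.ext_iff]

lemma ae_eq_zero_of_cosX_moments {f : ℝ → ℂ} (hf : IntegrableOn f (Icc 0 Real.pi))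
    (h : ∀ k, ∫ x in Icc 0 Real.pi, cosX k x • f x = 0) :
    f =ᵐ[volume.restrict (Icc 0 Real.pi)] 0 := by
  refine ae_eq_zero_of_cos_moments one_pos (by ring) hf fun k => ?_
  have h1 := h k
  have e : ∀ x, cosX k x • f x = (Real.sqrt ((if k = 0 then 1 else 2) / Real.pi) : ℂ) *
      (((Real.cos (k * (1 * (x - 0))) : ℝ) : ℂ) * f x) := by
    intro x
    rw [one_mul, sub_zero, cosX, Complex.real_smul]
    push_cast; ring
  simp only [e] at h1
  rw [integral_const_mul] at h1
  refine (mul_eq_zero.1 h1).resolve_left ?_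
  have : (0 : ℝ) < Real.sqrt ((if k = 0 then 1 else 2) / Real.pi) :=
    Real.sqrt_pos.2 (by split_ifs <;> positivity)
  exact_mod_cast this.ne'

/-- Multiply f by cos(π(y+1)/2). A product of this weight with an integer-frequency cosine is a sum
of half-integer cosines, so all integer cosine moments of the weighted function vanish. The weight
is positive on [-1,0), hence f itself vanishes almost everywhere. -/
lemma ae_eq_zero_of_cosY_moments {f : ℝ → ℂ} (hf : IntegrableOn f (Icc (-1) 0))
    (h : ∀ m, ∫ y in Icc (-1) 0, cosY m y • f y = 0) :
    f =ᵐ[volume.restrict (Icc (-1) 0)] 0 := by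
  have hbd : ∀ g : ℝ → ℝ, Continuous g →
      IntegrableOn (fun x => ((g x : ℝ) : ℂ) * f x) (Icc (-1) 0) := fun g hg =>
    hf.continuousOn_mul (by fun_prop) isCompact_Icc
  have h2 : (Real.sqrt 2 : ℂ) ≠ 0 := by
    have : (0 : ℝ) < Real.sqrt 2 := by positivity
    exact_mod_cast this.ne'
  have hm : ∀ m, ∫ y in Icc (-1) 0, ((Real.cos (freqY m * (y + 1)) : ℝ) : ℂ) * f y = 0 := by
    intro m
    have h1 := h m
    have e : ∀ y, cosY m y • f y = (Real.sqrt 2 : ℂ) *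
        (((Real.cos (freqY m * (y + 1)) : ℝ) : ℂ) * f y) := by
      intro y
      rw [cosY, Complex.real_smul]
      push_cast; ring
    simp only [e] at h1
    rw [integral_const_mul] at h1
    exact (mul_eq_zero.1 h1).resolve_left h2
  have hG := ae_eq_zero_of_cos_moments (l := -1) (r := 0) Real.pi_pos (by ring)
    (hbd (fun y => Real.cos (freqY 0 * (y + 1))) (by fun_prop)) (fun k => by
      rcases Nat.eq_zero_or_pos k with rfl | hk
      · simpa using hm 0
      · obtain ⟨j, rfl⟩ : ∃ j, k = j + 1 := ⟨k - 1, by omega⟩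
        have e : ∀ y : ℝ, ((Real.cos ((j + 1 : ℕ) * (Real.pi * (y - -1))) : ℝ) : ℂ) *
            (((Real.cos (freqY 0 * (y + 1)) : ℝ) : ℂ) * f y)
            = (1 / 2 : ℂ) * (((Real.cos (freqY (j + 1) * (y + 1)) : ℝ) : ℂ) * f y
              + ((Real.cos (freqY j * (y + 1)) : ℝ) : ℂ) * f y) := by
          intro y
          have : Real.cos ((j + 1 : ℕ) * (Real.pi * (y - -1))) * Real.cos (freqY 0 * (y + 1))
              = 1 / 2 * (Real.cos (freqY (j + 1) * (y + 1)) + Real.cos (freqY j * (y + 1))) := by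
            rw [show freqY (j + 1) * (y + 1) = (j + 1 : ℕ) * (Real.pi * (y - -1))
                + freqY 0 * (y + 1) by simp only [freqY]; push_cast; ring,
              show freqY j * (y + 1) = (j + 1 : ℕ) * (Real.pi * (y - -1))
                - freqY 0 * (y + 1) by simp only [freqY]; push_cast; ring,
              Real.cos_add, Real.cos_sub]
            ring
          rw [← mul_assoc, ← Complex.ofReal_mul, this]
          push_cast; ring
        simp only [e]
        rw [integral_const_mul, integral_add (hbd _ (by fun_prop)) (hbd _ (by fun_prop)), hm, hm]
        simp)
  have hae : ∀ᵐ y ∂(volume.restrict (Icc (-1 : ℝ) 0)), y ∈ Ico (-1 : ℝ) 0 := by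
    rw [Measure.restrict_congr_set Ico_ae_eq_Icc.symm]
    exact ae_restrict_mem measurableSet_Ico
  filter_upwards [hG, hae] with y h1 hy
  refine (mul_eq_zero.1 h1).resolve_left ?_
  have : 0 < Real.cos (freqY 0 * (y + 1)) := by
    refine Real.cos_pos_of_mem_Ioo ⟨?_, ?_⟩
    · simp only [freqY]
      push_cast
      nlinarith [Real.pi_pos, hy.1]
    · simp only [freqY]
      push_cast
      nlinarith [Real.pi_pos, hy.2]
  exact_mod_cast this.ne'

/-- By Fubini, for each m the y-moment against `cosY m` is a function of x with vanishing cosine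
moments. The countably many exceptional null sets are then united, and the one-dimensional result
applies on almost every slice. -/
lemma ae_eq_zero_of_cosX_cosY_moments {f : ℝ × ℝ → ℂ} (hfm : StronglyMeasurable f)
    (hf : IntegrableOn f Omega)
    (h : ∀ k m, ∫ p in Omega, (cosX k p.1 * cosY m p.2) • f p = 0) :
    f =ᵐ[volume.restrict Omega] 0 := by
  rw [IntegrableOn] at hf
  rw [restrict_Omega] at *
  set μ : Measure ℝ := volume.restrict (Icc 0 Real.pi) with hμ
  set ν : Measure ℝ := volume.restrict (Icc (-1) 0) with hν
  have hcX := fun k => (contDiff_cosX k).continuous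
  have hcY := fun k => (contDiff_cosY k).continuous
  have hbd : ∀ {C : ℝ} (θ : ℝ × ℝ → ℝ), Continuous θ → (∀ p, |θ p| ≤ C) →
      Integrable (fun p => θ p • f p) (μ.prod ν) := fun θ hθ hC =>
    hf.bdd_smul _ hθ.aestronglyMeasurable (Eventually.of_forall hC)
  have hYb : ∀ m y, |cosY m y| ≤ Real.sqrt 2 := by
    intro m y
    rw [cosY, abs_mul, abs_of_nonneg (Real.sqrt_nonneg 2)]
    exact mul_le_of_le_one_right (Real.sqrt_nonneg 2) (Real.abs_cos_le_one _)
  have hXb : ∀ k x, |cosX k x| ≤ Real.sqrt ((if k = 0 then 1 else 2) / Real.pi) := by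
    intro m y
    rw [cosX, abs_mul, abs_of_nonneg (Real.sqrt_nonneg _)]
    exact mul_le_of_le_one_right (Real.sqrt_nonneg _) (Real.abs_cos_le_one _)
  have hYi : ∀ m, Integrable (fun p : ℝ × ℝ => cosY m p.2 • f p) (μ.prod ν) := fun m =>
    hbd _ ((hcY m).comp continuous_snd) fun p => hYb m p.2
  have h1 : ∀ m, ∀ᵐ x ∂μ, ∫ y, cosY m y • f (x, y) ∂ν = 0 := by
    intro m
    refine ae_eq_zero_of_cosX_moments (hYi m).integral_prod_left fun k => ?_
    have h2 := h k m
    rw [integral_prod] at h2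
    · rw [← h2]
      congr 1
      ext x
      rw [← integral_smul]
      simp only [mul_smul]
    · refine hbd (C := Real.sqrt ((if k = 0 then 1 else 2) / Real.pi) * Real.sqrt 2) _ (((hcX k).comp continuous_fst).mul
        ((hcY m).comp continuous_snd)) fun p => ?_
      rw [abs_mul]
      exact mul_le_mul (hXb k p.1) (hYb m p.2) (abs_nonneg _) (Real.sqrt_nonneg _)
  have h3 : ∀ᵐ x ∂μ, ∀ᵐ y ∂ν, f (x, y) = 0 := by
    filter_upwards [ae_all_iff.2 h1, hf.prod_right_ae] with x hx hxi
    exact ae_eq_zero_of_cosY_moments hxi hx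
  exact (Measure.ae_prod_iff_ae_ae (hfm.measurable (measurableSet_singleton 0))).2 h3

lemma eq_zero_of_inner_cosX_cosY {f : L2Omega}
    (h : ∀ k m, ⟪prodFun (cosX k) (cosY m), f⟫_ℂ = 0) : f = 0 := by
  apply Lp.ext
  refine EventuallyEq.trans ?_ (Lp.coeFn_zero ℂ 2 (volume.restrict Omega)).symm
  refine ae_eq_zero_of_cosX_cosY_moments (Lp.stronglyMeasurable f)
    ((Lp.memLp f).integrable one_le_two) fun k m => ?_
  rw [← h k m, inner_prodFun (contDiff_cosX k).continuous (contDiff_cosY m).continuous]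

/-- The Hilbert basis of `L²(Ω)` of eigenfunctions of the mixed Laplacian. -/
def eigenBasis : HilbertBasis (ℕ × ℕ) ℂ L2Omega :=
  HilbertBasis.mkOfOrthogonalEqBot orthonormal_cosX_cosY (by
    rw [Submodule.eq_bot_iff]
    intro f hf
    refine eq_zero_of_inner_cosX_cosY fun k m => ?_
    exact (Submodule.mem_orthogonal _ _).1 hf _ (Submodule.subset_span ⟨(k, m), rfl⟩))

lemma eigenBasis_repr (f : L2Omega) (q : ℕ × ℕ) :
    eigenBasis.repr f q = ⟪prodFun (cosX q.1) (cosY q.2), f⟫_ℂ := by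
  rw [HilbertBasis.repr_apply_apply, eigenBasis, HilbertBasis.coe_mkOfOrthogonalEqBot]

/-- Poincaré's inequality for functions vanishing at the top. -/
lemma norm_val_le_norm_dy {F : H1Omega} (hF : IsTopTrace F 0) :
    ‖H1Omega.val F‖ ≤ ‖H1Omega.dy F‖ := by
  have key : ∀ q : ℕ × ℕ, ‖⟪prodFun (cosX q.1) (cosY q.2), H1Omega.val F⟫_ℂ‖
      ≤ ‖⟪prodFun (cosX q.1) (sinY q.2), H1Omega.dy F⟫_ℂ‖ := by
    rintro ⟨k, m⟩
    -- The sine vanishes at the bottom and F at the top, so a cosine coefficient of F times its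
    -- frequency is minus a sine coefficient of ∂F/∂y; the frequencies are at least 1.
    have h := green_y (contDiff_cosX k) (contDiff_sinY m) (sinY_neg_one m) hF
    rw [inner_zero_right, mul_zero, deriv_sinY, prodFun_mul_right _ (contDiff_cosX k).continuous
      (contDiff_cosY m).continuous, inner_smul_left, Complex.conj_ofReal] at h
    rw [← norm_neg ⟪prodFun (cosX k) (sinY m), H1Omega.dy F⟫_ℂ, ← eq_neg_of_add_eq_zero_left h,
      norm_mul, Complex.norm_real, Real.norm_of_nonneg (zero_le_one.trans (one_le_freqY m))]
    exact le_mul_of_one_le_left (norm_nonneg _) (one_le_freqY m)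
  have h1 : ‖H1Omega.val F‖ ^ 2 ≤ ‖H1Omega.dy F‖ ^ 2 := by
    rw [← eigenBasis.repr.norm_map, norm_sq_lp]
    -- For the sine system Bessel's inequality suffices; its completeness is not needed.
    refine le_trans ?_ (orthonormal_cosX_sinY.tsum_inner_products_le _)
    refine Summable.tsum_le_tsum (fun q => ?_) (summable_norm_sq_lp _)
      (orthonormal_cosX_sinY.inner_products_summable _)
    rw [eigenBasis_repr]
    exact pow_le_pow_left₀ (norm_nonneg _) (key q) 2
  exact le_of_sq_le_sq h1 (norm_nonneg _)

/-- A second derivative is moved onto the eigenfunction. The boundary terms vanish because `cosX`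
has zero slope at 0 and π, `cosY` has zero slope at -1, and F has zero trace on the top. -/
lemma gradPairing_eigen {F : H1Omega} (hF : IsTopTrace F 0) (k m : ℕ) :
    gradPairing F (prodH1 (contDiff_cosX k) (contDiff_cosY m))
      = (((k : ℝ) ^ 2 + freqY m ^ 2 : ℝ) : ℂ) * ⟪prodFun (cosX k) (cosY m), H1Omega.val F⟫_ℂ := by
  have hdX : ContDiff ℝ ∞ (deriv (cosX k)) := by rw [deriv_cosX]; fun_prop
  have hdY : ContDiff ℝ ∞ (deriv (cosY m)) := by
    rw [deriv_cosY]; exact contDiff_const.mul (contDiff_sinY m)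
  have hddY : deriv (deriv (cosY m)) = fun y => -freqY m ^ 2 * cosY m y := by
    rw [deriv_cosY]
    ext y
    rw [deriv_const_mul _ ((contDiff_sinY m).differentiable (by simp) y), deriv_sinY]
    ring
  have h1 := green_x hdX (contDiff_cosY m) (deriv_cosX_zero k) (deriv_cosX_pi k) F
  have h2 := green_y (contDiff_cosX k) hdY (by rw [deriv_cosY]; simp [sinY_neg_one]) hF
  rw [deriv_deriv_cosX, prodFun_mul_left _ (contDiff_cosX k).continuous
      (contDiff_cosY m).continuous, inner_smul_left, Complex.conj_ofReal] at h1
  rw [hddY, prodFun_mul_right _ (contDiff_cosX k).continuous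
      (contDiff_cosY m).continuous, inner_smul_left, Complex.conj_ofReal, inner_zero_right,
      mul_zero] at h2
  rw [gradPairing, dx_prodH1, dy_prodH1]
  push_cast at h1 h2 ⊢
  linear_combination h1 + h2

/-- The eigenvalues are nonzero, so all coefficients of F in the eigenbasis vanish. That countably
many test functions suffice matters later, when each one brings its own null set of times. -/
lemma eq_zero_of_gradPairing_eigen {F : H1Omega} (hF : IsTopTrace F 0)
    (h : ∀ k m, gradPairing F (prodH1 (contDiff_cosX k) (contDiff_cosY m)) = 0) : F = 0 := by
  refine H1Omega.eq_zero_of_val_eq_zero (eq_zero_of_inner_cosX_cosY fun k m => ?_)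
  have h1 := h k m
  rw [gradPairing_eigen hF] at h1
  refine (mul_eq_zero.1 h1).resolve_left ?_
  have := one_le_freqY m
  have h2 : (0 : ℝ) < (k : ℝ) ^ 2 + freqY m ^ 2 := by positivity
  exact_mod_cast h2.ne'

lemma isTopTrace_eigen (k m : ℕ) :
    IsTopTrace (prodH1 (contDiff_cosX k) (contDiff_cosY m)) 0 := by
  have := isTopTrace_prodH1 (contDiff_cosX k) (contDiff_cosY m)
  rwa [cosY_zero, Complex.ofReal_zero, zero_smul] at this

/-! ### The functional `Ψ ↦ ∫ h conj(Ψ(0,y)) dy` on `ℋ¹(Ω)` -/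

lemma memLp_mul_snd {a : ℝ → ℝ} (ha : Continuous a) (h : L2Side) :
    MemLp (fun p : ℝ × ℝ => (a p.1 : ℂ) * h p.2) 2 (volume.restrict Omega) := by
  obtain ⟨C, -, hC⟩ := exists_abs_le_of_continuous ha (Metric.isBounded_Icc 0 Real.pi)
  have h1 : MemLp (fun p : ℝ × ℝ => h p.2) 2 (volume.restrict Omega) := by
    rw [restrict_Omega]; exact MemLp.comp_snd (Lp.memLp h) _
  have hm : Continuous fun p : ℝ × ℝ => (a p.1 : ℂ) := by fun_prop
  refine h1.of_le_mul (c := C) (hm.aestronglyMeasurable.mul h1.aestronglyMeasurable) ?_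
  refine (ae_restrict_iff' measurableSet_Omega).2 (Eventually.of_forall fun p hp => ?_)
  rw [norm_mul, Complex.norm_real]
  exact mul_le_mul_of_nonneg_right (hC _ (Omega_subset_Icc hp).1) (norm_nonneg _)

lemma ae_snd_of_ae {P : ℝ → Prop} (h : ∀ᵐ y ∂(volume.restrict (Icc (-1 : ℝ) 0)), P y) :
    ∀ᵐ p ∂((volume : Measure (ℝ × ℝ)).restrict Omega), P p.2 := by
  rw [restrict_Omega]
  exact Measure.quasiMeasurePreserving_snd.ae h

/-- `h ↦ a(x) h(y)` as a bounded operator from `L²[-1,0]` to `L²(Ω)`. -/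
def sideProd (a : ℝ → ℝ) (ha : Continuous a) : L2Side →L[ℂ] L2Omega :=
  LinearMap.mkContinuous
    { toFun := fun h => (memLp_mul_snd ha h).toLp
      map_add' := by
        intro h k
        apply Lp.ext
        filter_upwards [(memLp_mul_snd ha (h + k)).coeFn_toLp, (memLp_mul_snd ha h).coeFn_toLp,
          (memLp_mul_snd ha k).coeFn_toLp, ae_snd_of_ae (Lp.coeFn_add h k),
          Lp.coeFn_add (memLp_mul_snd ha h).toLp (memLp_mul_snd ha k).toLp] with p h1 h2 h3 h4 h5
        rw [h1, h5, Pi.add_apply, h2, h3, h4, Pi.add_apply, mul_add]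
      map_smul' := by
        intro c h
        apply Lp.ext
        filter_upwards [(memLp_mul_snd ha (c • h)).coeFn_toLp, (memLp_mul_snd ha h).coeFn_toLp,
          ae_snd_of_ae (Lp.coeFn_smul c h),
          Lp.coeFn_smul c (memLp_mul_snd ha h).toLp] with p h1 h2 h3 h4
        rw [h1, RingHom.id_apply, h4, Pi.smul_apply, h2, h3, Pi.smul_apply, smul_eq_mul,
          smul_eq_mul, mul_left_comm] }
    (Real.sqrt (∫ x in Icc 0 Real.pi, a x ^ 2)) (by
      intro h
      have h0 : 0 ≤ ∫ x in Icc 0 Real.pi, a x ^ 2 := integral_nonneg fun x => sq_nonneg _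
      have key : ‖(memLp_mul_snd ha h).toLp‖ ^ 2 = (∫ x in Icc 0 Real.pi, a x ^ 2) * ‖h‖ ^ 2 := by
        have e1 : ∀ {α : Type} [MeasurableSpace α] {μ : Measure α} (f : Lp ℂ 2 μ),
            ‖f‖ ^ 2 = ∫ x, ‖f x‖ ^ 2 ∂μ := by
          intro α _ μ f
          have h1 : ((‖f‖ ^ 2 : ℝ) : ℂ) = ((∫ x, ‖f x‖ ^ 2 ∂μ : ℝ) : ℂ) := by
            rw [Complex.ofReal_pow]
            refine (inner_self_eq_norm_sq_to_K (𝕜 := ℂ) f).symm.trans ?_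
            rw [L2.inner_def, ← integral_complex_ofReal]
            congr 1
            ext x
            rw [inner_self_eq_norm_sq_to_K]
            simp
          exact_mod_cast h1
        rw [e1, e1, ← integral_prod_mul (fun x => a x ^ 2) (fun y => ‖h y‖ ^ 2), ← restrict_Omega]
        refine integral_congr_ae ?_
        filter_upwards [(memLp_mul_snd ha h).coeFn_toLp] with p hp
        rw [hp, norm_mul, mul_pow, Complex.norm_real, Real.norm_eq_abs, sq_abs]
      refine le_of_sq_le_sq ?_ (by positivity)
      rw [mul_pow, Real.sq_sqrt h0]
      exact key.le)

lemma sideProd_sideFun {a c : ℝ → ℝ} (ha : Continuous a) (hc : Continuous c) :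
    sideProd a ha (sideFun c) = prodFun a c := by
  apply Lp.ext
  filter_upwards [(memLp_mul_snd ha (sideFun c)).coeFn_toLp, ae_snd_of_ae (coeFn_sideFun hc),
    coeFn_prodFun ha hc] with p h1 h2 h3
  rw [h3]
  refine h1.trans ?_
  rw [h2, Complex.ofReal_mul]

/-- The weight `1 - x/π`. -/
def sideWeight (x : ℝ) : ℝ := 1 - x / Real.pi

lemma contDiff_sideWeight : ContDiff ℝ ∞ sideWeight := by unfold sideWeight; fun_prop

lemma continuous_deriv_sideWeight : Continuous (deriv sideWeight) :=
  contDiff_sideWeight.continuous_deriv (by simp)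

/-- The Riesz representative in `ℋ¹(Ω)` of the functional `Ψ ↦ ∫ conj(h) Ψ(0,y) dy`. -/
def sideRiesz (h : L2Side) : H1Omega :=
  -(ContinuousLinearMap.adjoint H1Omega.valL (sideProd _ continuous_deriv_sideWeight h)
    + ContinuousLinearMap.adjoint H1Omega.dxL (sideProd _ contDiff_sideWeight.continuous h))

lemma inner_sideRiesz (h : L2Side) (Ψ : H1Omega) : ⟪sideRiesz h, Ψ⟫_ℂ
    = -(⟪sideProd _ continuous_deriv_sideWeight h, H1Omega.val Ψ⟫_ℂ
      + ⟪sideProd _ contDiff_sideWeight.continuous h, H1Omega.dx Ψ⟫_ℂ) := by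
  rw [sideRiesz, inner_neg_left, inner_add_left, ContinuousLinearMap.adjoint_inner_left,
    ContinuousLinearMap.adjoint_inner_left]
  rfl

/-- Green's formula with a(x) = 1 - x/π, which is 1 on the left side and 0 on the right, expresses
the boundary integral by integrals over Ω. It holds for smooth profiles, and both sides are
continuous in the profile for the L² norm, so it extends to h. -/
lemma inner_sideRiesz_eq {Ψ : H1Omega} {g : L2Side} (hΨ : IsLeftTrace Ψ g) (h : L2Side) :
    ⟪Ψ, sideRiesz h⟫_ℂ = ⟪g, h⟫_ℂ := by
  set K₁ := sideProd _ continuous_deriv_sideWeight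
  set K₂ := sideProd _ contDiff_sideWeight.continuous
  -- The vanishing of this vector encodes Green's formula for all profiles at once.
  set w : L2Side := ContinuousLinearMap.adjoint K₁ (H1Omega.val Ψ)
    + ContinuousLinearMap.adjoint K₂ (H1Omega.dx Ψ) + g with hw
  have hw0 : w = 0 := by
    refine L2Side_eq_zero fun c hc => ?_
    have h1 := green_left contDiff_sideWeight hc (by simp [sideWeight, Real.pi_ne_zero]) hΨ
    rw [hw, inner_add_right, inner_add_right, ContinuousLinearMap.adjoint_inner_right,
      ContinuousLinearMap.adjoint_inner_right, sideProd_sideFun _ hc.continuous,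
      sideProd_sideFun _ hc.continuous, h1]
    simp [sideWeight]
  have h2 : ⟪h, w⟫_ℂ = 0 := by rw [hw0, inner_zero_right]
  rw [hw, inner_add_right, inner_add_right, ContinuousLinearMap.adjoint_inner_right,
      ContinuousLinearMap.adjoint_inner_right] at h2
  have h3 : ⟪sideRiesz h, Ψ⟫_ℂ = ⟪h, g⟫_ℂ := by
    rw [inner_sideRiesz]
    linear_combination -h2
  rw [← inner_conj_symm Ψ (sideRiesz h), h3, inner_conj_symm]

/-! ### The Neumann potential of the wave maker -/

/-- The functions in `ℋ¹(Ω)` vanishing on the top. -/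
def zeroTop : Submodule ℂ H1Omega := topTraceGraph.comap (LinearMap.inl ℂ H1Omega L2Top)

lemma mem_zeroTop {F : H1Omega} : F ∈ zeroTop ↔ IsTopTrace F 0 := Iff.rfl

lemma isClosed_zeroTop : IsClosed (zeroTop : Set H1Omega) :=
  isClosed_topTraceGraph.preimage (f := fun F : H1Omega => (F, (0 : L2Top))) (by fun_prop)

/-- Lax-Milgram: S*S + T*T is coercive, hence invertible, and the solution is its inverse applied to
J*r. -/
lemma exists_inner_eq_of_coercive {V W G : Type*} [NormedAddCommGroup V] [InnerProductSpace ℂ V]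
    [CompleteSpace V] [NormedAddCommGroup W] [InnerProductSpace ℂ W] [CompleteSpace W]
    [NormedAddCommGroup G] [InnerProductSpace ℂ G] [CompleteSpace G]
    (S T : V →L[ℂ] W) (J : V →L[ℂ] G) {c : ℝ≥0} (hc : 0 < c)
    (h : ∀ v, ‖v‖ ^ 2 * c ≤ ‖S v‖ ^ 2 + ‖T v‖ ^ 2) (r : G) :
    ∃ n : V, ∀ v, ⟪S v, S n⟫_ℂ + ⟪T v, T n⟫_ℂ = ⟪J v, r⟫_ℂ := by
  set D : V →L[ℂ] V := (ContinuousLinearMap.adjoint S).comp S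
    + (ContinuousLinearMap.adjoint T).comp T with hD
  have hin : ∀ v n, ⟪v, D n⟫_ℂ = ⟪S v, S n⟫_ℂ + ⟪T v, T n⟫_ℂ := fun v n => by
    rw [hD, add_apply, inner_add_right, ContinuousLinearMap.comp_apply,
      ContinuousLinearMap.comp_apply, ContinuousLinearMap.adjoint_inner_right,
      ContinuousLinearMap.adjoint_inner_right]
  have hu : IsUnit D := by
    refine ContinuousLinearMap.isUnit_of_forall_le_norm_inner_map D hc fun v => ?_
    have h1 : ⟪v, D v⟫_ℂ = ((‖S v‖ ^ 2 + ‖T v‖ ^ 2 : ℝ) : ℂ) := by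
      rw [hin, inner_self_eq_norm_sq_to_K, inner_self_eq_norm_sq_to_K]
      push_cast; rfl
    rw [← inner_conj_symm, RCLike.norm_conj, h1, Complex.norm_real,
      Real.norm_of_nonneg (by positivity)]
    exact h v
  obtain ⟨e, he⟩ := hu
  refine ⟨(↑e⁻¹ : V →L[ℂ] V) (ContinuousLinearMap.adjoint J r), fun v => ?_⟩
  rw [← hin, ← he]
  have h2 : (e : V →L[ℂ] V) ((↑e⁻¹ : V →L[ℂ] V) (ContinuousLinearMap.adjoint J r))
      = ContinuousLinearMap.adjoint J r := by
    change ((e * e⁻¹ : (V →L[ℂ] V)ˣ) : V →L[ℂ] V) _ = _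
    simp
  rw [h2, ContinuousLinearMap.adjoint_inner_right]

lemma Submodule.exists_inner_eq_of_coercive {W G : Type*}
    [NormedAddCommGroup W] [InnerProductSpace ℂ W] [CompleteSpace W]
    [NormedAddCommGroup G] [InnerProductSpace ℂ G] [CompleteSpace G]
    (V : Submodule ℂ G) (hV : IsClosed (V : Set G))
    (S T : G →L[ℂ] W) {c : ℝ≥0} (hc : 0 < c)
    (h : ∀ v ∈ V, ‖v‖ ^ 2 * c ≤ ‖S v‖ ^ 2 + ‖T v‖ ^ 2) (r : G) :
    ∃ n ∈ V, ∀ v ∈ V, ⟪S v, S n⟫_ℂ + ⟪T v, T n⟫_ℂ = ⟪v, r⟫_ℂ := by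
  have : CompleteSpace V := hV.completeSpace_coe
  obtain ⟨n, hn⟩ := WaterWave.exists_inner_eq_of_coercive (S.comp V.subtypeL) (T.comp V.subtypeL)
    V.subtypeL hc (fun v => h v v.2) r
  exact ⟨n, n.2, fun v hv => hn ⟨v, hv⟩⟩

/-- The weak form of ΔN = 0 with N = 0 on the top, ∂N/∂x = -h on the left and zero normal derivative
elsewhere. By Poincaré, ‖F‖² ≤ ‖∂F/∂x‖² + 2‖∂F/∂y‖² on functions vanishing on the top, which gives
coercivity with constant 1/2. -/
lemma exists_neumann_potential (h : L2Side) : ∃ N : H1Omega, IsTopTrace N 0 ∧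
    ∀ Ψ : H1Omega, IsTopTrace Ψ 0 → gradPairing N Ψ = ⟪Ψ, sideRiesz h⟫_ℂ := by
  refine Submodule.exists_inner_eq_of_coercive (G := H1Omega) zeroTop isClosed_zeroTop
    H1Omega.dxL H1Omega.dyL (c := 1 / 2) (by norm_num) (fun F hF => ?_) (sideRiesz h)
  have h2 := norm_val_le_norm_dy (mem_zeroTop.1 hF)
  have h3 := H1Omega.norm_sq_eq F
  have h4 := pow_le_pow_left₀ (norm_nonneg _) h2 2
  change _ ≤ ‖H1Omega.dx F‖ ^ 2 + ‖H1Omega.dy F‖ ^ 2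
  rw [h3]
  push_cast
  nlinarith [sq_nonneg ‖H1Omega.dx F‖]

/-! ### The harmonic functions `φ_k(x) cosh(k(y+1)) / cosh k` -/

/-- The eigenvalue `k tanh k` of the Dirichlet-to-Neumann operator. -/
def dtn (k : ℕ+) : ℝ := ((k : ℕ) : ℝ) * Real.tanh ((k : ℕ) : ℝ)

/-- `cosh(k(y+1)) / cosh k`. -/
def coshY (k : ℕ+) (y : ℝ) : ℝ := (Real.cosh ((k : ℕ) : ℝ))⁻¹ * Real.cosh ((k : ℕ) * (y + 1))

lemma contDiff_coshY (k : ℕ+) : ContDiff ℝ ∞ (coshY k) := by unfold coshY; fun_prop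

lemma one_le_cast (k : ℕ+) : (1 : ℝ) ≤ ((k : ℕ) : ℝ) := by exact_mod_cast k.pos

lemma tanh_pos {x : ℝ} (hx : 0 < x) : 0 < Real.tanh x := by
  rw [Real.tanh_eq_sinh_div_cosh]
  exact div_pos (Real.sinh_pos_iff.2 hx) (Real.cosh_pos x)

lemma tanh_one_le (k : ℕ+) : Real.tanh 1 ≤ Real.tanh ((k : ℕ) : ℝ) := by
  have h : 0 ≤ Real.sinh (((k : ℕ) : ℝ) - 1) := Real.sinh_nonneg_iff.2 (by linarith [one_le_cast k])
  rw [Real.sinh_sub] at h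
  rw [Real.tanh_eq_sinh_div_cosh, Real.tanh_eq_sinh_div_cosh,
    div_le_div_iff₀ (Real.cosh_pos _) (Real.cosh_pos _)]
  linarith

lemma dtn_pos (k : ℕ+) : 0 < dtn k :=
  mul_pos (by linarith [one_le_cast k]) (tanh_pos (by linarith [one_le_cast k]))

lemma dtn_le (k : ℕ+) : dtn k ≤ ((k : ℕ) : ℝ) :=
  mul_le_of_le_one_right (Nat.cast_nonneg _) (Real.tanh_lt_one _).le

/-- With the upper bound above, k tanh k is comparable to k, so the Dirichlet-to-Neumann weights
define the same spaces as powers of k. -/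
lemma le_dtn (k : ℕ+) : Real.tanh 1 * ((k : ℕ) : ℝ) ≤ dtn k := by
  rw [mul_comm]
  exact mul_le_mul_of_nonneg_left (tanh_one_le k) (Nat.cast_nonneg _)

lemma coshY_zero (k : ℕ+) : coshY k 0 = 1 := by
  rw [coshY, zero_add, mul_one, inv_mul_cancel₀ (Real.cosh_pos _).ne']

lemma deriv_coshY (k : ℕ+) : deriv (coshY k) = fun y =>
    (Real.cosh ((k : ℕ) : ℝ))⁻¹ * ((k : ℕ) * Real.sinh ((k : ℕ) * (y + 1))) := by
  ext y
  refine (((hasDerivAt_affine ((k : ℕ) : ℝ) 1 y).cosh.const_mul _).deriv).trans ?_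
  ring

lemma deriv_deriv_coshY (k : ℕ+) :
    deriv (deriv (coshY k)) = fun y => ((k : ℕ) : ℝ) ^ 2 * coshY k y := by
  rw [deriv_coshY]
  ext y
  refine ((((hasDerivAt_affine ((k : ℕ) : ℝ) 1 y).sinh.const_mul _).const_mul _).deriv).trans ?_
  rw [coshY]; ring

lemma deriv_coshY_neg_one (k : ℕ+) : deriv (coshY k) (-1) = 0 := by simp [deriv_coshY]

lemma deriv_coshY_zero (k : ℕ+) : deriv (coshY k) 0 = dtn k := by
  simp only [deriv_coshY, dtn, Real.tanh_eq_sinh_div_cosh]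
  rw [zero_add, mul_one]
  field_simp

lemma coshY_nonneg (k : ℕ+) (y : ℝ) : 0 ≤ coshY k y :=
  mul_nonneg (inv_nonneg.2 (Real.cosh_pos _).le) (Real.cosh_pos _).le

lemma coshY_le_one (k : ℕ+) {y : ℝ} (hy : y ∈ Icc (-1 : ℝ) 0) : coshY k y ≤ 1 := by
  rw [coshY, inv_mul_le_iff₀ (Real.cosh_pos _), mul_one, Real.cosh_le_cosh]
  have := one_le_cast k
  rw [abs_of_nonneg (mul_nonneg (by linarith) (by linarith [hy.1])), abs_of_nonneg (by linarith)]
  nlinarith [hy.2]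

/-- The numerator is at most exp(k(y+1)) and cosh k ≥ exp(k)/2. This dominates the input
coefficients by samples of the Laplace transform of |h|. -/
lemma coshY_le_exp (k : ℕ+) {y : ℝ} (hy : y ∈ Icc (-1 : ℝ) 0) :
    coshY k y ≤ 2 * Real.exp ((k : ℕ) * y) := by
  have hk := one_le_cast k
  rw [coshY, inv_mul_le_iff₀ (Real.cosh_pos _)]
  have h1 : Real.cosh ((k : ℕ) * (y + 1)) ≤ Real.exp ((k : ℕ) * (y + 1)) := by
    rw [← Real.cosh_add_sinh]
    exact le_add_of_nonneg_right (Real.sinh_nonneg_iff.2 (mul_nonneg (by linarith) (by linarith [hy.1])))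
  have h2 : Real.exp ((k : ℕ) : ℝ) ≤ 2 * Real.cosh ((k : ℕ) : ℝ) := by
    rw [Real.cosh_eq]; linarith [Real.exp_pos (-((k : ℕ) : ℝ))]
  have h3 : Real.exp ((k : ℕ) * (y + 1)) = Real.exp ((k : ℕ) * y) * Real.exp ((k : ℕ) : ℝ) := by
    rw [← Real.exp_add]; congr 1; ring
  rw [h3] at h1
  nlinarith [Real.exp_pos ((k : ℕ) * y)]

/-- The harmonic extension `φ_k(x) cosh(k(y+1)) / cosh k` of `φ_k`. -/
def harm (k : ℕ+) : H1Omega := prodH1 (contDiff_cosX k) (contDiff_coshY k)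

lemma topFun_cosX (k : ℕ+) : topFun (cosX k) = (cosH k : L2Top) := by
  apply Lp.ext
  filter_upwards [coeFn_topFun (contDiff_cosX k).continuous,
    MemLp.coeFn_toLp (memLp_of_continuous (continuous_cosFun k))] with x h1 h2
  rw [h1]
  refine Eq.trans ?_ h2.symm
  rw [cosX, cosFun, if_neg k.ne_zero]

lemma isTopTrace_harm (k : ℕ+) : IsTopTrace (harm k) (cosH k : L2Top) := by
  have := isTopTrace_prodH1 (contDiff_cosX k) (contDiff_coshY k)
  rwa [coshY_zero, Complex.ofReal_one, one_smul, topFun_cosX] at this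

lemma isLeftTrace_harm (k : ℕ+) : IsLeftTrace (harm k) (((cosX k 0 : ℝ) : ℂ) • sideFun (coshY k)) :=
  isLeftTrace_prodH1 (contDiff_cosX k) (contDiff_coshY k)

lemma contDiff_top_deriv {f : ℝ → ℝ} (hf : ContDiff ℝ ∞ f) : ContDiff ℝ ∞ (deriv f) := by
  exact (contDiff_infty_iff_deriv.1 hf).2

/-- Green's formula. -/
lemma gradPairing_harm (k : ℕ+) {Ψ : H1Omega} {g : L2Top} (hΨ : IsTopTrace Ψ g) :
    gradPairing Ψ (harm k) = dtn k * ⟪(cosH k : L2Top), g⟫_ℂ := by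
  -- Green's formula in both variables, applied to the two partial derivatives of `harm k`. The
  -- interior terms ∓k² cancel by harmonicity, and only the top survives, where the slope of `coshY`
  -- is k tanh k.
  have h1 := green_x (contDiff_top_deriv (contDiff_cosX k)) (contDiff_coshY k)
    (deriv_cosX_zero _) (deriv_cosX_pi _) Ψ
  have h2 := green_y (contDiff_cosX k) (contDiff_top_deriv (contDiff_coshY k))
    (deriv_coshY_neg_one _) hΨ
  rw [deriv_deriv_cosX, prodFun_mul_left _ (contDiff_cosX k).continuous
    (contDiff_coshY k).continuous, inner_smul_left, Complex.conj_ofReal] at h1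
  rw [deriv_deriv_coshY, prodFun_mul_right _ (contDiff_cosX k).continuous
    (contDiff_coshY k).continuous, inner_smul_left, Complex.conj_ofReal, deriv_coshY_zero,
    topFun_cosX] at h2
  rw [gradPairing, harm, dx_prodH1, dy_prodH1]
  push_cast at h1 h2
  linear_combination h1 + h2

lemma inner_cosH (j k : ℕ+) : ⟪(cosH j : L2Top), (cosH k : L2Top)⟫_ℂ = if j = k then 1 else 0 :=
  orthonormal_iff_ite.1 cosH_orthonormal j k

lemma gradPairing_harm_harm (j k : ℕ+) :
    gradPairing (harm j) (harm k) = if k = j then (dtn k : ℂ) else 0 := by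
  rw [gradPairing_harm k (isTopTrace_harm j), inner_cosH]
  split_ifs <;> simp

/-- The functions are orthogonal both in the Dirichlet form and in L²(Ω), hence in the full inner
product, as the orthogonal expansion of the extension operator requires. -/
lemma inner_harm_of_ne {j k : ℕ+} (h : j ≠ k) : ⟪harm j, harm k⟫_ℂ = 0 := by
  have h1 := gradPairing_harm_harm k j
  rw [if_neg h, gradPairing] at h1
  rw [H1Omega.inner_eq, add_assoc, h1, harm, harm, val_prodH1, val_prodH1,
    inner_prodFun_prodFun (contDiff_cosX _).continuous (contDiff_coshY _).continuous
      (contDiff_cosX _).continuous (contDiff_coshY _).continuous, integral_cosX_mul,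
    if_neg (by exact_mod_cast h)]
  simp

lemma integral_coshY_sq_le (k : ℕ+) : ∫ y in Icc (-1 : ℝ) 0, coshY k y * coshY k y ≤ 1 := by
  have hc := (contDiff_coshY k).continuous
  have : ∫ y in Icc (-1 : ℝ) 0, coshY k y * coshY k y ≤ ∫ y in Icc (-1 : ℝ) 0, (1 : ℝ) := by
    refine setIntegral_mono_on ((hc.mul hc).continuousOn.integrableOn_compact isCompact_Icc)
      (continuousOn_const.integrableOn_compact isCompact_Icc) measurableSet_Icc fun y hy => ?_
    exact mul_le_one₀ (coshY_le_one k hy) (coshY_nonneg k y) (coshY_le_one k hy)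
  simpa using this

/-- The energy part is k tanh k ≤ k and the L² part is at most 1 ≤ k. The linear growth matches the
weight of H_{1/2}. -/
lemma norm_harm_sq_le (k : ℕ+) : ‖harm k‖ ^ 2 ≤ 2 * ((k : ℕ) : ℝ) := by
  have h1 := gradPairing_harm_harm k k
  rw [if_pos rfl, gradPairing] at h1
  have h2 : ((‖harm k‖ ^ 2 : ℝ) : ℂ)
      = (((∫ y in Icc (-1 : ℝ) 0, coshY k y * coshY k y) + dtn k : ℝ) : ℂ) := by
    rw [Complex.ofReal_pow]
    refine (inner_self_eq_norm_sq_to_K (𝕜 := ℂ) (harm k)).symm.trans ?_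
    rw [H1Omega.inner_eq, add_assoc, h1, harm, val_prodH1,
      inner_prodFun_prodFun (contDiff_cosX _).continuous (contDiff_coshY _).continuous
      (contDiff_cosX _).continuous (contDiff_coshY _).continuous, integral_cosX_mul, if_pos rfl]
    push_cast
    ring
  rw [Complex.ofReal_inj.1 h2]
  linarith [integral_coshY_sq_le k, dtn_le k, one_le_cast k]

/-! ### Orthogonal expansions -/

section OrthogonalExpansion

variable {ι : Type*}

lemma memℓp_mul_of_bdd {m x : ι → ℂ} {M : ℝ} (hm : ∀ j, ‖m j‖ ≤ M) (h : Memℓp x 2) :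
    Memℓp (fun j => m j * x j) 2 := by
  rw [memℓp_gen_iff (by norm_num)] at h ⊢
  simp only [ENNReal.toReal_ofNat, Real.rpow_ofNat] at h ⊢
  refine Summable.of_nonneg_of_le (fun j => by positivity) (fun j => ?_) (h.mul_left (M ^ 2))
  rw [norm_mul, mul_pow]
  exact mul_le_mul_of_nonneg_right (pow_le_pow_left₀ (norm_nonneg _) (hm j) 2) (by positivity)

/-- Multiplication by a bounded sequence on `ℓ²(ι)`. -/
def bddMul (m : ι → ℂ) (M : ℝ) (hM : 0 ≤ M) (hm : ∀ j, ‖m j‖ ≤ M) :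
    lp (fun _ : ι => ℂ) 2 →L[ℂ] lp (fun _ : ι => ℂ) 2 :=
  LinearMap.mkContinuous
    { toFun := fun x => ⟨fun j => m j * x j, memℓp_mul_of_bdd hm (lp.memℓp x)⟩
      map_add' := fun x y => by
        ext j
        exact mul_add _ _ _
      map_smul' := fun c x => by
        ext j
        simp [mul_left_comm] }
    M fun x => by
      refine le_of_sq_le_sq ?_ (by positivity)
      rw [mul_pow, norm_sq_lp, norm_sq_lp, ← tsum_mul_left]
      refine Summable.tsum_le_tsum (fun j => ?_) (summable_norm_sq_lp _)
        ((summable_norm_sq_lp x).mul_left _)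
      change ‖m j * x j‖ ^ 2 ≤ _
      rw [norm_mul, mul_pow]
      exact mul_le_mul_of_nonneg_right (pow_le_pow_left₀ (norm_nonneg _) (hm j) 2) (by positivity)

/-- Normalizing the d_k gives an isometry from ℓ² into G, which is composed with multiplication by
the bounded sequence m_k ‖d_k‖. -/
lemma exists_clm_hasSum_of_orthogonal {G : Type*} [NormedAddCommGroup G] [InnerProductSpace ℂ G]
    [CompleteSpace G] {d : ι → G} (h0 : ∀ k, d k ≠ 0) (ho : Pairwise fun j k => ⟪d j, d k⟫_ℂ = 0)
    {m : ι → ℂ} {M : ℝ} (hM : 0 ≤ M) (hm : ∀ k, ‖m k‖ * ‖d k‖ ≤ M) :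
    ∃ D : lp (fun _ : ι => ℂ) 2 →L[ℂ] G, ∀ s, HasSum (fun k => (m k * s k) • d k) (D s) := by
  have hon : Orthonormal ℂ fun k => ((‖d k‖⁻¹ : ℝ) : ℂ) • d k := by
    refine ⟨fun k => ?_, fun j k hjk => ?_⟩
    · rw [norm_smul, Complex.norm_real, norm_inv, norm_norm,
        inv_mul_cancel₀ (norm_ne_zero_iff.2 (h0 k))]
    · change ⟪((‖d j‖⁻¹ : ℝ) : ℂ) • d j, ((‖d k‖⁻¹ : ℝ) : ℂ) • d k⟫_ℂ = 0
      rw [inner_smul_left, inner_smul_right, show ⟪d j, d k⟫_ℂ = 0 from ho hjk, mul_zero, mul_zero]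
  refine ⟨hon.orthogonalFamily.linearIsometry.toContinuousLinearMap.comp
    (bddMul (fun k => m k * ‖d k‖) M hM fun k => ?_), fun s => ?_⟩
  · rw [norm_mul, Complex.norm_real, norm_norm]
    exact hm k
  · refine (hon.orthogonalFamily.hasSum_linearIsometry _).congr_fun fun k => ?_
    change (m k * s k) • d k = (m k * ‖d k‖ * s k) • ((‖d k‖⁻¹ : ℝ) : ℂ) • d k
    have : (‖d k‖ : ℂ) ≠ 0 := by exact_mod_cast norm_ne_zero_iff.2 (h0 k)
    rw [smul_smul, mul_right_comm, mul_assoc (m k), Complex.ofReal_inv, mul_inv_cancel₀ this,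
      mul_one]

end OrthogonalExpansion

/-! ### The harmonic extension operator -/

/-- `HAlpha.toSeq` as a bounded operator. -/
def HAlpha.toSeqL (α : ℝ≥0) : HAlpha α →L[ℂ] lp (fun _ : ℕ+ => ℂ) 2 :=
  LinearMap.mkContinuous (HAlpha.toSeq α) 1 fun η => by rw [one_mul, HAlpha.norm_eq]

lemma HAlpha.toSeqL_apply (α : ℝ≥0) (η : HAlpha α) (k : ℕ+) :
    HAlpha.toSeqL α η k = ((((k : ℕ) : ℝ) ^ (α : ℝ) : ℝ) : ℂ) * coeff η.toH k := rfl

lemma rpow_half_sq (k : ℕ+) : (((k : ℕ) : ℝ) ^ ((1 / 2 : ℝ≥0) : ℝ)) ^ 2 = ((k : ℕ) : ℝ) := by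
  rw [← rpow_two_mul]
  norm_num

lemma harm_ne_zero (k : ℕ+) : harm k ≠ 0 := by
  intro h
  have h1 := gradPairing_harm_harm k k
  rw [if_pos rfl, h, gradPairing_eq, map_zero, map_zero, inner_zero_left, add_zero] at h1
  exact (dtn_pos k).ne (by exact_mod_cast h1)

/-- The multiplier k^{-1/2} undoes the weight of H_{1/2}, and √2 is the constant in the bound for
‖harm k‖. -/
lemma exists_dirExt : ∃ D : HAlpha (1 / 2) →L[ℂ] H1Omega, ∀ η : HAlpha (1 / 2),
    HasSum (fun k => coeff η.toH k • harm k) (D η) := by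
  obtain ⟨D, hD⟩ := exists_clm_hasSum_of_orthogonal harm_ne_zero
    (fun j k hjk => inner_harm_of_ne hjk)
    (m := fun k => (((((k : ℕ) : ℝ) ^ ((1 / 2 : ℝ≥0) : ℝ))⁻¹ : ℝ) : ℂ)) (M := Real.sqrt 2)
    (Real.sqrt_nonneg _) (fun k => by
      have hp := rpow_pos_cast k ((1 / 2 : ℝ≥0) : ℝ)
      rw [Complex.norm_real, norm_inv, Real.norm_of_nonneg hp.le, inv_mul_le_iff₀ hp]
      refine le_of_sq_le_sq ?_ (by positivity)
      rw [mul_pow, rpow_half_sq, Real.sq_sqrt zero_le_two, mul_comm]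
      exact norm_harm_sq_le k)
  refine ⟨D.comp (HAlpha.toSeqL _), fun η => ?_⟩
  refine (hD (HAlpha.toSeqL _ η)).congr_fun fun k => ?_
  rw [HAlpha.toSeqL_apply, ← mul_assoc, ← Complex.ofReal_mul,
    inv_mul_cancel₀ (rpow_pos_cast k _).ne', Complex.ofReal_one, one_mul]

/-- The harmonic extension with vanishing normal derivatives on the other three sides. -/
def dirExt : HAlpha (1 / 2) →L[ℂ] H1Omega := exists_dirExt.choose

lemma hasSum_dirExt (η : HAlpha (1 / 2)) : HasSum (fun k => coeff η.toH k • harm k) (dirExt η) :=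
  exists_dirExt.choose_spec η

lemma hasSum_coeff_smul (x : H) : HasSum (fun k => coeff x k • (cosH k : L2Top)) (x : L2Top) := by
  have h1 := (cosBasis.hasSum_repr x).mapL H.subtypeL
  refine h1.congr_fun fun k => ?_
  rw [cosBasis_repr, map_smul]
  congr 1
  rw [cosBasis, HilbertBasis.coe_mkOfOrthogonalEqBot]
  rfl

/-- Parseval's identity. -/
lemma hasSum_inner_coeff (g : L2Top) (x : H) :
    HasSum (fun k => coeff x k * ⟪g, (cosH k : L2Top)⟫_ℂ) ⟪g, (x : L2Top)⟫_ℂ := by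
  have h1 := (hasSum_coeff_smul x).mapL (innerSL ℂ g)
  refine h1.congr_fun fun k => ?_
  rw [innerSL_apply_apply, inner_smul_right]

/-- The partial sums converge in ℋ¹(Ω) and their traces in L²[0,π], and the graph of the trace is
closed. -/
lemma isTopTrace_dirExt (η : HAlpha (1 / 2)) : IsTopTrace (dirExt η) (η.toH : L2Top) := by
  have h1 := (hasSum_dirExt η).prodMk (hasSum_coeff_smul η.toH)
  refine isClosed_topTraceGraph.mem_of_tendsto h1 (Eventually.of_forall fun s => ?_)
  exact topTraceGraph.sum_mem fun k _ => (isTopTrace_harm k).smul _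

/-- `F ↦ ∫ ∇F · conj(∇Ψ)` as a bounded functional. -/
def gradFunctional (Ψ : H1Omega) : H1Omega →L[ℂ] ℂ :=
  (innerSL ℂ (H1Omega.dx Ψ)).comp H1Omega.dxL + (innerSL ℂ (H1Omega.dy Ψ)).comp H1Omega.dyL

lemma gradFunctional_apply (F Ψ : H1Omega) : gradFunctional Ψ F = gradPairing F Ψ := rfl

lemma gradPairing_harm_left (k : ℕ+) {Ψ : H1Omega} {g : L2Top} (hΨ : IsTopTrace Ψ g) :
    gradPairing (harm k) Ψ = dtn k * ⟪g, (cosH k : L2Top)⟫_ℂ := by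
  rw [← gradPairing_conj, gradPairing_harm k hΨ, map_mul, Complex.conj_ofReal, inner_conj_symm]

lemma hasSum_gradPairing_dirExt (η : HAlpha (1 / 2)) {Ψ : H1Omega} {g : L2Top}
    (hΨ : IsTopTrace Ψ g) :
    HasSum (fun k => coeff η.toH k * (dtn k * ⟪g, (cosH k : L2Top)⟫_ℂ))
      (gradPairing (dirExt η) Ψ) := by
  have h1 := (hasSum_dirExt η).mapL (gradFunctional Ψ)
  refine h1.congr_fun fun k => ?_
  rw [map_smul, gradFunctional_apply, gradPairing_harm_left k hΨ, smul_eq_mul]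

/-! ### Traces belong to `H_{1/2}` up to constants -/

/-- The constant function `1` in `ℋ¹(Ω)`. -/
def oneH1 : H1Omega :=
  prodH1 (a := fun _ => (1 : ℝ)) (c := fun _ => (1 : ℝ)) contDiff_const contDiff_const

lemma isTopTrace_oneH1 : IsTopTrace oneH1 (topFun fun _ => 1) := by
  have := isTopTrace_prodH1 (a := fun _ => (1 : ℝ)) (c := fun _ => (1 : ℝ))
    contDiff_const contDiff_const
  rwa [Complex.ofReal_one, one_smul] at this

lemma isLeftTrace_oneH1 : IsLeftTrace oneH1 (sideFun fun _ => 1) := by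
  have := isLeftTrace_prodH1 (a := fun _ => (1 : ℝ)) (c := fun _ => (1 : ℝ))
    contDiff_const contDiff_const
  rwa [Complex.ofReal_one, one_smul] at this

lemma dx_oneH1 : H1Omega.dx oneH1 = 0 := by
  rw [oneH1, dx_prodH1, deriv_const', prodFun]
  simpa using omegaFun_const_mul 0 (θ := fun _ => 0) continuous_const

lemma dy_oneH1 : H1Omega.dy oneH1 = 0 := by
  rw [oneH1, dy_prodH1, deriv_const', prodFun]
  simpa using omegaFun_const_mul 0 (θ := fun _ => 0) continuous_const

lemma gradPairing_oneH1 (F : H1Omega) : gradPairing F oneH1 = 0 := by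
  rw [gradPairing, dx_oneH1, dy_oneH1, inner_zero_left, inner_zero_left, add_zero]

lemma mem_H_iff_inner (g : L2Top) : g ∈ H ↔ ⟪topFun fun _ => 1, g⟫_ℂ = 0 := by
  rw [mem_H_iff, inner_topFun continuous_const]
  simp

lemma inner_topFun_one_H (x : H) : ⟪topFun fun _ => 1, (x : L2Top)⟫_ℂ = 0 :=
  (mem_H_iff_inner _).1 x.2

lemma inner_topFun_one_one : ⟪topFun fun _ => 1, topFun fun _ => 1⟫_ℂ = (Real.pi : ℂ) := by
  rw [inner_topFun continuous_const]
  have : ∫ x in Icc 0 Real.pi, (1 : ℝ) • (topFun fun _ => 1 : L2Top) x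
      = ∫ x in Icc 0 Real.pi, (1 : ℂ) := by
    refine integral_congr_ae ?_
    filter_upwards [coeFn_topFun (a := fun _ => 1) continuous_const] with x hx
    rw [hx]; simp
  rw [this]
  simp [Real.pi_pos.le]

lemma isTopTrace_sum {ι : Type*} {F : ι → H1Omega} {f : ι → L2Top}
    (h : ∀ i, IsTopTrace (F i) (f i)) (s : Finset ι) :
    IsTopTrace (∑ i ∈ s, F i) (∑ i ∈ s, f i) := by
  classical
  induction s using Finset.induction_on with
  | empty => exact topTraceGraph.zero_mem
  | insert i s hi ih =>
    rw [Finset.sum_insert hi, Finset.sum_insert hi]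
    exact (h i).add ih

/-- Bessel's inequality for the Dirichlet form. By Green's formula the finite harmonic sum F built
from the coefficients of g satisfies ⟨F,Ψ⟩ = ⟨F,F⟩ there, and the energy of Ψ - F is nonnegative. -/
lemma sum_dtn_mul_sq_le {Ψ : H1Omega} {g : L2Top} (hΨ : IsTopTrace Ψ g) (s : Finset ℕ+) :
    ∑ k ∈ s, dtn k * ‖⟪(cosH k : L2Top), g⟫_ℂ‖ ^ 2 ≤ (gradPairing Ψ Ψ).re := by
  set c : ℕ+ → ℂ := fun k => ⟪(cosH k : L2Top), g⟫_ℂ with hc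
  set F : H1Omega := ∑ k ∈ s, c k • harm k with hF
  have hcc : ∀ k, ⟪g, (cosH k : L2Top)⟫_ℂ = starRingEnd ℂ (c k) := fun k => (inner_conj_symm _ _).symm
  have hFG : ∀ {G : H1Omega} {γ : L2Top}, IsTopTrace G γ →
      gradPairing F G = ∑ k ∈ s, c k * (dtn k * ⟪γ, (cosH k : L2Top)⟫_ℂ) := by
    intro G γ hG
    rw [← gradFunctional_apply, hF, map_sum]
    refine Finset.sum_congr rfl fun k _ => ?_
    rw [map_smul, gradFunctional_apply, gradPairing_harm_left k hG, smul_eq_mul]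
  have htF : IsTopTrace F (∑ k ∈ s, c k • (cosH k : L2Top)) :=
    isTopTrace_sum (fun k => (isTopTrace_harm k).smul _) s
  have e1 : gradPairing F Ψ = ((∑ k ∈ s, dtn k * ‖c k‖ ^ 2 : ℝ) : ℂ) := by
    rw [hFG hΨ, Complex.ofReal_sum]
    refine Finset.sum_congr rfl fun k _ => ?_
    rw [hcc, mul_left_comm, Complex.mul_conj, Complex.normSq_eq_norm_sq]
    push_cast; ring
  have e2 : gradPairing F F = ((∑ k ∈ s, dtn k * ‖c k‖ ^ 2 : ℝ) : ℂ) := by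
    rw [hFG htF, Complex.ofReal_sum]
    refine Finset.sum_congr rfl fun k hk => ?_
    have : ⟪∑ j ∈ s, c j • (cosH j : L2Top), (cosH k : L2Top)⟫_ℂ = starRingEnd ℂ (c k) := by
      rw [sum_inner, Finset.sum_eq_single_of_mem k hk]
      · rw [inner_smul_left, inner_cosH, if_pos rfl, mul_one]
      · intro j _ hjk
        rw [inner_smul_left, inner_cosH, if_neg hjk, mul_zero]
    rw [this, mul_left_comm, Complex.mul_conj, Complex.normSq_eq_norm_sq]
    push_cast; ring
  have e3 : 0 ≤ (gradPairing (Ψ - F) (Ψ - F)).re := by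
    rw [gradPairing, Complex.add_re]
    exact add_nonneg (inner_self_nonneg (𝕜 := ℂ)) (inner_self_nonneg (𝕜 := ℂ))
  have e4 : gradPairing (Ψ - F) (Ψ - F)
      = gradPairing Ψ Ψ - gradPairing Ψ F - gradPairing F Ψ + gradPairing F F := by
    simp only [gradPairing_eq, map_sub, inner_sub_left, inner_sub_right]
    ring
  rw [e4, ← gradPairing_conj Ψ F, e1, e2, Complex.conj_ofReal, Complex.add_re,
    Complex.sub_re, Complex.sub_re, Complex.ofReal_re, sub_add_cancel] at e3
  exact sub_nonneg.1 e3

/-- Here c is the mean of g. The Bessel bound makes k tanh(k)|g_k|² summable, and k tanh k dominates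
a multiple of k. -/
lemma exists_trace_decomposition {Ψ : H1Omega} {g : L2Top} (hΨ : IsTopTrace Ψ g) :
    ∃ (c : ℂ) (η : HAlpha (1 / 2)), g = c • (topFun fun _ => 1) + (η.toH : L2Top) := by
  set c : ℂ := (Real.pi : ℂ)⁻¹ * ⟪topFun fun _ => 1, g⟫_ℂ with hc
  have hπ : (Real.pi : ℂ) ≠ 0 := by exact_mod_cast Real.pi_ne_zero
  have hm : g - c • (topFun fun _ => 1) ∈ H := by
    rw [mem_H_iff_inner, inner_sub_right, inner_smul_right, inner_topFun_one_one, hc]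
    field_simp
    ring
  set x : H := ⟨g - c • (topFun fun _ => 1), hm⟩ with hx
  have hcoeff : ∀ k, coeff x k = ⟪(cosH k : L2Top), g⟫_ℂ := by
    intro k
    have h1 : ⟪(cosH k : L2Top), topFun fun _ => 1⟫_ℂ = 0 := by
      rw [← inner_conj_symm, inner_topFun_one_H, map_zero]
    change ⟪(cosH k : L2Top), g - c • (topFun fun _ => 1)⟫_ℂ = _
    rw [inner_sub_right, inner_smul_right, h1, mul_zero, sub_zero]
  have hs : Summable fun k => dtn k * ‖⟪(cosH k : L2Top), g⟫_ℂ‖ ^ 2 :=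
    summable_of_sum_le (fun k => mul_nonneg (dtn_pos k).le (by positivity)) (sum_dtn_mul_sq_le hΨ)
  have hmem : x ∈ HScale (1 / 2) := by
    change Summable _
    have ht := tanh_pos one_pos
    refine Summable.of_nonneg_of_le (fun k => by positivity) (fun k => ?_)
      (hs.mul_left (Real.tanh 1)⁻¹)
    rw [rpow_two_mul, rpow_half_sq, hcoeff, ← mul_assoc]
    refine mul_le_mul_of_nonneg_right ?_ (by positivity)
    rw [inv_mul_eq_div, le_div_iff₀ ht, mul_comm]
    exact le_dtn k
  refine ⟨c, ⟨x, hmem⟩, ?_⟩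
  change g = c • (topFun fun _ => 1) + (g - c • (topFun fun _ => 1))
  rw [add_sub_cancel]

/-! ### The input vector -/

/-- Square summability of these coefficients is what makes the control operator bounded into X; it
comes from the Hilbert-type inequality. -/
lemma exists_waveInput (h : L2Side) : ∃ b : H, ∀ k,
    coeff b k = -((cosX k 0 : ℝ) * ⟪sideFun (coshY k), h⟫_ℂ) := by
  have hb : Memℓp (fun k : ℕ+ => -(((cosX k 0 : ℝ) : ℂ) * ⟪sideFun (coshY k), h⟫_ℂ)) 2 := by
    rw [memℓp_gen_iff (by norm_num)]
    simp only [ENNReal.toReal_ofNat, Real.rpow_ofNat]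
    -- The factor 2/π is the square of `cosX k 0`, and 4 is the square of the constant in the
    -- exponential bound for `coshY`.
    refine Summable.of_nonneg_of_le (fun j => by positivity) (fun k => ?_)
      ((summable_sq_integral_mul_exp h).mul_left (2 / Real.pi * 4))
    have h1 : ‖⟪sideFun (coshY k), h⟫_ℂ‖
        ≤ 2 * ∫ y in Icc (-1 : ℝ) 0, ‖h y‖ * Real.exp ((k : ℕ) * y) := by
      rw [inner_sideFun (contDiff_coshY k).continuous, ← integral_const_mul]
      have hi : IntegrableOn h (Icc (-1) 0) := (Lp.memLp h).integrable one_le_two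
      refine norm_integral_le_of_norm_le ?_ ?_
      · exact (IntegrableOn.mul_continuousOn hi.norm (g' := fun y => Real.exp ((k : ℕ) * y)) (by fun_prop)
          isCompact_Icc).const_mul 2
      · refine (ae_restrict_iff' measurableSet_Icc).2 (Eventually.of_forall fun y hy => ?_)
        rw [norm_smul, Real.norm_of_nonneg (coshY_nonneg k y), mul_left_comm, mul_comm]
        exact mul_le_mul_of_nonneg_left (coshY_le_exp k hy) (norm_nonneg _)
    have h2 : ‖((cosX k 0 : ℝ) : ℂ)‖ ^ 2 = 2 / Real.pi := by
      rw [Complex.norm_real, Real.norm_eq_abs, sq_abs, cosX, if_neg k.ne_zero, mul_zero,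
        Real.cos_zero, mul_one, Real.sq_sqrt (by positivity)]
    rw [norm_neg, norm_mul, mul_pow, h2, mul_assoc]
    refine mul_le_mul_of_nonneg_left ?_ (by positivity)
    refine (pow_le_pow_left₀ (norm_nonneg _) h1 2).trans (le_of_eq ?_)
    ring
  refine ⟨cosBasis.repr.symm ⟨_, hb⟩, fun k => ?_⟩
  rw [← cosBasis_repr, LinearIsometryEquiv.apply_symm_apply]

/-- The vector through which the wave maker acts on `dζ/dt`. -/
def waveInput (h : L2Side) : H := (exists_waveInput h).choose

lemma coeff_waveInput (h : L2Side) (k : ℕ+) :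
    coeff (waveInput h) k = -((cosX k 0 : ℝ) * ⟪sideFun (coshY k), h⟫_ℂ) :=
  (exists_waveInput h).choose_spec k

lemma coeff_waveInput' (h : L2Side) (k : ℕ+) :
    coeff (waveInput h) k = -⟪((cosX k 0 : ℝ) : ℂ) • sideFun (coshY k), h⟫_ℂ := by
  rw [coeff_waveInput, inner_smul_left, Complex.conj_ofReal]

/-- The functional is continuous on ℋ¹(Ω), so it may be evaluated termwise on the harmonic
expansion, where the left traces are explicit. -/
lemma inner_dirExt_sideRiesz (h : L2Side) (η : HAlpha (1 / 2)) :
    ⟪dirExt η, sideRiesz h⟫_ℂ = -⟪(η.toH : L2Top), (waveInput h : L2Top)⟫_ℂ := by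
  have h1 := (hasSum_dirExt η).mapL (innerSL ℂ (sideRiesz h))
  have h2 := (hasSum_inner_coeff (waveInput h : L2Top) η.toH).neg
  have h3 : ⟪sideRiesz h, dirExt η⟫_ℂ = -⟪(waveInput h : L2Top), (η.toH : L2Top)⟫_ℂ := by
    refine (h1.congr_fun fun k => ?_).unique h2
    rw [map_smul, innerSL_apply_apply, smul_eq_mul, ← mul_neg]
    congr 1
    rw [← inner_conj_symm (sideRiesz h), inner_sideRiesz_eq (isLeftTrace_harm k),
      ← inner_conj_symm (waveInput h : L2Top)]
    change -(starRingEnd ℂ) (coeff (waveInput h) k) = _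
    rw [coeff_waveInput', map_neg, neg_neg]
  rw [← inner_conj_symm (dirExt η) (sideRiesz h), h3, map_neg, inner_conj_symm]

/-- A potential vanishing on the top generates the input functional. -/
lemma exists_wave_potential (h : L2Side) (hmean : ∫ y in Icc (-1 : ℝ) 0, h y = 0) :
    ∃ N : H1Omega, IsTopTrace N 0 ∧ ∀ (Ψ : H1Omega) (g : L2Top) (g' : L2Side),
      IsTopTrace Ψ g → IsLeftTrace Ψ g' →
        gradPairing N Ψ = ⟪g, (waveInput h : L2Top)⟫_ℂ + ⟪g', h⟫_ℂ := by
  obtain ⟨N, hN, hP⟩ := exists_neumann_potential h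
  refine ⟨N, hN, fun Ψ g g' hg hg' => ?_⟩
  -- Split Ψ into a constant, a harmonic extension and a remainder with zero top trace; the
  -- variational equation for N applies to the remainder.
  obtain ⟨c, η, hη⟩ := exists_trace_decomposition hg
  have h1 : IsTopTrace (Ψ - c • oneH1 - dirExt η) 0 := by
    have := (hg.sub (isTopTrace_oneH1.smul c)).sub (isTopTrace_dirExt η)
    rwa [hη, add_sub_cancel_left, sub_self] at this
  have h2 := hP _ h1
  -- A function with zero top trace is orthogonal in the Dirichlet form to every harmonic extension.
  have h3 : gradPairing N (dirExt η) = 0 := by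
    rw [← gradPairing_conj]
    have := hasSum_gradPairing_dirExt η hN
    simp only [inner_zero_left, mul_zero] at this
    rw [this.unique hasSum_zero, map_zero]
  have h4 : gradPairing N (Ψ - c • oneH1 - dirExt η) = gradPairing N Ψ := by
    have e : gradPairing N (Ψ - c • oneH1 - dirExt η)
        = gradPairing N Ψ - starRingEnd ℂ c * gradPairing N oneH1 - gradPairing N (dirExt η) := by
      simp only [gradPairing_eq, map_sub, map_smul, inner_sub_left, inner_smul_left]
      ring
    rw [e, gradPairing_oneH1, h3, mul_zero, sub_zero, sub_zero]
  -- The mean-zero condition on h removes the constant component, which the Dirichlet form cannot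
  -- see.
  have h5 : ⟪oneH1, sideRiesz h⟫_ℂ = 0 := by
    rw [inner_sideRiesz_eq isLeftTrace_oneH1, inner_sideFun continuous_const]
    simpa using hmean
  have h6 : ⟪c • oneH1, sideRiesz h⟫_ℂ = 0 :=
    (inner_smul_left (𝕜 := ℂ) oneH1 (sideRiesz h) c).trans (by rw [h5, mul_zero])
  rw [h4, inner_sub_left, inner_sub_left, h6, inner_sideRiesz_eq hg',
    inner_dirExt_sideRiesz] at h2
  rw [h2, hη, inner_add_left, inner_smul_left, inner_topFun_one_H]
  ring

/-! ### Diagonalization of the state space -/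

section PmSeq

variable {ι : Type*}

lemma memℓp_of_norm_le {f g : ι → ℂ} {C : ℝ} (hf : Memℓp f 2) (h : ∀ k, ‖g k‖ ≤ C * ‖f k‖) :
    Memℓp g 2 := by
  rw [memℓp_gen_iff (by norm_num)] at hf ⊢
  simp only [ENNReal.toReal_ofNat, Real.rpow_ofNat] at hf ⊢
  refine Summable.of_nonneg_of_le (fun j => by positivity) (fun j => ?_) (hf.mul_left (C ^ 2))
  rw [← mul_pow]
  exact pow_le_pow_left₀ (norm_nonneg _) (h j) 2

/-- `1/√2`. -/
def rsqrtTwo : ℂ := (((Real.sqrt 2)⁻¹ : ℝ) : ℂ)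

lemma rsqrtTwo_mul_self : rsqrtTwo * rsqrtTwo = 1 / 2 := by
  rw [rsqrtTwo, ← Complex.ofReal_mul, ← mul_inv, Real.mul_self_sqrt zero_le_two]
  norm_num

lemma conj_rsqrtTwo : starRingEnd ℂ rsqrtTwo = rsqrtTwo := Complex.conj_ofReal _

/-- The sequences `(a + ib)/√2` and `(a - ib)/√2`. -/
def pmSeq (a b : ι → ℂ) : ι ⊕ ι → ℂ :=
  Sum.elim (fun k => rsqrtTwo * (a k + Complex.I * b k))
    (fun k => rsqrtTwo * (a k - Complex.I * b k))

lemma pmSeq_inl (a b : ι → ℂ) (k : ι) :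
    pmSeq a b (Sum.inl k) = rsqrtTwo * (a k + Complex.I * b k) := rfl

lemma pmSeq_inr (a b : ι → ℂ) (k : ι) :
    pmSeq a b (Sum.inr k) = rsqrtTwo * (a k - Complex.I * b k) := rfl

lemma pmSeq_fst (a b : ι → ℂ) (k : ι) :
    rsqrtTwo * (pmSeq a b (Sum.inl k) + pmSeq a b (Sum.inr k)) = a k := by
  rw [pmSeq_inl, pmSeq_inr]
  linear_combination (2 * a k) * rsqrtTwo_mul_self

lemma pmSeq_snd (a b : ι → ℂ) (k : ι) :
    -Complex.I * rsqrtTwo * (pmSeq a b (Sum.inl k) - pmSeq a b (Sum.inr k)) = b k := by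
  rw [pmSeq_inl, pmSeq_inr]
  linear_combination (-2 * Complex.I ^ 2 * b k) * rsqrtTwo_mul_self - b k * Complex.I_sq

lemma pmSeq_eq (y : ι ⊕ ι → ℂ) :
    pmSeq (fun k => rsqrtTwo * (y (Sum.inl k) + y (Sum.inr k)))
      (fun k => -Complex.I * rsqrtTwo * (y (Sum.inl k) - y (Sum.inr k))) = y := by
  ext (k | k)
  · rw [pmSeq_inl]
    linear_combination (y (Sum.inl k) + y (Sum.inr k)
      - Complex.I ^ 2 * (y (Sum.inl k) - y (Sum.inr k))) * rsqrtTwo_mul_self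
      - 1 / 2 * (y (Sum.inl k) - y (Sum.inr k)) * Complex.I_sq
  · rw [pmSeq_inr]
    linear_combination (y (Sum.inl k) + y (Sum.inr k)
      + Complex.I ^ 2 * (y (Sum.inl k) - y (Sum.inr k))) * rsqrtTwo_mul_self
      + 1 / 2 * (y (Sum.inl k) - y (Sum.inr k)) * Complex.I_sq

lemma memℓp_sum_iff (y : ι ⊕ ι → ℂ) :
    Memℓp y 2 ↔ Memℓp (fun k => y (Sum.inl k)) 2 ∧ Memℓp (fun k => y (Sum.inr k)) 2 := by
  simp only [memℓp_gen_iff (p := 2) (by norm_num)]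
  exact ⟨fun h => ⟨h.comp_injective Sum.inl_injective, h.comp_injective Sum.inr_injective⟩,
    fun h => h.1.sum _ h.2⟩

lemma memℓp_pmSeq (a b : ι → ℂ) : Memℓp (pmSeq a b) 2 ↔ Memℓp a 2 ∧ Memℓp b 2 := by
  rw [memℓp_sum_iff]
  constructor
  · rintro ⟨h1, h2⟩
    constructor
    · convert (h1.add h2).const_smul rsqrtTwo using 1
      ext k
      exact (pmSeq_fst a b k).symm
    · convert (h1.sub h2).const_smul (-Complex.I * rsqrtTwo) using 1
      ext k
      exact (pmSeq_snd a b k).symm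
  · rintro ⟨h1, h2⟩
    exact ⟨(h1.add (h2.const_smul Complex.I)).const_smul rsqrtTwo,
      (h1.sub (h2.const_smul Complex.I)).const_smul rsqrtTwo⟩

/-- The change of coordinates is unitary in each mode; this is why the energy becomes the ℓ² inner
product. -/
lemma conj_pmSeq_mul (a b a' b' : ι → ℂ) (k : ι) :
    starRingEnd ℂ (pmSeq a b (Sum.inl k)) * pmSeq a' b' (Sum.inl k)
      + starRingEnd ℂ (pmSeq a b (Sum.inr k)) * pmSeq a' b' (Sum.inr k)
      = starRingEnd ℂ (a k) * a' k + starRingEnd ℂ (b k) * b' k := by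
  simp only [pmSeq_inl, pmSeq_inr, map_mul, map_add, map_sub, conj_rsqrtTwo, Complex.conj_I]
  linear_combination (2 * (starRingEnd ℂ (a k) * a' k)
    - 2 * Complex.I ^ 2 * (starRingEnd ℂ (b k) * b' k)) * rsqrtTwo_mul_self
    - starRingEnd ℂ (b k) * b' k * Complex.I_sq

end PmSeq

/-- The frequency `√(k tanh k)` of the `k`-th mode. -/
def freq (k : ℕ+) : ℝ := Real.sqrt (dtn k)

lemma freq_pos (k : ℕ+) : 0 < freq k := Real.sqrt_pos.2 (dtn_pos k)

lemma freq_sq (k : ℕ+) : freq k ^ 2 = dtn k := Real.sq_sqrt (dtn_pos k).le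

lemma freq_le (k : ℕ+) : freq k ≤ ((k : ℕ) : ℝ) ^ ((1 / 2 : ℝ≥0) : ℝ) := by
  refine le_of_sq_le_sq ?_ (rpow_pos_cast k _).le
  rw [freq_sq, rpow_half_sq]
  exact dtn_le k

lemma le_freq (k : ℕ+) :
    ((k : ℕ) : ℝ) ^ ((1 / 2 : ℝ≥0) : ℝ) ≤ Real.sqrt (Real.tanh 1)⁻¹ * freq k := by
  have ht := tanh_pos one_pos
  refine le_of_sq_le_sq ?_ (mul_nonneg (Real.sqrt_nonneg _) (freq_pos k).le)
  rw [rpow_half_sq, mul_pow, freq_sq, Real.sq_sqrt (inv_nonneg.2 ht.le), inv_mul_eq_div,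
    le_div_iff₀ ht, mul_comm]
  exact le_dtn k

lemma norm_ofReal_mul {r : ℝ} (hr : 0 ≤ r) (z : ℂ) : ‖(r : ℂ) * z‖ = r * ‖z‖ := by
  rw [norm_mul, Complex.norm_real, Real.norm_of_nonneg hr]

/-- The frequencies are bounded above and below by multiples of k^{1/2}. -/
lemma memℓp_freq_mul_iff (x : H) :
    Memℓp (fun k => (freq k : ℂ) * coeff x k) 2 ↔ x ∈ HScale (1 / 2) := by
  refine Iff.trans ⟨fun h => ?_, fun h => ?_⟩ (memlp_weighted_iff (1 / 2) x)
  · refine memℓp_of_norm_le (C := Real.sqrt (Real.tanh 1)⁻¹) h fun k => ?_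
    rw [norm_ofReal_mul (rpow_pos_cast k _).le, norm_ofReal_mul (freq_pos k).le, ← mul_assoc]
    exact mul_le_mul_of_nonneg_right (le_freq k) (norm_nonneg _)
  · refine memℓp_of_norm_le (C := 1) h fun k => ?_
    rw [norm_ofReal_mul (rpow_pos_cast k _).le, norm_ofReal_mul (freq_pos k).le, one_mul]
    exact mul_le_mul_of_nonneg_right (freq_le k) (norm_nonneg _)

lemma memℓp_dtn_mul_iff (x : H) :
    Memℓp (fun k => (dtn k : ℂ) * coeff x k) 2 ↔ x ∈ HScale 1 := by
  have e : ∀ k : ℕ+, ((k : ℕ) : ℝ) ^ ((1 : ℝ≥0) : ℝ) = ((k : ℕ) : ℝ) := fun k => by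
    rw [NNReal.coe_one, Real.rpow_one]
  refine Iff.trans ⟨fun h => ?_, fun h => ?_⟩ (memlp_weighted_iff 1 x)
  · refine memℓp_of_norm_le (C := (Real.tanh 1)⁻¹) h fun k => ?_
    rw [norm_ofReal_mul (rpow_pos_cast k _).le, norm_ofReal_mul (dtn_pos k).le, ← mul_assoc, e]
    refine mul_le_mul_of_nonneg_right ?_ (norm_nonneg _)
    rw [inv_mul_eq_div, le_div_iff₀ (tanh_pos one_pos), mul_comm]
    exact le_dtn k
  · refine memℓp_of_norm_le (C := 1) h fun k => ?_
    rw [norm_ofReal_mul (rpow_pos_cast k _).le, norm_ofReal_mul (dtn_pos k).le, one_mul, e]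
    exact mul_le_mul_of_nonneg_right (dtn_le k) (norm_nonneg _)

lemma memℓp_coeff (x : H) : Memℓp (fun k => coeff x k) 2 := by
  have e : (fun k => coeff x k) = ⇑(cosBasis.repr x) := funext fun k => (cosBasis_repr x k).symm
  rw [e]
  exact lp.memℓp _

lemma exists_coeff_eq {s : ℕ+ → ℂ} (hs : Memℓp s 2) : ∃ x : H, ∀ k, coeff x k = s k :=
  ⟨cosBasis.repr.symm ⟨s, hs⟩, fun k => by
    rw [← cosBasis_repr, LinearIsometryEquiv.apply_symm_apply]⟩

lemma ext_coeff {x y : H} (h : ∀ k, coeff x k = coeff y k) : x = y := by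
  refine cosBasis.repr.injective (lp.ext (funext fun k => ?_))
  rw [cosBasis_repr, cosBasis_repr, h]

lemma HAlpha.toH_injective {α : ℝ≥0} : Function.Injective (HAlpha.toH (α := α)) :=
  Subtype.val_injective

lemma HAlpha.ext_coeff {α : ℝ≥0} {x y : HAlpha α} (h : ∀ k, coeff x.toH k = coeff y.toH k) :
    x = y := HAlpha.toH_injective (WaterWave.ext_coeff h)

/-- The coordinates `(√(k tanh k) η_k ± i w_k)/√2` of a state `(η, w)`. -/
def stateSeq (z : StateSpace) : ℕ+ ⊕ ℕ+ → ℂ :=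
  pmSeq (fun k => freq k * coeff z.fst.toH k) (fun k => coeff z.snd k)

lemma memℓp_stateSeq (z : StateSpace) : Memℓp (stateSeq z) 2 :=
  (memℓp_pmSeq _ _).2 ⟨(memℓp_freq_mul_iff _).2 z.fst.2, memℓp_coeff _⟩

/-- `stateSeq` as a linear map. -/
def stateMap : StateSpace →ₗ[ℂ] lp (fun _ : ℕ+ ⊕ ℕ+ => ℂ) 2 where
  toFun z := ⟨stateSeq z, memℓp_stateSeq z⟩
  map_add' z z' := by
    ext j
    change stateSeq (z + z') j = stateSeq z j + stateSeq z' j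
    rcases j with k | k <;>
    · simp only [stateSeq, pmSeq_inl, pmSeq_inr, WithLp.add_fst, WithLp.add_snd, map_add, coeff_add]
      ring
  map_smul' c z := by
    ext j
    change stateSeq (c • z) j = c * stateSeq z j
    rcases j with k | k <;>
    · simp only [stateSeq, pmSeq_inl, pmSeq_inr, WithLp.smul_fst, WithLp.smul_snd, map_smul,
        coeff_smul]
      ring

lemma stateMap_apply (z : StateSpace) (j : ℕ+ ⊕ ℕ+) : stateMap z j = stateSeq z j := rfl

lemma stateSeq_fst (z : StateSpace) (k : ℕ+) :
    rsqrtTwo * (stateSeq z (Sum.inl k) + stateSeq z (Sum.inr k)) = freq k * coeff z.fst.toH k :=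
  pmSeq_fst _ _ k

lemma stateSeq_snd (z : StateSpace) (k : ℕ+) :
    -Complex.I * rsqrtTwo * (stateSeq z (Sum.inl k) - stateSeq z (Sum.inr k)) = coeff z.snd k :=
  pmSeq_snd _ _ k

lemma stateMap_injective : Function.Injective stateMap := by
  intro z z' h
  have hj : ∀ j, stateSeq z j = stateSeq z' j := fun j => by
    rw [← stateMap_apply, h, stateMap_apply]
  have h1 : z.fst = z'.fst := HAlpha.ext_coeff fun k => by
    have h := stateSeq_fst z k
    rw [hj, hj, stateSeq_fst] at h
    exact (mul_left_cancel₀ (by exact_mod_cast (freq_pos k).ne') h).symm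
  have h2 : z.snd = z'.snd := ext_coeff fun k => by
    have h := stateSeq_snd z k
    rw [hj, hj, stateSeq_snd] at h
    exact h.symm
  exact WithLp.ofLp_injective 2 (Prod.ext h1 h2)

lemma stateMap_surjective : Function.Surjective stateMap := by
  intro y
  set a : ℕ+ → ℂ := fun k => rsqrtTwo * (y (Sum.inl k) + y (Sum.inr k)) with ha
  set b : ℕ+ → ℂ := fun k => -Complex.I * rsqrtTwo * (y (Sum.inl k) - y (Sum.inr k)) with hb
  have hy : pmSeq a b = y := pmSeq_eq _
  have hab : Memℓp a 2 ∧ Memℓp b 2 := by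
    rw [← memℓp_pmSeq, hy]
    exact lp.memℓp y
  obtain ⟨w, hw⟩ := exists_coeff_eq hab.2
  -- The frequencies stay away from zero, so division by them preserves ℓ².
  have ht : ∀ k, 1 ≤ Real.sqrt (Real.tanh 1)⁻¹ * freq k := fun k =>
    (Real.one_le_rpow (one_le_cast k) (by positivity)).trans (le_freq k)
  obtain ⟨η, hη⟩ := exists_coeff_eq (s := fun k => ((freq k)⁻¹ : ℝ) * a k)
    (memℓp_of_norm_le (C := Real.sqrt (Real.tanh 1)⁻¹) hab.1 fun k => by
      rw [norm_ofReal_mul (inv_nonneg.2 (freq_pos k).le)]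
      refine mul_le_mul_of_nonneg_right ?_ (norm_nonneg _)
      rw [inv_le_iff_one_le_mul₀ (freq_pos k)]
      exact ht k)
  have hη' : ∀ k, (freq k : ℂ) * coeff η k = a k := fun k => by
    have : (freq k : ℂ) ≠ 0 := by exact_mod_cast (freq_pos k).ne'
    rw [hη, Complex.ofReal_inv, mul_inv_cancel_left₀ this]
  have hm : η ∈ HScale (1 / 2) := by
    rw [← memℓp_freq_mul_iff]
    simp only [hη']
    exact hab.1
  refine ⟨WithLp.toLp 2 ((⟨η, hm⟩ : HScale (1 / 2)), w), ?_⟩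
  ext j
  rw [stateMap_apply, ← hy]
  refine congrFun (congrArg₂ pmSeq (funext hη') (funext hw)) j

/-- The coordinate functionals of the state space are bounded. -/
lemma exists_stateSeq_clm (j : ℕ+ ⊕ ℕ+) : ∃ f : StateSpace →L[ℂ] ℂ, ∀ z, f z = stateSeq z j := by
  have h1 : ∀ k, ∃ f : StateSpace →L[ℂ] ℂ, ∀ z, f z = coeff z.fst.toH k := fun k => by
    refine ⟨((((((k : ℕ) : ℝ) ^ ((1 / 2 : ℝ≥0) : ℝ))⁻¹ : ℝ) : ℂ)) •
      ((lp.evalCLM ℂ (fun _ : ℕ+ => ℂ) 2 k).comp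
        ((HAlpha.toSeqL (1 / 2)).comp (WithLp.fstL 2 ℂ (HAlpha (1 / 2)) H))), fun z => ?_⟩
    change ((((((k : ℕ) : ℝ) ^ ((1 / 2 : ℝ≥0) : ℝ))⁻¹ : ℝ) : ℂ)) *
      (((((k : ℕ) : ℝ) ^ ((1 / 2 : ℝ≥0) : ℝ) : ℝ) : ℂ) * coeff z.fst.toH k) = _
    rw [← mul_assoc, ← Complex.ofReal_mul, inv_mul_cancel₀ (rpow_pos_cast k _).ne',
      Complex.ofReal_one, one_mul]
  have h2 : ∀ k, ∃ f : StateSpace →L[ℂ] ℂ, ∀ z, f z = coeff z.snd k := fun k =>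
    ⟨(innerSL ℂ (cosH k)).comp (WithLp.sndL 2 ℂ (HAlpha (1 / 2)) H), fun z => rfl⟩
  rcases j with k | k
  all_goals
    obtain ⟨f, hf⟩ := h1 k
    obtain ⟨g, hg⟩ := h2 k
  · refine ⟨rsqrtTwo • ((freq k : ℂ) • f + Complex.I • g), fun z => ?_⟩
    change rsqrtTwo * ((freq k : ℂ) * f z + Complex.I * g z) = _
    rw [hf, hg]; rfl
  · refine ⟨rsqrtTwo • ((freq k : ℂ) • f - Complex.I • g), fun z => ?_⟩
    change rsqrtTwo * ((freq k : ℂ) * f z - Complex.I * g z) = _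
    rw [hf, hg]; rfl

/-- Closed graph theorem: every coordinate is a bounded functional. The inverse is then bounded by
the open mapping theorem, which yields the equivalence of the norms. -/
lemma continuous_stateMap : Continuous stateMap := by
  refine stateMap.continuous_of_seq_closed_graph fun v x y hv hy => ?_
  ext j
  obtain ⟨f, hf⟩ := exists_stateSeq_clm j
  have h1 : Tendsto (fun n => f (v n)) atTop (𝓝 (f x)) := (f.continuous.tendsto x).comp hv
  have h2 := ((lp.evalCLM ℂ (fun _ : ℕ+ ⊕ ℕ+ => ℂ) 2 j).continuous.tendsto y).comp hy
  simp only [hf] at h1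
  exact tendsto_nhds_unique h2 h1

/-- The coordinates as an isomorphism of the state space onto `ℓ²`. -/
def stateEquiv : StateSpace ≃L[ℂ] lp (fun _ : ℕ+ ⊕ ℕ+ => ℂ) 2 :=
  (LinearEquiv.ofBijective stateMap
    ⟨stateMap_injective, stateMap_surjective⟩).toContinuousLinearEquivOfContinuous
    continuous_stateMap

lemma stateEquiv_apply (z : StateSpace) (j : ℕ+ ⊕ ℕ+) : stateEquiv z j = stateSeq z j := rfl

/-- The two halves of the ℓ² series are paired mode by mode, and Parseval's identity splits off the
velocity part. -/
lemma energyInner_eq (z z' : StateSpace) : energyInner z z' = ⟪stateEquiv z, stateEquiv z'⟫_ℂ := by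
  have hs := lp.summable_inner (𝕜 := ℂ) (stateEquiv z) (stateEquiv z')
  have h1 := hs.comp_injective Sum.inl_injective
  have h2 := hs.comp_injective Sum.inr_injective
  have h3 : HasSum (fun k => starRingEnd ℂ (freq k * coeff z.fst.toH k) * (freq k * coeff z'.fst.toH k)
      + starRingEnd ℂ (coeff z.snd k) * coeff z'.snd k) ⟪stateEquiv z, stateEquiv z'⟫_ℂ := by
    have h4 := (h1.hasSum.add h2.hasSum)
    rw [lp.inner_eq_tsum, Summable.tsum_sum h1 h2]
    refine h4.congr_fun fun k => ?_
    rw [← conj_pmSeq_mul (fun k => (freq k : ℂ) * coeff z.fst.toH k) (fun k => coeff z.snd k)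
      (fun k => (freq k : ℂ) * coeff z'.fst.toH k) (fun k => coeff z'.snd k)]
    refine congrArg₂ (· + ·) ?_ ?_ <;> exact mul_comm _ _
  have h5 : HasSum (fun k => starRingEnd ℂ (coeff z.snd k) * coeff z'.snd k) ⟪z.snd, z'.snd⟫_ℂ := by
    refine (hasSum_inner_coeff (z.snd : L2Top) z'.snd).congr_fun fun k => ?_
    rw [mul_comm, ← inner_conj_symm (z.snd : L2Top)]
    rfl
  rw [energyInner, ← eq_sub_iff_add_eq, ← (h3.sub h5).tsum_eq]
  refine tsum_congr fun k => ?_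
  rw [add_sub_cancel_right, map_mul, Complex.conj_ofReal]
  change (dtn k : ℂ) * _ = _
  rw [← freq_sq]
  push_cast
  ring

lemma isEquivalentInnerProduct_energyInner : IsEquivalentInnerProduct energyInner where
  conj_symm z z' := by rw [energyInner_eq, energyInner_eq, inner_conj_symm]
  add_right x y z := by rw [energyInner_eq, map_add, inner_add_right, energyInner_eq, energyInner_eq]
  smul_right c x y := by rw [energyInner_eq, map_smul, inner_smul_right, energyInner_eq]
  equiv := by
    set E := (stateEquiv : StateSpace →L[ℂ] lp (fun _ : ℕ+ ⊕ ℕ+ => ℂ) 2)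
    set F := (stateEquiv.symm : lp (fun _ : ℕ+ ⊕ ℕ+ => ℂ) 2 →L[ℂ] StateSpace)
    have hE := norm_nonneg E
    have hF := norm_nonneg F
    -- Adding 1 to the operator norms guarantees positive constants.
    refine ⟨((‖F‖ + 1) ^ 2)⁻¹, (‖E‖ + 1) ^ 2, by positivity, by positivity, fun z => ?_⟩
    have h1 : (energyInner z z).re = ‖stateEquiv z‖ ^ 2 := by
      rw [energyInner_eq]
      exact (norm_sq_eq_re_inner (𝕜 := ℂ) _).symm
    have h2 : ‖stateEquiv z‖ ≤ (‖E‖ + 1) * ‖z‖ :=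
      (E.le_opNorm z).trans (mul_le_mul_of_nonneg_right (by linarith) (norm_nonneg _))
    have h3 : ‖z‖ ≤ (‖F‖ + 1) * ‖stateEquiv z‖ := by
      have := F.le_opNorm (stateEquiv z)
      rw [show F (stateEquiv z) = z from stateEquiv.symm_apply_apply z] at this
      exact this.trans (mul_le_mul_of_nonneg_right (by linarith) (norm_nonneg _))
    rw [h1, inv_mul_le_iff₀ (by positivity), ← mul_pow, ← mul_pow]
    exact ⟨pow_le_pow_left₀ (norm_nonneg _) h3 2, pow_le_pow_left₀ (norm_nonneg _) h2 2⟩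

/-! ### The water wave group -/

/-- The eigenfrequencies of the water wave operator. -/
def stateRate : ℕ+ ⊕ ℕ+ → ℝ := Sum.elim (fun k => -freq k) freq

/-- In coordinates, multiplication by the imaginary rates is the operator (η, w) ↦ (w, -Λη), where Λ
has eigenvalues k tanh k. -/
lemma stateRate_mul_stateSeq (z : StateSpace) :
    (fun j => (stateRate j : ℂ) * Complex.I * stateSeq z j)
      = pmSeq (fun k => freq k * coeff z.snd k) (fun k => -(dtn k * coeff z.fst.toH k)) := by
  ext (k | k)
  · rw [stateSeq, pmSeq_inl, pmSeq_inl, stateRate, Sum.elim_inl, ← freq_sq]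
    push_cast
    linear_combination (-rsqrtTwo * freq k * coeff z.snd k) * Complex.I_sq
  · rw [stateSeq, pmSeq_inr, pmSeq_inr, stateRate, Sum.elim_inr, ← freq_sq]
    push_cast
    linear_combination (-rsqrtTwo * freq k * coeff z.snd k) * Complex.I_sq

/-- The multiplied sequence is in ℓ² exactly when √(k tanh k) w_k and k tanh(k) η_k are, and these
weights are comparable to k^{1/2} and k. -/
lemma mem_domain_iff (z : StateSpace) : z ∈ (diagGen stateEquiv stateRate).domain ↔
    z.fst.toH ∈ HScale 1 ∧ z.snd ∈ HScale (1 / 2) := by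
  rw [mem_diagGen_domain]
  change Memℓp (fun j => (stateRate j : ℂ) * Complex.I * stateSeq z j) 2 ↔ _
  rw [stateRate_mul_stateSeq, memℓp_pmSeq, memℓp_freq_mul_iff, ← memℓp_dtn_mul_iff, and_comm]
  refine and_congr_left fun _ => ⟨fun h => ?_, fun h => ?_⟩ <;>
  exact memℓp_of_norm_le (C := 1) h fun k => by rw [norm_neg, one_mul]

/-- The vector through which the wave maker acts on the state. -/
def stateInput (h : L2Side) : StateSpace := WithLp.toLp 2 (0, waveInput h)

/-- The water wave control system. -/
def waveSystem (h : L2Side) : WellPosedSystem ℂ StateSpace :=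
  diagSystem stateEquiv stateRate (stateInput h)

/-- The trajectories of the water wave control system. -/
def waveTraj (h : L2Side) (u : ℝ → ℂ) (z : StateSpace) : ℝ → StateSpace :=
  trajectory stateEquiv stateRate (stateInput h) u z

lemma waveTraj_eq (h : L2Side) {u : ℝ → ℂ} (hu : MemL2Loc u) (z : StateSpace) {τ : ℝ}
    (hτ : 0 ≤ τ) :
    waveTraj h u z τ = (waveSystem h).T τ z + (waveSystem h).inputMap τ u hu := by
  rw [waveSystem, diagSystem_inputMap _ _ _ hu hτ]
  rfl

lemma stateSeq_stateInput_inl (h : L2Side) (k : ℕ+) :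
    stateSeq (stateInput h) (Sum.inl k) = rsqrtTwo * (Complex.I * coeff (waveInput h) k) := by
  rw [stateSeq, pmSeq_inl]
  change rsqrtTwo * ((freq k : ℂ) * coeff (HAlpha.toH (0 : HAlpha (1 / 2))) k + _) = _
  rw [map_zero, coeff_zero, mul_zero, zero_add]
  rfl

lemma stateSeq_stateInput_inr (h : L2Side) (k : ℕ+) :
    stateSeq (stateInput h) (Sum.inr k) = rsqrtTwo * -(Complex.I * coeff (waveInput h) k) := by
  rw [stateSeq, pmSeq_inr]
  change rsqrtTwo * ((freq k : ℂ) * coeff (HAlpha.toH (0 : HAlpha (1 / 2))) k - _) = _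
  rw [map_zero, coeff_zero, mul_zero, zero_sub]
  rfl

/-! ### The equations for the Fourier coefficients -/

/-- The Fourier coefficient as a bounded functional on `H`. -/
def coeffL (k : ℕ+) : H →L[ℂ] ℂ := innerSL ℂ (cosH k)

lemma coeffL_apply (k : ℕ+) (x : H) : coeffL k x = coeff x k := rfl

/-- The inclusion `H_{1/2} ⊆ H` composed with `coeffL`. -/
def HAlpha.coeffL (k : ℕ+) : HAlpha (1 / 2) →L[ℂ] ℂ :=
  ((((((k : ℕ) : ℝ) ^ ((1 / 2 : ℝ≥0) : ℝ))⁻¹ : ℝ) : ℂ)) •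
    ((lp.evalCLM ℂ (fun _ : ℕ+ => ℂ) 2 k).comp (HAlpha.toSeqL (1 / 2)))

lemma HAlpha.coeffL_apply (k : ℕ+) (η : HAlpha (1 / 2)) : HAlpha.coeffL k η = coeff η.toH k := by
  change ((((((k : ℕ) : ℝ) ^ ((1 / 2 : ℝ≥0) : ℝ))⁻¹ : ℝ) : ℂ)) *
    (((((k : ℕ) : ℝ) ^ ((1 / 2 : ℝ≥0) : ℝ) : ℝ) : ℂ) * coeff η.toH k) = _
  rw [← mul_assoc, ← Complex.ofReal_mul, inv_mul_cancel₀ (rpow_pos_cast k _).ne',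
    Complex.ofReal_one, one_mul]

section Coefficients

variable {h : L2Side} {u : ℝ → ℂ}

lemma continuousOn_stateSeq {z : ℝ → StateSpace} {s : Set ℝ}
    (h1 : ∀ k, ContinuousOn (fun t => coeff (z t).fst.toH k) s)
    (h2 : ∀ k, ContinuousOn (fun t => coeff (z t).snd k) s) (j : ℕ+ ⊕ ℕ+) :
    ContinuousOn (fun t => stateSeq (z t) j) s := by
  rcases j with k | k
  · exact (((h1 k).const_mul _).add ((h2 k).const_mul _)).const_mul _
  · exact (((h1 k).const_mul _).sub ((h2 k).const_mul _)).const_mul _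

/-- A solution of the equations for the Fourier coefficients is a trajectory. -/
lemma eq_waveTraj_of_coeff (hu : MemL2Loc u) {z : ℝ → StateSpace}
    (h1 : ∀ k, ContinuousOn (fun t => coeff (z t).fst.toH k) (Ici 0))
    (h2 : ∀ k, ContinuousOn (fun t => coeff (z t).snd k) (Ici 0))
    (e1 : ∀ k t, 0 ≤ t → coeff (z t).fst.toH k
      = coeff (z 0).fst.toH k + ∫ s in (0 : ℝ)..t, coeff (z s).snd k)
    (e2 : ∀ k t, 0 ≤ t → coeff (z t).snd k = coeff (z 0).snd k
      + ∫ s in (0 : ℝ)..t, (-(dtn k * coeff (z s).fst.toH k) + u s * coeff (waveInput h) k))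
    {τ : ℝ} (hτ : 0 ≤ τ) : z τ = waveTraj h u (z 0) τ := by
  refine ext_coord (E := stateEquiv) fun j => ?_
  rw [waveTraj, trajectory_coord _ _ _ hu _ hτ]
  simp only [stateEquiv_apply]
  have hui := fun t (ht : (0 : ℝ) ≤ t) => hu.intervalIntegrable ht
  have hsub : ∀ t : ℝ, 0 ≤ t → uIcc 0 t ⊆ Ici 0 := fun t ht x hx => by
    rw [uIcc_of_le ht] at hx; exact hx.1
  have i1 := fun k t (ht : 0 ≤ t) =>
    ((h1 k).mono (hsub t ht)).intervalIntegrable (μ := volume)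
  have i2 := fun k t (ht : 0 ≤ t) =>
    ((h2 k).mono (hsub t ht)).intervalIntegrable (μ := volume)
  -- In the diagonal coordinates the two integral equations combine into one scalar equation for
  -- each j, solved by variation of constants.
  refine duhamel_of_integral_eq hτ ((continuousOn_stateSeq h1 h2 j).mono fun t ht => ht.1)
    ((hui τ hτ).mul_const _) fun t ht => ?_
  have i3 : ∀ k, IntervalIntegrable (fun s => Complex.I *
      (-(dtn k * coeff (z s).fst.toH k) + u s * coeff (waveInput h) k)) volume 0 t := fun k =>
    ((((i1 k t ht.1).const_mul _).neg).add ((hui t ht.1).mul_const _)).const_mul _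
  rcases j with k | k
  · have e : ∀ s, (stateRate (Sum.inl k) : ℂ) * Complex.I * stateSeq (z s) (Sum.inl k)
        + u s * stateSeq (stateInput h) (Sum.inl k)
        = rsqrtTwo * (freq k * coeff (z s).snd k + Complex.I *
          (-(dtn k * coeff (z s).fst.toH k) + u s * coeff (waveInput h) k)) := fun s => by
      rw [congrFun (stateRate_mul_stateSeq (z s)) (Sum.inl k), pmSeq_inl, stateSeq_stateInput_inl]
      ring
    simp only [e]
    rw [intervalIntegral.integral_const_mul, intervalIntegral.integral_add
      ((i2 k t ht.1).const_mul _) (i3 k), intervalIntegral.integral_const_mul,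
      intervalIntegral.integral_const_mul, stateSeq, stateSeq, pmSeq_inl, pmSeq_inl,
      e1 k t ht.1, e2 k t ht.1]
    ring
  · have e : ∀ s, (stateRate (Sum.inr k) : ℂ) * Complex.I * stateSeq (z s) (Sum.inr k)
        + u s * stateSeq (stateInput h) (Sum.inr k)
        = rsqrtTwo * (freq k * coeff (z s).snd k - Complex.I *
          (-(dtn k * coeff (z s).fst.toH k) + u s * coeff (waveInput h) k)) := fun s => by
      rw [congrFun (stateRate_mul_stateSeq (z s)) (Sum.inr k), pmSeq_inr, stateSeq_stateInput_inr]
      ring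
    simp only [e]
    rw [intervalIntegral.integral_const_mul, intervalIntegral.integral_sub
      ((i2 k t ht.1).const_mul _) (i3 k), intervalIntegral.integral_const_mul,
      intervalIntegral.integral_const_mul, stateSeq, stateSeq, pmSeq_inr, pmSeq_inr,
      e1 k t ht.1, e2 k t ht.1]
    ring

lemma continuousOn_waveTraj (hu : MemL2Loc u) (z₀ : StateSpace) :
    ContinuousOn (waveTraj h u z₀) (Ici 0) := continuousOn_trajectory _ _ _ hu _

lemma continuousOn_waveTraj_fst (hu : MemL2Loc u) (z₀ : StateSpace) :
    ContinuousOn (fun t => (waveTraj h u z₀ t).fst) (Ici 0) :=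
  (WithLp.fstL 2 ℂ (HAlpha (1 / 2)) H).continuous.comp_continuousOn (continuousOn_waveTraj hu z₀)

lemma continuousOn_waveTraj_snd (hu : MemL2Loc u) (z₀ : StateSpace) :
    ContinuousOn (fun t => (waveTraj h u z₀ t).snd) (Ici 0) :=
  (WithLp.sndL 2 ℂ (HAlpha (1 / 2)) H).continuous.comp_continuousOn (continuousOn_waveTraj hu z₀)

lemma waveTraj_zero (z₀ : StateSpace) : waveTraj h u z₀ 0 = z₀ := by
  rw [waveTraj, trajectory, diagGroup_zero, intervalIntegral.integral_same, add_zero]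
  rfl

lemma stateSeq_waveTraj (hu : MemL2Loc u) (z₀ : StateSpace) (j : ℕ+ ⊕ ℕ+) {τ : ℝ} (hτ : 0 ≤ τ) :
    stateSeq (waveTraj h u z₀ τ) j = stateSeq z₀ j + ∫ s in (0 : ℝ)..τ,
      ((stateRate j : ℂ) * Complex.I * stateSeq (waveTraj h u z₀ s) j
        + u s * stateSeq (stateInput h) j) :=
  integral_eq_of_duhamel hτ ((hu.intervalIntegrable hτ).mul_const _) fun _ ht =>
    trajectory_coord stateEquiv stateRate (stateInput h) hu z₀ ht.1 j

lemma intervalIntegrable_stateSeq_waveTraj (hu : MemL2Loc u) (z₀ : StateSpace) (j : ℕ+ ⊕ ℕ+) {τ : ℝ}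
    (hτ : 0 ≤ τ) : IntervalIntegrable (fun s => (stateRate j : ℂ) * Complex.I *
      stateSeq (waveTraj h u z₀ s) j + u s * stateSeq (stateInput h) j) volume 0 τ := by
  refine IntervalIntegrable.add (IntervalIntegrable.const_mul ?_ _)
    ((hu.intervalIntegrable hτ).mul_const _)
  obtain ⟨f, hf⟩ := exists_stateSeq_clm j
  simp only [← hf]
  refine ContinuousOn.intervalIntegrable (f.continuous.comp_continuousOn
    ((continuousOn_waveTraj hu z₀).mono fun t ht => ?_))
  rw [uIcc_of_le hτ] at ht
  exact ht.1

lemma coeff_waveTraj_fst (hu : MemL2Loc u) (z₀ : StateSpace) (k : ℕ+) {τ : ℝ} (hτ : 0 ≤ τ) :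
    coeff (waveTraj h u z₀ τ).fst.toH k
      = coeff z₀.fst.toH k + ∫ s in (0 : ℝ)..τ, coeff (waveTraj h u z₀ s).snd k := by
  have h1 := stateSeq_waveTraj (h := h) hu z₀ (Sum.inl k) hτ
  have h2 := stateSeq_waveTraj (h := h) hu z₀ (Sum.inr k) hτ
  have h3 := stateSeq_fst (waveTraj h u z₀ τ) k
  rw [h1, h2, add_add_add_comm, mul_add, stateSeq_fst, ← intervalIntegral.integral_add
    (intervalIntegrable_stateSeq_waveTraj hu z₀ _ hτ)
    (intervalIntegrable_stateSeq_waveTraj hu z₀ _ hτ), ← intervalIntegral.integral_const_mul] at h3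
  have e : ∀ s, rsqrtTwo * ((stateRate (Sum.inl k) : ℂ) * Complex.I *
        stateSeq (waveTraj h u z₀ s) (Sum.inl k) + u s * stateSeq (stateInput h) (Sum.inl k)
      + ((stateRate (Sum.inr k) : ℂ) * Complex.I *
        stateSeq (waveTraj h u z₀ s) (Sum.inr k) + u s * stateSeq (stateInput h) (Sum.inr k)))
      = freq k * coeff (waveTraj h u z₀ s).snd k := fun s => by
    have e1 := congrFun (stateRate_mul_stateSeq (waveTraj h u z₀ s))
    rw [add_add_add_comm, mul_add, e1, e1, pmSeq_fst, stateSeq_stateInput_inl,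
      stateSeq_stateInput_inr]
    ring
  simp only [e] at h3
  rw [intervalIntegral.integral_const_mul, ← mul_add] at h3
  exact (mul_left_cancel₀ (by exact_mod_cast (freq_pos k).ne') h3).symm

lemma coeff_waveTraj_snd (hu : MemL2Loc u) (z₀ : StateSpace) (k : ℕ+) {τ : ℝ} (hτ : 0 ≤ τ) :
    coeff (waveTraj h u z₀ τ).snd k = coeff z₀.snd k + ∫ s in (0 : ℝ)..τ,
      (-(dtn k * coeff (waveTraj h u z₀ s).fst.toH k) + u s * coeff (waveInput h) k) := by
  have h1 := stateSeq_waveTraj (h := h) hu z₀ (Sum.inl k) hτ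
  have h2 := stateSeq_waveTraj (h := h) hu z₀ (Sum.inr k) hτ
  have h3 := stateSeq_snd (waveTraj h u z₀ τ) k
  rw [h1, h2, add_sub_add_comm, mul_add, stateSeq_snd, ← intervalIntegral.integral_sub
    (intervalIntegrable_stateSeq_waveTraj hu z₀ _ hτ)
    (intervalIntegrable_stateSeq_waveTraj hu z₀ _ hτ), ← intervalIntegral.integral_const_mul] at h3
  have e : ∀ s, -Complex.I * rsqrtTwo * ((stateRate (Sum.inl k) : ℂ) * Complex.I *
        stateSeq (waveTraj h u z₀ s) (Sum.inl k) + u s * stateSeq (stateInput h) (Sum.inl k)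
      - ((stateRate (Sum.inr k) : ℂ) * Complex.I *
        stateSeq (waveTraj h u z₀ s) (Sum.inr k) + u s * stateSeq (stateInput h) (Sum.inr k)))
      = -(dtn k * coeff (waveTraj h u z₀ s).fst.toH k) + u s * coeff (waveInput h) k := fun s => by
    have e1 := congrFun (stateRate_mul_stateSeq (waveTraj h u z₀ s))
    rw [add_sub_add_comm, mul_add, e1, e1, pmSeq_snd, stateSeq_stateInput_inl,
      stateSeq_stateInput_inr]
    linear_combination (-2 * Complex.I ^ 2 * u s * coeff (waveInput h) k) * rsqrtTwo_mul_self
      - u s * coeff (waveInput h) k * Complex.I_sq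
  simp only [e] at h3
  exact h3.symm

end Coefficients

/-! ### Regularity of trajectories and of solutions -/

section Regularity

/-- The velocity of the first component of a trajectory, and its regularity. -/
lemma contDiffOn_and_velocity_eq {ζ : ℝ → HAlpha (1 / 2)} {w : ℝ → H}
    (hw : ContinuousOn w (Ici 0))
    (hζ : ∀ k t, 0 ≤ t → coeff (ζ t).toH k
      = coeff (ζ 0).toH k + ∫ s in (0 : ℝ)..t, coeff (w s) k) :
    ContDiffOn ℝ 1 (fun t => (ζ t).toH) (Ici 0) ∧ ∀ t, 0 ≤ t → velocity ζ t = w t := by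
  -- Extending w to negative times by its value at 0 makes the primitive C¹ on the whole line, so
  -- the one-sided derivative at 0 needs no separate argument.
  set v : ℝ → H := fun s => w (max s 0) with hv
  have hvc : Continuous v :=
    hw.comp_continuous (by fun_prop) fun s => le_max_right s 0
  set G : ℝ → H := fun t => (ζ 0).toH + ∫ s in (0 : ℝ)..t, v s with hG
  have hd : ∀ t, HasDerivAt G (v t) t := fun t =>
    ((hvc.integral_hasStrictDerivAt 0 t).hasDerivAt).const_add _
  have heq : EqOn (fun t => (ζ t).toH) G (Ici 0) := fun t ht => by
    refine ext_coeff fun k => ?_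
    have h1 := (coeffL k).intervalIntegral_comp_comm (hvc.intervalIntegrable (μ := volume) 0 t)
    rw [hζ k t ht, hG]
    simp only [coeff_add]
    rw [← coeffL_apply k (∫ s in (0 : ℝ)..t, v s), ← h1]
    congr 1
    refine intervalIntegral.integral_congr fun s hs => ?_
    rw [uIcc_of_le (mem_Ici.1 ht)] at hs
    rw [coeffL_apply, hv]
    simp only [max_eq_left hs.1]
  refine ⟨?_, fun t ht => ?_⟩
  · have hG1 : ContDiff ℝ 1 G := by
      rw [contDiff_one_iff_deriv]
      exact ⟨fun t => (hd t).differentiableAt, by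
        rw [show deriv G = v from funext fun t => (hd t).deriv]; exact hvc⟩
    exact hG1.contDiffOn.congr heq
  · have h1 := ((hd t).hasDerivWithinAt (s := Ici 0)).congr heq (heq ht)
    rw [velocity, h1.derivWithin (uniqueDiffOn_Ici 0 t ht), hv]
    simp only [max_eq_left ht]

variable {h : L2Side} {u : ℝ → ℂ} {φ : ℝ → H1Omega} {ζ : ℝ → HAlpha (1 / 2)}

lemma IsSolution.continuousOn_velocity (hs : IsSolution h u φ ζ) :
    ContinuousOn (velocity ζ) (Ici 0) :=
  hs.zeta_diff.continuousOn_derivWithin (uniqueDiffOn_Ici 0) le_rfl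

lemma IsSolution.coeff_zeta (hs : IsSolution h u φ ζ) (k : ℕ+) {t : ℝ} (ht : 0 ≤ t) :
    coeff (ζ t).toH k = coeff (ζ 0).toH k + ∫ s in (0 : ℝ)..t, coeff (velocity ζ s) k := by
  have hI : Icc 0 t ⊆ Ici 0 := fun x hx => hx.1
  have h1 : ContinuousOn (fun s => coeffL k (velocity ζ s)) (Icc 0 t) :=
    (coeffL k).continuous.comp_continuousOn (hs.continuousOn_velocity.mono hI)
  have h2 : ∀ x ∈ Ioo 0 t, HasDerivAt (fun s => coeffL k (ζ s).toH) (coeffL k (velocity ζ x)) x := by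
    intro x hx
    have h3 : HasDerivWithinAt (fun s => (ζ s).toH) (velocity ζ x) (Ici 0) x :=
      ((hs.zeta_diff.differentiableOn one_ne_zero) x hx.1.le).hasDerivWithinAt
    exact ((coeffL k).restrictScalars ℝ).hasFDerivAt.comp_hasDerivAt x
      (h3.hasDerivAt (Ici_mem_nhds hx.1))
  have h4 := intervalIntegral.integral_eq_sub_of_hasDerivAt_of_le ht
    ((coeffL k).continuous.comp_continuousOn (hs.zeta_diff.continuousOn.mono hI)) h2
    (by rw [← uIcc_of_le ht] at h1; exact h1.intervalIntegrable)
  simp only [coeffL_apply, Function.comp_apply] at h4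
  rw [h4, add_sub_cancel]

lemma MemL2Loc.intervalIntegrable_clm {E : Type*} [NormedAddCommGroup E] [NormedSpace ℂ E]
    {f : ℝ → E} (hf : MemL2Loc f) (l : E →L[ℂ] ℂ) {t : ℝ} (ht : 0 ≤ t) :
    IntervalIntegrable (fun s => l (f s)) volume 0 t :=
  MemL2Loc.intervalIntegrable (fun T hT => l.comp_memLp' (hf T hT)) ht

/-- Test the weak equation with `harm k`. Green's formula expresses the Dirichlet pairing by the top
trace alone, and the trace condition, valid for almost every time, replaces it by -ζ; the potential
is thereby eliminated. -/
lemma IsSolution.coeff_velocity (hs : IsSolution h u φ ζ) (hu : MemL2Loc u) (k : ℕ+) {t : ℝ}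
    (ht : 0 ≤ t) :
    coeff (velocity ζ t) k = coeff (velocity ζ 0) k + ∫ s in (0 : ℝ)..t,
      (-(dtn k * coeff (ζ s).toH k) + u s * coeff (waveInput h) k) := by
  rcases ht.eq_or_lt with rfl | ht
  · simp
  have h1 := hs.weak_eq (harm k) _ _ (isTopTrace_harm k) (isLeftTrace_harm k) t ht
  have h2 : ∫ s in (0 : ℝ)..t, (-(dtn k * coeff (ζ s).toH k) + u s * coeff (waveInput h) k)
      = (∫ s in (0 : ℝ)..t, gradPairing (φ s) (harm k))
        - ∫ s in (0 : ℝ)..t, u s * ⟪((cosX k 0 : ℝ) : ℂ) • sideFun (coshY k), h⟫_ℂ := by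
    have hi : IntervalIntegrable (fun s => gradPairing (φ s) (harm k)) volume 0 t :=
      hs.phi_mem.intervalIntegrable_clm (gradFunctional (harm k)) ht.le
    rw [← intervalIntegral.integral_sub hi ((hu.intervalIntegrable ht.le).mul_const _)]
    have h3 := ae_restrict_iff' (μ := volume) measurableSet_Ici |>.1 hs.trace_eq
    refine intervalIntegral.integral_congr_ae ?_
    filter_upwards [h3] with s h3 hst
    rw [uIoc_of_le ht.le] at hst
    rw [gradPairing_harm k (h3 hst.1.le), coeff_waveInput', inner_neg_right]
    change _ = dtn k * -(coeff (ζ s).toH k) - _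
    ring
  rw [h2, ← h1]
  exact (add_sub_cancel _ _).symm

/-- Solutions are trajectories of the control system. -/
lemma IsSolution.eq_waveTraj (hs : IsSolution h u φ ζ) (hu : MemL2Loc u) {τ : ℝ} (hτ : 0 ≤ τ) :
    (WithLp.toLp 2 (ζ τ, velocity ζ τ) : StateSpace)
      = waveTraj h u (WithLp.toLp 2 (ζ 0, velocity ζ 0)) τ :=
  eq_waveTraj_of_coeff (z := fun t => WithLp.toLp 2 (ζ t, velocity ζ t)) hu
    (fun k => (coeffL k).continuous.comp_continuousOn hs.zeta_diff.continuousOn)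
    (fun k => (coeffL k).continuous.comp_continuousOn hs.continuousOn_velocity)
    (fun k _ ht => hs.coeff_zeta k ht) (fun k _ ht => hs.coeff_velocity hu k ht) hτ

end Regularity

/-! ### Existence and uniqueness -/

lemma memL2Loc_of_continuousOn {E : Type*} [NormedAddCommGroup E] {f : ℝ → E}
    (hf : ContinuousOn f (Ici 0)) : MemL2Loc f := by
  intro T _
  have h1 : ContinuousOn f (Icc 0 T) := hf.mono fun x hx => hx.1
  obtain ⟨C, hC⟩ := isCompact_Icc.exists_bound_of_continuousOn h1
  exact MemLp.of_bound (h1.aestronglyMeasurable measurableSet_Icc) C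
    ((ae_restrict_iff' measurableSet_Icc).2 (Eventually.of_forall hC))

lemma exists_isSolution (h : L2Side) (hmean : ∫ y in Icc (-1 : ℝ) 0, h y = 0) {u : ℝ → ℂ}
    (hu : MemL2Loc u) (ζ₀ : HAlpha (1 / 2)) (w₀ : H) :
    ∃ (φ : ℝ → H1Omega) (ζ : ℝ → HAlpha (1 / 2)),
      IsSolution h u φ ζ ∧ ζ 0 = ζ₀ ∧ velocity ζ 0 = w₀ := by
  obtain ⟨N, hN, hP⟩ := exists_wave_potential h hmean
  set z₀ : StateSpace := WithLp.toLp 2 (ζ₀, w₀) with hz₀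
  set ζ : ℝ → HAlpha (1 / 2) := fun t => (waveTraj h u z₀ t).fst with hζ
  set w : ℝ → H := fun t => (waveTraj h u z₀ t).snd with hw
  have hζc : ContinuousOn ζ (Ici 0) := continuousOn_waveTraj_fst hu z₀
  have hwc : ContinuousOn w (Ici 0) := continuousOn_waveTraj_snd hu z₀
  have hζ0 : ζ 0 = ζ₀ := by
    rw [hζ]; simp only [waveTraj_zero]; rfl
  have hw0 : w 0 = w₀ := by
    rw [hw]; simp only [waveTraj_zero]; rfl
  obtain ⟨hdiff, hvel⟩ := contDiffOn_and_velocity_eq (ζ := ζ) hwc fun k t ht => by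
    rw [hζ0]
    exact coeff_waveTraj_fst hu z₀ k ht
  -- The first term carries the trace -ζ and the second the wave maker. As N vanishes on the top, it
  -- does not disturb the trace condition.
  refine ⟨fun t => -dirExt (ζ t) + u t • N, ζ, ⟨?_, hζc, hdiff, ?_, ?_⟩, hζ0, ?_⟩
  · intro T hT
    refine MemLp.add (memL2Loc_of_continuousOn (f := fun t => -dirExt (ζ t))
      (dirExt.continuous.comp_continuousOn hζc).neg T hT) ?_
    exact (ContinuousLinearMap.toSpanSingleton ℂ N).comp_memLp' (hu T hT)
  · refine Eventually.of_forall fun t => ?_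
    have h1 := (isTopTrace_dirExt (ζ t)).neg.add (hN.smul (u t))
    rwa [smul_zero, add_zero] at h1
  · intro Ψ g g' hg hg' t ht
    have hi : IntervalIntegrable ζ volume 0 t := by
      refine (hζc.mono fun x hx => ?_).intervalIntegrable
      rw [uIcc_of_le ht.le] at hx
      exact hx.1
    -- Integrating ζ in H_{1/2} before expanding avoids exchanging the series over the modes with
    -- the time integral.
    set Z : HAlpha (1 / 2) := ∫ s in (0 : ℝ)..t, ζ s with hZ
    have e1 : ∫ s in (0 : ℝ)..t, gradPairing (-dirExt (ζ s) + u s • N) Ψ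
        = -gradPairing (dirExt Z) Ψ + (∫ s in (0 : ℝ)..t, u s) * gradPairing N Ψ := by
      have h1 := ((gradFunctional Ψ).comp dirExt).intervalIntegral_comp_comm hi
      have h2 : ∀ s, gradPairing (-dirExt (ζ s) + u s • N) Ψ
          = -((gradFunctional Ψ).comp dirExt (ζ s)) + u s * gradPairing N Ψ := fun s => by
        rw [← gradFunctional_apply, map_add, map_neg, map_smul]
        rfl
      simp only [h2]
      rw [intervalIntegral.integral_add ?_ ((hu.intervalIntegrable ht.le).mul_const _),
        intervalIntegral.integral_neg, h1, intervalIntegral.integral_mul_const]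
      · rfl
      · refine IntervalIntegrable.neg (ContinuousOn.intervalIntegrable
          (((gradFunctional Ψ).comp dirExt).continuous.comp_continuousOn (hζc.mono fun x hx => ?_)))
        rw [uIcc_of_le ht.le] at hx
        exact hx.1
    have e2 : ∀ k, coeff (w t - w 0) k
        = -(dtn k * coeff Z.toH k) + (∫ s in (0 : ℝ)..t, u s) * coeff (waveInput h) k := by
      intro k
      have h1 := (HAlpha.coeffL k).intervalIntegral_comp_comm hi
      have h2 : IntervalIntegrable (fun s => coeff (ζ s).toH k) volume 0 t := by
        simp only [← HAlpha.coeffL_apply]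
        refine ContinuousOn.intervalIntegrable
          ((HAlpha.coeffL k).continuous.comp_continuousOn (hζc.mono fun x hx => ?_))
        rw [uIcc_of_le ht.le] at hx
        exact hx.1
      have h4 : IntervalIntegrable (fun s => -(dtn k * coeff (ζ s).toH k)) volume 0 t :=
        (h2.const_mul _).neg
      have h3 := coeff_waveTraj_snd (h := h) hu z₀ k ht.le
      simp only [HAlpha.coeffL_apply] at h1
      rw [← coeffL_apply, map_sub, coeffL_apply, coeffL_apply, hw0, hZ, ← h1]
      rw [intervalIntegral.integral_add h4 ((hu.intervalIntegrable ht.le).mul_const _), intervalIntegral.integral_neg,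
        intervalIntegral.integral_const_mul, intervalIntegral.integral_mul_const] at h3
      rw [sub_eq_iff_eq_add']
      exact h3
    -- The coefficient equations are summed against the coefficients of g by Parseval's identity.
    have e3 : ⟪g, ((w t - w 0 : H) : L2Top)⟫_ℂ = -gradPairing (dirExt Z) Ψ
        + (∫ s in (0 : ℝ)..t, u s) * ⟪g, (waveInput h : L2Top)⟫_ℂ := by
      refine (hasSum_inner_coeff g (w t - w 0)).unique ?_
      refine ((hasSum_gradPairing_dirExt Z hg).neg.add
        ((hasSum_inner_coeff g (waveInput h)).mul_left _)).congr_fun fun k => ?_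
      rw [e2]
      ring
    rw [hvel t ht.le, hvel 0 le_rfl, ← inner_sub_right, e1, hP Ψ g g' hg hg',
      intervalIntegral.integral_mul_const]
    refine e3.trans ?_
    ring
  · rw [hvel 0 le_rfl, hw0]

/-- By Lebesgue differentiation f is almost everywhere the derivative of its primitive, which is
constant near each t > 0. -/
lemma ae_eq_zero_of_integral_eq_zero {f : ℝ → ℂ}
    (hf : ∀ T : ℝ, 0 < T → IntervalIntegrable f volume 0 T)
    (h : ∀ t : ℝ, 0 < t → ∫ s in (0 : ℝ)..t, f s = 0) :
    ∀ᵐ t ∂(volume.restrict (Ici (0 : ℝ))), f t = 0 := by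
  have h1 : ∀ n : ℕ, ∀ᵐ t, t ∈ uIcc (0 : ℝ) (n + 1 : ℝ) → ∀ c ∈ uIcc (0 : ℝ) (n + 1 : ℝ),
      HasDerivAt (fun x => ∫ s in c..x, f s) (f t) t := fun n =>
    (hf _ (by positivity)).ae_hasDerivAt_integral
  have h0 : ∀ᵐ t : ℝ, t ≠ 0 := by
    simp [ae_iff, measure_singleton]
  rw [ae_restrict_iff' measurableSet_Ici]
  filter_upwards [ae_all_iff.2 h1, h0] with t ht ht0 htI
  have htp : 0 < t := lt_of_le_of_ne htI (Ne.symm ht0)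
  obtain ⟨n, hn⟩ := exists_nat_gt t
  have hle : (0 : ℝ) ≤ n + 1 := by positivity
  have h2 := ht n (by rw [uIcc_of_le hle]; exact ⟨htp.le, by linarith⟩) 0 left_mem_uIcc
  have h3 : HasDerivAt (fun x => ∫ s in (0 : ℝ)..x, f s) 0 t := by
    refine (hasDerivAt_const t (0 : ℂ)).congr_of_eventuallyEq ?_
    filter_upwards [Ioi_mem_nhds htp] with x hx
    exact h x hx
  exact h2.unique h3

/-- Both solutions follow the same trajectory, so ζ' = ζ. Subtracting the weak equations for the
eigenfunctions with zero top trace removes the velocity and input terms. For almost every t the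
difference of the potentials then has zero trace and vanishing pairing with all of them. -/
lemma IsSolution.eq_of_initial_eq {h : L2Side} {u : ℝ → ℂ} (hu : MemL2Loc u)
    {φ φ' : ℝ → H1Omega} {ζ ζ' : ℝ → HAlpha (1 / 2)} (hs : IsSolution h u φ ζ)
    (hs' : IsSolution h u φ' ζ') (h0 : ζ' 0 = ζ 0) (h1 : velocity ζ' 0 = velocity ζ 0) :
    φ' =ᵐ[volume.restrict (Ici (0 : ℝ))] φ ∧ EqOn ζ' ζ (Ici 0) := by
  have hζ : EqOn ζ' ζ (Ici 0) := fun t ht => by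
    have e1 := hs'.eq_waveTraj hu (mem_Ici.1 ht)
    rw [h0, h1, ← hs.eq_waveTraj hu (mem_Ici.1 ht)] at e1
    exact congrArg (fun z : StateSpace => z.fst) e1
  refine ⟨?_, hζ⟩
  have key : ∀ k m : ℕ, ∀ᵐ t ∂(volume.restrict (Ici (0 : ℝ))),
      gradPairing (φ' t - φ t) (prodH1 (contDiff_cosX k) (contDiff_cosY m)) = 0 := by
    intro k m
    set Ψ := prodH1 (contDiff_cosX k) (contDiff_cosY m)
    have i1 := fun T (hT : (0 : ℝ) < T) =>
      hs.phi_mem.intervalIntegrable_clm (gradFunctional Ψ) hT.le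
    have i2 := fun T (hT : (0 : ℝ) < T) =>
      hs'.phi_mem.intervalIntegrable_clm (gradFunctional Ψ) hT.le
    simp only [← gradFunctional_apply, map_sub]
    refine ae_eq_zero_of_integral_eq_zero (fun T hT => (i2 T hT).sub (i1 T hT)) fun t ht => ?_
    have w1 := hs.weak_eq Ψ 0 _ (isTopTrace_eigen k m) (isLeftTrace_prodH1 _ _) t ht
    have w2 := hs'.weak_eq Ψ 0 _ (isTopTrace_eigen k m) (isLeftTrace_prodH1 _ _) t ht
    rw [intervalIntegral.integral_sub (i2 t ht) (i1 t ht)]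
    simp only [inner_zero_left] at w1 w2
    simp only [gradFunctional_apply]
    linear_combination w1 - w2
  filter_upwards [hs.trace_eq, hs'.trace_eq, ae_all_iff.2 fun k => ae_all_iff.2 fun m => key k m,
    ae_restrict_mem measurableSet_Ici] with t t1 t2 hk ht
  rw [← sub_eq_zero]
  refine eq_zero_of_gradPairing_eigen ?_ hk
  have := t2.sub t1
  rwa [hζ ht, sub_self] at this

end WaterWave
end

/-! ### Assembly of the theorem. -/

open WaterWave
theorem theorem2p3 (h : L2Side) (hmean : ∫ y in Set.Icc (-1 : ℝ) 0, h y = 0) :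
    -- existence and uniqueness of the solution
    (∀ u : ℝ → ℂ, MemL2Loc u → ∀ (ζ₀ : HAlpha (1 / 2)) (w₀ : H),
      ∃ (φ : ℝ → H1Omega) (ζ : ℝ → HAlpha (1 / 2)),
        (IsSolution h u φ ζ ∧ ζ 0 = ζ₀ ∧ velocity ζ 0 = w₀) ∧
        ∀ (φ' : ℝ → H1Omega) (ζ' : ℝ → HAlpha (1 / 2)),
          IsSolution h u φ' ζ' → ζ' 0 = ζ₀ → velocity ζ' 0 = w₀ →
            φ' =ᵐ[volume.restrict (Set.Ici (0 : ℝ))] φ ∧ Set.EqOn ζ' ζ (Set.Ici 0)) ∧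
    -- the well-posed linear control system
    ∃ S : WellPosedSystem ℂ StateSpace,
      (∀ (u : ℝ → ℂ) (hu : MemL2Loc u) (φ : ℝ → H1Omega) (ζ : ℝ → HAlpha (1 / 2)),
        IsSolution h u φ ζ → ∀ τ : ℝ, 0 ≤ τ →
          (WithLp.toLp 2 (ζ τ, velocity ζ τ) : StateSpace)
            = S.T τ (WithLp.toLp 2 (ζ 0, velocity ζ 0)) + S.inputMap τ u hu) ∧
      -- the generator
      (∃ A : StateSpace →ₗ.[ℂ] StateSpace, S.IsGenerator A ∧
        (∀ z : StateSpace, z ∈ A.domain ↔ z.fst.toH ∈ HScale 1 ∧ z.snd ∈ HScale (1 / 2)) ∧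
        IsEquivalentInnerProduct energyInner ∧ IsSkewAdjointWrt energyInner A) ∧
      -- the bounded control operator
      ∃ B : ℂ →L[ℂ] StateSpace, ∀ τ : ℝ, 0 ≤ τ → ∀ (u : ℝ → ℂ) (hu : MemL2Loc u),
        IntervalIntegrable (fun σ => S.T (τ - σ) (B (u σ))) volume 0 τ ∧
        S.inputMap τ u hu = ∫ σ in (0 : ℝ)..τ, S.T (τ - σ) (B (u σ)) := by
  refine ⟨fun u hu ζ₀ w₀ => ?_, waveSystem h, fun u hu φ ζ hs τ hτ => ?_,
    ⟨diagGen stateEquiv stateRate, mem_diagGen_graph_iff_tendsto _ _, mem_domain_iff,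
      isEquivalentInnerProduct_energyInner, ?_⟩,
    ContinuousLinearMap.toSpanSingleton ℂ (stateInput h), fun τ hτ u hu => ?_⟩
  · obtain ⟨φ, ζ, hs, h0, h1⟩ := exists_isSolution h hmean hu ζ₀ w₀
    exact ⟨φ, ζ, ⟨hs, h0, h1⟩, fun φ' ζ' hs' h0' h1' =>
      hs.eq_of_initial_eq hu hs' (h0'.trans h0.symm) (h1'.trans h1.symm)⟩
  · rw [hs.eq_waveTraj hu hτ, waveTraj_eq h hu _ hτ]
  · have e : energyInner = fun z z' => inner ℂ (stateEquiv z) (stateEquiv z') :=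
      funext fun z => funext fun z' => energyInner_eq z z'
    rw [e]
    exact isSkewAdjointWrt_diagGen _ _
  · have e : ∀ σ, (waveSystem h).T (τ - σ)
        (ContinuousLinearMap.toSpanSingleton ℂ (stateInput h) (u σ))
        = u σ • diagGroup stateEquiv stateRate (τ - σ) (stateInput h) := fun σ => by
      rw [ContinuousLinearMap.toSpanSingleton_apply, map_smul]
      rfl
    simp only [e]
    exact ⟨intervalIntegrable_smul_diagGroup _ _ _ τ (hu.intervalIntegrable hτ),
      diagSystem_inputMap _ _ _ hu hτ⟩
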